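/- **Corollary (Dimension Formula).** Let $T$ be a semisimple tensor category over $\mathbb{C}$ (a $\mathbb{C}$-linear abelian monoidal category with bilinear tensor product and finite-dimensional Hom spaces, in which every object is a finite direct sum of simple objects and $\mathrm{End}(I)=\mathbb{C}$), furnished with a Frobenius duality: each object $X$ has a dual $X^*$ with rigidity pairs given by $\epsilon_X:X\otimes X^*\to I$ and, identifying $X^{**}=X$, $\epsilon_{X^*}:X^*\otimes X\to I$, which are natural (left and right transposes of morphisms coincide), multiplicative ($\epsilon_{X\otimes Y}=\epsilon_X(1\otimes\epsilon_Y\otimes 1)$ under $(X\otimes Y)^*=Y^*\otimes X^*$, and likewise for $\epsilon_{(X\otimes Y)^*}$) and neutral (left and right traces of endomorphisms coincide). The dimension $\dim(X)\in\mathbb{C}$ of an object $X$ is the scalar $I\to X\otimes X^*\to I$. A finite-dimensional semisimple complex Hopf algebra $A$ is realized in $T$ by a fully faithful linear monoidal functor $F$ from the category of finite-dimensional $A$-modules to $T$ such that $\dim F(V)=\dim V$ for all $V$. Put $|A|=\dim A$ and $\mathbb{A}=\bigoplus_V F(V)\otimes V^*=F(A^*)$ ($V$ running through the irreducible $A$-modules;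 $A^*$ is an $A$-module by $(af)(b)=f(ba)$). Let $B$ be likewise realized by $G$, with $\mathbb{B}=\bigoplus_W G(W)\otimes W^*$. An $A$-$B$ module in $T$ is an object $X$ with natural isomorphisms $F(V)\otimes X\cong X\otimes V$ and $X\otimes G(W)\cong W\otimes X$ (multiples of $X$ by the underlying vector spaces) that are multiplicative, unital and commute with each other. Such modules are the 1-morphisms of the bicategory $M(T)$ whose objects are the realized Hopf algebras, with composition $X\otimes_B Y$, unit $\mathbb{A}$, and unit constraints $\mathbb{A}\otimes X\to X$, $X\otimes\mathbb{B}\to X$ obtained from the actions $F(V)\otimes V^*\otimes X\to X\otimes V\otimes V^*\to X$ and $X\otimes G(W)\otimes W^*\to W\otimes X\otimes W^*\to X$ by multiplication by $|A|^{-1/2}$ and $|B|^{-1/2}$. For an $A$-$B$ module $X$ let $X^*$ be the $B$-$A$ module whose trivializing isomorphisms are the transposes of those of $X$, and let $\epsilon:X\otimes_B X^*\to\mathbb{A}$ be induced by the sum over the irreducible $V$, with weight $\dim V$, of $$X\otimes X^*\to X\otimes V\otimes V^*\otimes X^*\to F(V)\otimes X\otimes X^*\otimes V^*\xrightarrow{\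 \epsilon_X\ }F(V)\otimes V^*;$$ let $\epsilon':X^*\otimes_A X\to\mathbb{B}$ be defined in the same way from $X^*$ and $\epsilon_{X^*}$. Then $X^*$ is well defined, and $|A|^{-1/4}|B|^{-1/4}\epsilon$ and $|A|^{-1/4}|B|^{-1/4}\epsilon'$ are well defined and belong to rigidity pairs in $M(T)$ (the normalized Frobenius duality), and with the copairings $\mathbb{A}\to X\otimes_B X^*$ and $\mathbb{B}\to X^*\otimes_A X$ of these pairs both composites $$\mathbb{A}\to X\otimes_B X^*\to\mathbb{A},\qquad \mathbb{B}\to X^*\otimes_A X\to\mathbb{B}$$ are equal to the identity multiplied by $$\dim({}_AX_B)=\frac{\dim(X)}{|A|^{1/2}\,|B|^{1/2}},$$ where $\dim(X)$ is the dimension of $X$ as an object of $T$. -/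

import Mathlib

open CategoryTheory MonoidalCategory Limits
open scoped TensorProduct

universe v u

set_option linter.unusedSectionVars false

noncomputable section

namespace HopfBicat

/-! ### Finite-dimensional modules over a complex Hopf algebra -/

/-- A finite-dimensional (left) module over a complex algebra `A`. -/
structure HRep (A : Type) [Ring A] [Algebra ℂ A] where
  carrier : Type
  [addCommGroup : AddCommGroup carrier]
  [module : Module ℂ carrier]
  [finite : FiniteDimensional ℂ carrier]
  ρ : A →ₐ[ℂ] Module.End ℂ carrier

namespace HRep

instance coeSort (A : Type) [Ring A] [Algebra ℂ A] : CoeSort (HRep A) Type := ⟨HRep.carrier⟩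

attribute [instance] HRep.addCommGroup HRep.module HRep.finite

section Category

variable {A : Type} [Ring A] [Algebra ℂ A]

/-- The space of `A`-linear maps. -/
def homs (V W : HRep A) : Submodule ℂ (V →ₗ[ℂ] W) where
  carrier := {f | ∀ a, f ∘ₗ V.ρ a = W.ρ a ∘ₗ f}
  add_mem' := fun {f g} hf hg a => by
    rw [LinearMap.add_comp, LinearMap.comp_add, hf a, hg a]
  zero_mem' := fun a => by rw [LinearMap.zero_comp, LinearMap.comp_zero]
  smul_mem' := fun c f hf a => by rw [LinearMap.smul_comp, LinearMap.comp_smul, hf a]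

instance category : Category (HRep A) where
  Hom V W := homs V W
  id V := ⟨LinearMap.id, fun _ => rfl⟩
  comp f g := ⟨g.1 ∘ₗ f.1, fun a => by
    rw [LinearMap.comp_assoc, f.2 a, ← LinearMap.comp_assoc, g.2 a, LinearMap.comp_assoc]⟩

/-- The linear map underlying a morphism. -/
def lin {V W : HRep A} (f : V ⟶ W) : V →ₗ[ℂ] W := Subtype.val (p := (· ∈ homs V W)) f

/-- An `A`-linear map as a morphism. -/
def ofLin {V W : HRep A} (f : V →ₗ[ℂ] W) (h : ∀ a, f ∘ₗ V.ρ a = W.ρ a ∘ₗ f) : V ⟶ W :=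
  (⟨f, h⟩ : homs V W)

theorem lin_comm {V W : HRep A} (f : V ⟶ W) (a : A) : lin f ∘ₗ V.ρ a = W.ρ a ∘ₗ lin f :=
  Subtype.property (p := (· ∈ homs V W)) f a

@[ext] theorem hom_ext {V W : HRep A} {f g : V ⟶ W} (h : lin f = lin g) : f = g :=
  Subtype.ext h

@[simp] theorem lin_ofLin {V W : HRep A} (f : V →ₗ[ℂ] W) (h) : lin (ofLin (V := V) (W := W) f h) = f :=
  rfl
@[simp] theorem lin_id (V : HRep A) : lin (𝟙 V) = LinearMap.id := rfl
@[simp] theorem lin_comp {U V W : HRep A} (f : U ⟶ V) (g : V ⟶ W) :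
    lin (f ≫ g) = lin g ∘ₗ lin f := rfl

instance preadditive : Preadditive (HRep A) where
  homGroup V W := inferInstanceAs (AddCommGroup (homs V W))
  add_comp _ _ _ _ _ _ := Subtype.ext (LinearMap.comp_add _ _ _)
  comp_add _ _ _ _ _ _ := Subtype.ext (LinearMap.add_comp _ _ _)

instance linear : Linear ℂ (HRep A) where
  homModule V W := inferInstanceAs (Module ℂ (homs V W))
  smul_comp _ _ _ c f g := Subtype.ext (LinearMap.comp_smul g.1 c f.1)
  comp_smul _ _ _ f c g := Subtype.ext (LinearMap.smul_comp c g.1 f.1)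

/-- A linear isomorphism that is `A`-linear, as an isomorphism. -/
def mkIso {V W : HRep A} (e : V ≃ₗ[ℂ] W)
    (h : ∀ a, (e : V →ₗ[ℂ] W) ∘ₗ V.ρ a = W.ρ a ∘ₗ (e : V →ₗ[ℂ] W)) : V ≅ W where
  hom := ofLin (e : V →ₗ[ℂ] W) h
  inv := ofLin (e.symm : W →ₗ[ℂ] V) fun a => by
    ext w
    have := LinearMap.congr_fun (h a) (e.symm w)
    simp only [LinearMap.comp_apply, LinearEquiv.coe_coe, LinearEquiv.apply_symm_apply] at this ⊢
    rw [← this, LinearEquiv.symm_apply_apply]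
  hom_inv_id := by ext x; simp
  inv_hom_id := by ext x; simp

end Category

section Monoidal

variable {A : Type} [Ring A] [HopfAlgebra ℂ A]

/-- The action of `A ⊗ A` on `V ⊗ W`. -/
def act₂ (V W : HRep A) : A ⊗[ℂ] A →ₐ[ℂ] Module.End ℂ (V ⊗[ℂ] W) :=
  (Module.endTensorEndAlgHom (R := ℂ) (S := ℂ) (A := ℂ) (M := V) (N := W)).comp
    (Algebra.TensorProduct.map V.ρ W.ρ)

theorem act₂_tmul (V W : HRep A) (a b : A) :
    act₂ V W (a ⊗ₜ b) = TensorProduct.map (V.ρ a) (W.ρ b) := by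
  simp only [act₂, AlgHom.comp_apply, Algebra.TensorProduct.map_tmul]
  rfl

/-- The tensor product, on which `a` acts through its comultiplication. -/
def tensor (V W : HRep A) : HRep A where
  carrier := V ⊗[ℂ] W
  ρ := (act₂ V W).comp (Bialgebra.comulAlgHom ℂ A)

/-- The trivial module `ℂ`, on which `a` acts through its counit. -/
def triv (A : Type) [Ring A] [HopfAlgebra ℂ A] : HRep A where
  carrier := ℂ
  ρ := (Algebra.ofId ℂ (Module.End ℂ ℂ)).comp (Bialgebra.counitAlgHom ℂ A)

theorem tensor_ρ (V W : HRep A) (a : A) :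
    (tensor V W).ρ a = act₂ V W (Coalgebra.comul (R := ℂ) a) := rfl

theorem triv_ρ (a : A) (z : ℂ) :
    (triv A).ρ a z = Coalgebra.counit (R := ℂ) a * z := rfl

theorem act₂_map {V V' W W' : HRep A} (f : V ⟶ V') (g : W ⟶ W') (t : A ⊗[ℂ] A) :
    TensorProduct.map (lin f) (lin g) ∘ₗ act₂ V W t =
      act₂ V' W' t ∘ₗ TensorProduct.map (lin f) (lin g) := by
  induction t with
  | zero => simp
  | add x y hx hy => rw [map_add, map_add, LinearMap.comp_add, hx, hy, LinearMap.add_comp]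
  | tmul a b =>
    rw [act₂_tmul, act₂_tmul, ← TensorProduct.map_comp, ← TensorProduct.map_comp,
      lin_comm, lin_comm]

/-- The tensor product of `A`-linear maps. -/
def tensorMap {V V' W W' : HRep A} (f : V ⟶ V') (g : W ⟶ W') : tensor V W ⟶ tensor V' W' :=
  ofLin (V := tensor V W) (W := tensor V' W') (TensorProduct.map (lin f) (lin g))
    fun a => act₂_map f g (Coalgebra.comul (R := ℂ) a)

/-- The action of `A ⊗ (A ⊗ A)` on `U ⊗ (V ⊗ W)`. -/
def act₃ (U V W : HRep A) : A ⊗[ℂ] (A ⊗[ℂ] A) →ₐ[ℂ] Module.End ℂ (U ⊗[ℂ] (V ⊗[ℂ] W)) :=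
  (Module.endTensorEndAlgHom (R := ℂ) (S := ℂ) (A := ℂ) (M := U) (N := V ⊗[ℂ] W)).comp
    (Algebra.TensorProduct.map U.ρ (act₂ V W))

theorem act₃_tmul (U V W : HRep A) (a : A) (t : A ⊗[ℂ] A) :
    act₃ U V W (a ⊗ₜ t) = TensorProduct.map (U.ρ a) (act₂ V W t) := by
  simp only [act₃, AlgHom.comp_apply, Algebra.TensorProduct.map_tmul]
  rfl

theorem act₂_right (U V W : HRep A) (t : A ⊗[ℂ] A) :
    act₂ U (tensor V W) t =
      act₃ U V W ((Coalgebra.comul (R := ℂ) (A := A)).lTensor A t) := by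
  induction t with
  | zero => simp only [map_zero]; rfl
  | add x y hx hy => rw [map_add, map_add, map_add, hx, hy]; rfl
  | tmul a b =>
    rw [act₂_tmul, LinearMap.lTensor_tmul, act₃_tmul]
    rfl

theorem assoc_act₂ (U V W : HRep A) (s : A ⊗[ℂ] A) (b : A) :
    (TensorProduct.assoc ℂ U V W : _ →ₗ[ℂ] _) ∘ₗ TensorProduct.map (act₂ U V s) (W.ρ b) =
      act₃ U V W (TensorProduct.assoc ℂ A A A (s ⊗ₜ b)) ∘ₗ
        (TensorProduct.assoc ℂ U V W : _ →ₗ[ℂ] _) := by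
  induction s with
  | zero => simp
  | add x y hx hy =>
    rw [map_add, TensorProduct.map_add_left, LinearMap.comp_add, hx, hy, TensorProduct.add_tmul,
      map_add, map_add, LinearMap.add_comp]
  | tmul a c =>
    rw [act₂_tmul, TensorProduct.assoc_tmul, act₃_tmul, act₂_tmul]
    ext u v w
    rfl

/-- The linear associativity isomorphism. -/
def assocLin (U V W : HRep A) :
    (tensor U V).carrier ⊗[ℂ] W.carrier ≃ₗ[ℂ] U.carrier ⊗[ℂ] (V.carrier ⊗[ℂ] W.carrier) :=
  TensorProduct.assoc ℂ U V W

theorem act₂_left (U V W : HRep A) (t : A ⊗[ℂ] A) :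
    (assocLin U V W).toLinearMap ∘ₗ act₂ (tensor U V) W t =
      act₃ U V W (TensorProduct.assoc ℂ A A A
          ((Coalgebra.comul (R := ℂ) (A := A)).rTensor A t)) ∘ₗ
        (assocLin U V W).toLinearMap := by
  induction t with
  | zero => simp only [map_zero, LinearMap.comp_zero, LinearMap.zero_comp]
  | add x y hx hy =>
    rw [map_add, map_add, map_add, map_add, LinearMap.add_comp, ← hx, ← hy]
    exact LinearMap.comp_add _ _ _
  | tmul a b =>
    rw [LinearMap.rTensor_tmul, act₂_tmul]
    exact assoc_act₂ U V W _ b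

/-- The associativity isomorphism. -/
def assocIso (U V W : HRep A) : tensor (tensor U V) W ≅ tensor U (tensor V W) :=
  mkIso (V := tensor (tensor U V) W) (W := tensor U (tensor V W))
    (assocLin U V W) fun a => by
      rw [tensor_ρ, tensor_ρ]
      refine (act₂_left U V W _).trans ?_
      rw [Coalgebra.coassoc_apply, ← act₂_right]
      rfl

/-- The linear unit isomorphism. -/
def lidLin (V : HRep A) : (triv A).carrier ⊗[ℂ] V.carrier ≃ₗ[ℂ] V.carrier :=
  TensorProduct.lid ℂ V

theorem lid_act₂ (V : HRep A) (t : A ⊗[ℂ] A) :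
    (lidLin V).toLinearMap ∘ₗ act₂ (triv A) V t =
      V.ρ (TensorProduct.lid ℂ A ((Coalgebra.counit (R := ℂ) (A := A)).rTensor A t)) ∘ₗ
        (lidLin V).toLinearMap := by
  induction t with
  | zero => simp only [map_zero, LinearMap.comp_zero, LinearMap.zero_comp]
  | add x y hx hy =>
    rw [map_add, map_add, map_add, map_add, LinearMap.add_comp, ← hx, ← hy]
    exact LinearMap.comp_add _ _ _
  | tmul a b =>
    rw [act₂_tmul]
    refine TensorProduct.ext' fun (z : ℂ) v => ?_
    rw [LinearMap.rTensor_tmul, TensorProduct.lid_tmul, map_smul]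
    change (Coalgebra.counit (R := ℂ) a * z) • V.ρ b v = Coalgebra.counit (R := ℂ) a • V.ρ b (z • v)
    rw [map_smul, mul_smul]

/-- The linear unit isomorphism. -/
def ridLin (V : HRep A) : V.carrier ⊗[ℂ] (triv A).carrier ≃ₗ[ℂ] V.carrier :=
  TensorProduct.rid ℂ V

theorem rid_act₂ (V : HRep A) (t : A ⊗[ℂ] A) :
    (ridLin V).toLinearMap ∘ₗ act₂ V (triv A) t =
      V.ρ (TensorProduct.rid ℂ A ((Coalgebra.counit (R := ℂ) (A := A)).lTensor A t)) ∘ₗ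
        (ridLin V).toLinearMap := by
  induction t with
  | zero => simp only [map_zero, LinearMap.comp_zero, LinearMap.zero_comp]
  | add x y hx hy =>
    rw [map_add, map_add, map_add, map_add, LinearMap.add_comp, ← hx, ← hy]
    exact LinearMap.comp_add _ _ _
  | tmul a b =>
    rw [act₂_tmul]
    refine TensorProduct.ext' fun v (z : ℂ) => ?_
    rw [LinearMap.lTensor_tmul, TensorProduct.rid_tmul, map_smul]
    change (Coalgebra.counit (R := ℂ) b * z) • V.ρ a v = Coalgebra.counit (R := ℂ) b • V.ρ a (z • v)
    rw [map_smul, mul_smul]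

/-- The left unit isomorphism. -/
def lidIso (V : HRep A) : tensor (triv A) V ≅ V :=
  mkIso (V := tensor (triv A) V) (lidLin V) fun a => by
    rw [tensor_ρ]
    refine (lid_act₂ V _).trans ?_
    rw [Coalgebra.rTensor_counit_comul, TensorProduct.lid_tmul, one_smul]
    rfl

/-- The right unit isomorphism. -/
def ridIso (V : HRep A) : tensor V (triv A) ≅ V :=
  mkIso (V := tensor V (triv A)) (ridLin V) fun a => by
    rw [tensor_ρ]
    refine (rid_act₂ V _).trans ?_
    rw [Coalgebra.lTensor_counit_comul, TensorProduct.rid_tmul, one_smul]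
    rfl

/-- The monoidal category of finite-dimensional modules over a Hopf algebra. -/
instance monoidal : MonoidalCategory (HRep A) where
  tensorObj := tensor
  whiskerLeft V _ _ g := tensorMap (𝟙 V) g
  whiskerRight f W := tensorMap f (𝟙 W)
  tensorHom := tensorMap
  tensorUnit := triv A
  associator := assocIso
  leftUnitor := lidIso
  rightUnitor := ridIso
  tensorHom_def _ _ := hom_ext (TensorProduct.ext' fun _ _ => rfl)
  id_tensorHom_id _ _ := hom_ext (TensorProduct.ext' fun _ _ => rfl)
  tensorHom_comp_tensorHom _ _ _ _ := hom_ext (TensorProduct.ext' fun _ _ => rfl)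
  whiskerLeft_id _ _ := hom_ext (TensorProduct.ext' fun _ _ => rfl)
  id_whiskerRight _ _ := hom_ext (TensorProduct.ext' fun _ _ => rfl)
  associator_naturality _ _ _ := hom_ext (TensorProduct.ext_threefold fun _ _ _ => rfl)
  leftUnitor_naturality f := hom_ext (TensorProduct.ext' fun z v =>
    ((lin f).map_smul z v).symm)
  rightUnitor_naturality f := hom_ext (TensorProduct.ext' fun v z =>
    ((lin f).map_smul z v).symm)
  pentagon _ _ _ _ := hom_ext (TensorProduct.ext_fourfold fun _ _ _ _ => rfl)
  triangle _ _ := hom_ext (TensorProduct.ext_threefold fun v z w =>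
    (TensorProduct.smul_tmul (R := ℂ) (R' := ℂ) z v w).symm)

/-- The action `(a · f)(b) = f(ba)` of `A` on the dual space `A^*`. -/
def funsAct (A : Type) [Ring A] [HopfAlgebra ℂ A] : A →ₐ[ℂ] Module.End ℂ (Module.Dual ℂ A) :=
  AlgHom.ofLinearMap
    { toFun := fun a => Module.Dual.transpose (R := ℂ) (LinearMap.mulRight ℂ a)
      map_add' := fun a b => by
        ext f c
        simp [Module.Dual.transpose_apply, mul_add]
      map_smul' := fun z a => by
        ext f c
        simp [Module.Dual.transpose_apply] }
    (by ext f c; simp [Module.Dual.transpose_apply])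
    (fun a b => by ext f c; simp [Module.Dual.transpose_apply, mul_assoc])

theorem funsAct_apply (a b : A) (f : Module.Dual ℂ A) : funsAct A a f b = f (b * a) := rfl

/-- The product of `f` and `g` in `A^*`, that is, `a ↦ ∑ f(a₁) g(a₂)`. -/
def convMul : Module.Dual ℂ A ⊗[ℂ] Module.Dual ℂ A →ₗ[ℂ] Module.Dual ℂ A :=
  (Coalgebra.comul (R := ℂ) (A := A)).dualMap ∘ₗ TensorProduct.dualDistrib ℂ A A

theorem dualDistrib_act (t s : A ⊗[ℂ] A) (x : Module.Dual ℂ A ⊗[ℂ] Module.Dual ℂ A) :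
    TensorProduct.dualDistrib ℂ A A
        (Module.endTensorEndAlgHom (R := ℂ) (S := ℂ) (A := ℂ)
          (Algebra.TensorProduct.map (funsAct A) (funsAct A) t) x) s =
      TensorProduct.dualDistrib ℂ A A x (s * t) := by
  induction t with
  | zero => simp
  | add t t' h h' =>
    rw [map_add, map_add, mul_add, map_add, ← h, ← h', LinearMap.add_apply, map_add,
      LinearMap.add_apply]
  | tmul a b =>
    induction s with
    | zero => simp
    | add s s' h h' => rw [map_add, add_mul, map_add, h, h']
    | tmul c d =>
      induction x with
      | zero => simp
      | add x x' h h' =>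
        rw [map_add, map_add, map_add, LinearMap.add_apply, LinearMap.add_apply, h, h']
      | tmul f g =>
        rw [Algebra.TensorProduct.map_tmul, Module.endTensorEndAlgHom_apply,
          TensorProduct.AlgebraTensorModule.map_tmul, Algebra.TensorProduct.tmul_mul_tmul,
          TensorProduct.dualDistrib_apply, TensorProduct.dualDistrib_apply,
          funsAct_apply, funsAct_apply]

theorem one_convMul (z : ℂ) (f : Module.Dual ℂ A) :
    convMul ((z • Coalgebra.counit (R := ℂ) (A := A)) ⊗ₜ f) = z • f := by
  ext a
  have h : ∀ t : A ⊗[ℂ] A, TensorProduct.dualDistrib ℂ A A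
      ((z • Coalgebra.counit (R := ℂ) (A := A)) ⊗ₜ f) t =
        z * f (TensorProduct.lid ℂ A ((Coalgebra.counit (R := ℂ) (A := A)).rTensor A t)) := by
    intro t
    induction t with
    | zero => simp
    | add x y hx hy => rw [map_add, hx, hy, map_add, map_add, map_add, mul_add]
    | tmul x y => simp [mul_assoc]
  refine (h _).trans ?_
  rw [Coalgebra.rTensor_counit_comul, TensorProduct.lid_tmul, one_smul]
  rfl

theorem convMul_one (f : Module.Dual ℂ A) (z : ℂ) :
    convMul (f ⊗ₜ (z • Coalgebra.counit (R := ℂ) (A := A))) = z • f := by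
  ext a
  have h : ∀ t : A ⊗[ℂ] A, TensorProduct.dualDistrib ℂ A A
      (f ⊗ₜ (z • Coalgebra.counit (R := ℂ) (A := A))) t =
        z * f (TensorProduct.rid ℂ A ((Coalgebra.counit (R := ℂ) (A := A)).lTensor A t)) := by
    intro t
    induction t with
    | zero => simp
    | add x y hx hy => rw [map_add, hx, hy, map_add, map_add, map_add, mul_add]
    | tmul x y =>
      rw [TensorProduct.dualDistrib_apply, LinearMap.lTensor_tmul, TensorProduct.rid_tmul, map_smul,
        LinearMap.smul_apply, smul_eq_mul, smul_eq_mul]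
      ring
  refine (h _).trans ?_
  rw [Coalgebra.lTensor_counit_comul, TensorProduct.rid_tmul, one_smul]
  rfl

theorem convMul_assoc (f g h : Module.Dual ℂ A) :
    convMul (convMul (f ⊗ₜ g) ⊗ₜ h) = convMul (f ⊗ₜ convMul (g ⊗ₜ h)) := by
  ext a
  have h1 : ∀ t : A ⊗[ℂ] A, TensorProduct.dualDistrib ℂ A A (convMul (f ⊗ₜ g) ⊗ₜ h) t =
      TensorProduct.dualDistrib ℂ A (A ⊗[ℂ] A) (f ⊗ₜ TensorProduct.dualDistrib ℂ A A (g ⊗ₜ h))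
        (TensorProduct.assoc ℂ A A A ((Coalgebra.comul (R := ℂ) (A := A)).rTensor A t)) := by
    intro t
    induction t with
    | zero => simp
    | add x y hx hy => rw [map_add, hx, hy, map_add, map_add, map_add]
    | tmul x y =>
      rw [LinearMap.rTensor_tmul, TensorProduct.dualDistrib_apply]
      change TensorProduct.dualDistrib ℂ A A (f ⊗ₜ g) (Coalgebra.comul (R := ℂ) x) * h y = _
      generalize Coalgebra.comul (R := ℂ) x = s
      induction s with
      | zero => simp
      | add x y hx hy => rw [map_add, add_mul, hx, hy, TensorProduct.add_tmul, map_add, map_add]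
      | tmul x z => simp [mul_assoc]
  have h2 : ∀ t : A ⊗[ℂ] A, TensorProduct.dualDistrib ℂ A A (f ⊗ₜ convMul (g ⊗ₜ h)) t =
      TensorProduct.dualDistrib ℂ A (A ⊗[ℂ] A) (f ⊗ₜ TensorProduct.dualDistrib ℂ A A (g ⊗ₜ h))
        ((Coalgebra.comul (R := ℂ) (A := A)).lTensor A t) := by
    intro t
    induction t with
    | zero => simp
    | add x y hx hy => rw [map_add, hx, hy, map_add, map_add]
    | tmul x y => rfl
  refine (h1 _).trans ?_
  rw [Coalgebra.coassoc_apply]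
  exact (h2 _).symm

variable [FiniteDimensional ℂ A]

/-- The dual space `A^*` with the action `(a · f)(b) = f(ba)`. By `f ⊗ v ↦ (a ↦ ⟨f, a v⟩)` it is
the direct sum of the modules `V ⊗ V^*` (`A` acting on `V` only), `V` running through the
irreducible modules, if `A` is semisimple. -/
def funs (A : Type) [Ring A] [HopfAlgebra ℂ A] [FiniteDimensional ℂ A] : HRep A where
  carrier := Module.Dual ℂ A
  ρ := funsAct A

/-- The product of `A^*` as an `A`-linear map. -/
def funsMul : tensor (funs A) (funs A) ⟶ funs A :=
  ofLin (V := tensor (funs A) (funs A)) (W := funs A) convMul fun a => by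
    refine LinearMap.ext fun x => LinearMap.ext fun b => ?_
    refine (dualDistrib_act _ _ _).trans ?_
    exact (congrArg (TensorProduct.dualDistrib ℂ A A x) (Bialgebra.comul_mul b a)).symm

/-- The unit of `A^*`, that is, the counit of `A`, as an `A`-linear map. -/
def funsOne : triv A ⟶ funs A :=
  ofLin (V := triv A) (W := funs A)
    (LinearMap.toSpanSingleton ℂ (Module.Dual ℂ A) (Coalgebra.counit (R := ℂ) (A := A))) fun a => by
    refine LinearMap.ext fun (z : ℂ) => LinearMap.ext fun b => ?_
    change (Coalgebra.counit (R := ℂ) a * z) * Coalgebra.counit (R := ℂ) b =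
      z * Coalgebra.counit (R := ℂ) (b * a)
    rw [Bialgebra.counit_mul]
    ring

/-- `A^*` is an algebra in the category of `A`-modules. -/
instance funsMon : MonObj (funs A) where
  one := funsOne
  mul := funsMul
  one_mul := hom_ext (TensorProduct.ext' fun z f => one_convMul z f)
  mul_one := hom_ext (TensorProduct.ext' fun f z => convMul_one f z)
  mul_assoc := hom_ext (TensorProduct.ext_threefold fun f g h => convMul_assoc f g h)

end Monoidal
end HRep
/-! ### Semisimple tensor categories with Frobenius duality -/

section TensorCategory

attribute [local instance] Abelian.hasFiniteBiproducts

variable (T : Type u) [Category.{v} T] [Abelian T] [Linear ℂ T] [MonoidalCategory T]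

/-- A complex linear abelian monoidal category `T` is a semisimple tensor category if its Hom
spaces are finite-dimensional, every object is a finite direct sum of simple objects, and the
endomorphisms of the unit object are the scalars. -/
class SemisimpleTensorCategory : Prop where
  finite_hom : ∀ X Y : T, FiniteDimensional ℂ (X ⟶ Y)
  semisimple : ∀ X : T, ∃ (n : ℕ) (S : Fin n → T), (∀ i, Simple (S i)) ∧ Nonempty (X ≅ ⨁ S)
  end_unit : ∀ f : 𝟙_ T ⟶ 𝟙_ T, ∃! c : ℂ, f = c • 𝟙 (𝟙_ T)

/-- A Frobenius duality. Each object `X` has a dual object `X^*` with a rigidity pair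
`ε_X : X ⊗ X^* ⟶ 1`, `1 ⟶ X^* ⊗ X` and, using the identification `X^{**} = X`, a rigidity pair
`ε_{X^*} : X^* ⊗ X ⟶ 1`, `1 ⟶ X ⊗ X^*`, such that the following hold.

* Naturality: the two transposes `Y^* ⟶ X^*` of each `f : X ⟶ Y` coincide.
* Multiplicativity: there is an identification `(X ⊗ Y)^* = Y^* ⊗ X^*` under which
  `ε_{X ⊗ Y} = ε_X (1 ⊗ ε_Y ⊗ 1)` and `ε_{(X ⊗ Y)^*} = ε_{Y^*} (1 ⊗ ε_{X^*} ⊗ 1)`.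
* Neutrality: the left and the right trace of each endomorphism coincide. -/
class FrobeniusDuality where
  dual : T → T
  pair : ∀ X : T, ExactPairing (dual X) X
  pairStar : ∀ X : T, ExactPairing X (dual X)
  natural : ∀ {X Y : T} (f : X ⟶ Y),
    (λ_ (dual Y)).inv ≫ (pair X).coevaluation' ▷ dual Y ≫ (α_ (dual X) X (dual Y)).hom ≫
        dual X ◁ (f ▷ dual Y ≫ (pair Y).evaluation') ≫ (ρ_ (dual X)).hom =
      (ρ_ (dual Y)).inv ≫ dual Y ◁ (pairStar X).coevaluation' ≫ (α_ (dual Y) X (dual X)).inv ≫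
        (dual Y ◁ f ≫ (pairStar Y).evaluation') ▷ dual X ≫ (λ_ (dual X)).hom
  multiplicative : ∀ X Y : T, ∃ θ : dual (X ⊗ Y) ≅ dual Y ⊗ dual X,
    (pair (X ⊗ Y)).evaluation' =
        (X ⊗ Y) ◁ θ.hom ≫ (α_ X Y (dual Y ⊗ dual X)).hom ≫ X ◁ (α_ Y (dual Y) (dual X)).inv ≫
          X ◁ (pair Y).evaluation' ▷ dual X ≫ X ◁ (λ_ (dual X)).hom ≫ (pair X).evaluation' ∧
      (pairStar (X ⊗ Y)).evaluation' =
        θ.hom ▷ (X ⊗ Y) ≫ (α_ (dual Y) (dual X) (X ⊗ Y)).hom ≫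
          dual Y ◁ (α_ (dual X) X Y).inv ≫ dual Y ◁ (pairStar X).evaluation' ▷ Y ≫
          dual Y ◁ (λ_ Y).hom ≫ (pairStar Y).evaluation'
  neutral : ∀ {X : T} (f : X ⟶ X),
    (pairStar X).coevaluation' ≫ f ▷ dual X ≫ (pair X).evaluation' =
      (pair X).coevaluation' ≫ dual X ◁ f ≫ (pairStar X).evaluation'

variable {T}

section Duality

variable [FrobeniusDuality T]

/-- The dual object `X^*`. -/
abbrev dualObj (X : T) : T := FrobeniusDuality.dual X

/-- The pairing `ε_X : X ⊗ X^* ⟶ 1`. -/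
def ev (X : T) : X ⊗ dualObj X ⟶ 𝟙_ T := (FrobeniusDuality.pair X).evaluation'

/-- The copairing `1 ⟶ X^* ⊗ X` of `ε_X`. -/
def coev (X : T) : 𝟙_ T ⟶ dualObj X ⊗ X := (FrobeniusDuality.pair X).coevaluation'

/-- The pairing `ε_{X^*} : X^* ⊗ X ⟶ 1`. -/
def evStar (X : T) : dualObj X ⊗ X ⟶ 𝟙_ T := (FrobeniusDuality.pairStar X).evaluation'

/-- The copairing `1 ⟶ X ⊗ X^*` of `ε_{X^*}`. -/
def coevStar (X : T) : 𝟙_ T ⟶ X ⊗ dualObj X := (FrobeniusDuality.pairStar X).coevaluation'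

instance tensorLeft_preserves (X : T) : PreservesColimitsOfSize.{0, 0} (tensorLeft X) :=
  letI := FrobeniusDuality.pair X
  (tensorLeftAdjunction (dualObj X) X).leftAdjoint_preservesColimits

instance tensorRight_preserves (X : T) : PreservesColimitsOfSize.{0, 0} (tensorRight X) :=
  letI := FrobeniusDuality.pairStar X
  (tensorRightAdjunction X (dualObj X)).leftAdjoint_preservesColimits

/-- The dimension of an object `X`: the scalar `1 ⟶ X ⊗ X^* ⟶ 1`. -/
def dim [SemisimpleTensorCategory T] (X : T) : ℂ :=
  (SemisimpleTensorCategory.end_unit (coevStar X ≫ ev X)).choose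

theorem dim_spec [SemisimpleTensorCategory T] (X : T) :
    coevStar X ≫ ev X = dim X • 𝟙 (𝟙_ T) :=
  (SemisimpleTensorCategory.end_unit (coevStar X ≫ ev X)).choose_spec.1

end Duality

/-! ### Hopf algebras realized in a tensor category, and their modules -/

/-- Let `X ⊗ V` be the multiple of an object `X` by a finite-dimensional vector space `V`, that is,
`Hom(Y, X ⊗ V) = Hom(V^*, Hom(Y, X))` and `Hom(X ⊗ V, Y) = Hom(V, Hom(X, Y))`. This is an
isomorphism `Y ≅ X ⊗ V`, written in terms of its components. -/
structure MultipleIso (Y X : T) (V : Type) [AddCommGroup V] [Module ℂ V] where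
  /-- The components `Y ⟶ X ⊗ V ⟶ X` of the isomorphism, for functionals on `V`. -/
  hom : Module.Dual ℂ V →ₗ[ℂ] (Y ⟶ X)
  /-- The components `X ⟶ X ⊗ V ⟶ Y` of the inverse, for vectors of `V`. -/
  inv : V →ₗ[ℂ] (X ⟶ Y)
  inv_hom : ∀ (v : V) (f : Module.Dual ℂ V), inv v ≫ hom f = f v • 𝟙 X
  hom_inv : ∀ {n : ℕ} (b : Module.Basis (Fin n) ℂ V), ∑ i, hom (b.coord i) ≫ inv (b i) = 𝟙 Y

variable [MonoidalPreadditive T] [MonoidalLinear ℂ T] [SemisimpleTensorCategory T]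
  [FrobeniusDuality T]

variable (T) in
/-- A finite-dimensional semisimple Hopf algebra `A` realized in `T`: its category of
finite-dimensional modules is embedded in `T` by a fully faithful linear monoidal functor `F`,
and the duality of `T` restricts to that of vector spaces, that is, `dim F(V) = dim V`. -/
structure HopfIn where
  A : Type
  [ring : Ring A]
  [hopf : HopfAlgebra ℂ A]
  [finite : FiniteDimensional ℂ A]
  [semisimple : IsSemisimpleRing A]
  F : HRep A ⥤ T
  [monoidal : F.Monoidal]
  [additive : F.Additive]
  [linear : F.Linear ℂ]
  [full : F.Full]
  [faithful : F.Faithful]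
  dim_obj : ∀ V : HRep A, dim (F.obj V) = Module.finrank ℂ V

attribute [instance] HopfIn.ring HopfIn.hopf HopfIn.finite HopfIn.semisimple HopfIn.monoidal
  HopfIn.additive HopfIn.linear HopfIn.full HopfIn.faithful

open Functor.LaxMonoidal in
/-- The structure of an `A`-`B` module on an object `X`: trivializing isomorphisms
`F(V) ⊗ X ≅ X ⊗ V` and `X ⊗ G(W) ≅ W ⊗ X = X ⊗ W`, natural in the `A`-module `V` and the
`B`-module `W`, that are multiplicative, unital, and commute with each other. -/
structure ModuleStr (𝒜 ℬ : HopfIn T) (X : T) where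
  left : ∀ V : HRep 𝒜.A, MultipleIso (𝒜.F.obj V ⊗ X) X V
  right : ∀ W : HRep ℬ.A, MultipleIso (X ⊗ ℬ.F.obj W) X W
  left_natural : ∀ {V V' : HRep 𝒜.A} (h : V ⟶ V') (f : Module.Dual ℂ V'),
    𝒜.F.map h ▷ X ≫ (left V').hom f = (left V).hom (f ∘ₗ HRep.lin h)
  right_natural : ∀ {W W' : HRep ℬ.A} (h : W ⟶ W') (f : Module.Dual ℂ W'),
    X ◁ ℬ.F.map h ≫ (right W').hom f = (right W).hom (f ∘ₗ HRep.lin h)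
  left_unit : ε 𝒜.F ▷ X ≫ (left (𝟙_ (HRep 𝒜.A))).hom (LinearMap.id (R := ℂ) (M := ℂ)) = (λ_ X).hom
  right_unit :
    X ◁ ε ℬ.F ≫ (right (𝟙_ (HRep ℬ.A))).hom (LinearMap.id (R := ℂ) (M := ℂ)) = (ρ_ X).hom
  left_mul : ∀ (V V' : HRep 𝒜.A) (f : Module.Dual ℂ V) (f' : Module.Dual ℂ V'),
    μ 𝒜.F V V' ▷ X ≫ (left (V ⊗ V')).hom (TensorProduct.dualDistrib ℂ V V' (f ⊗ₜ f')) =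
      (α_ (𝒜.F.obj V) (𝒜.F.obj V') X).hom ≫ 𝒜.F.obj V ◁ (left V').hom f' ≫ (left V).hom f
  right_mul : ∀ (W W' : HRep ℬ.A) (f : Module.Dual ℂ W) (f' : Module.Dual ℂ W'),
    X ◁ μ ℬ.F W W' ≫ (right (W ⊗ W')).hom (TensorProduct.dualDistrib ℂ W W' (f ⊗ₜ f')) =
      (α_ X (ℬ.F.obj W) (ℬ.F.obj W')).inv ≫ (right W).hom f ▷ ℬ.F.obj W' ≫ (right W').hom f'
  commute : ∀ (V : HRep 𝒜.A) (W : HRep ℬ.A) (f : Module.Dual ℂ V) (g : Module.Dual ℂ W),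
    (left V).hom f ▷ ℬ.F.obj W ≫ (right W).hom g =
      (α_ (𝒜.F.obj V) X (ℬ.F.obj W)).hom ≫ 𝒜.F.obj V ◁ (right W).hom g ≫ (left V).hom f

/-- `ℳ.IsTranspose 𝒩` says that the trivializing isomorphisms of the `B`-`A` module `𝒩` on the
dual object `X^*` are the transposes of those of the `A`-`B` module `ℳ` on `X`: the isomorphism
`G(W) ⊗ X^* ⟶ X^* ⊗ W` is the transpose of `X ⊗ G(W) ⟶ W ⊗ X`, and the isomorphism
`V ⊗ X^* ⟶ X^* ⊗ F(V)` is the transpose of `X ⊗ V ⟶ F(V) ⊗ X`. -/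
structure ModuleStr.IsTranspose {𝒜 ℬ : HopfIn T} {X : T} (ℳ : ModuleStr 𝒜 ℬ X)
    (𝒩 : ModuleStr ℬ 𝒜 (dualObj X)) : Prop where
  left : ∀ (W : HRep ℬ.A) (g : Module.Dual ℂ W),
    (𝒩.left W).hom g =
      (λ_ (ℬ.F.obj W ⊗ dualObj X)).inv ≫ coev X ▷ (ℬ.F.obj W ⊗ dualObj X) ≫
        (α_ (dualObj X) X (ℬ.F.obj W ⊗ dualObj X)).hom ≫
        dualObj X ◁ ((α_ X (ℬ.F.obj W) (dualObj X)).inv ≫ (ℳ.right W).hom g ▷ dualObj X ≫ ev X) ≫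
        (ρ_ (dualObj X)).hom
  right : ∀ (V : HRep 𝒜.A) (v : V),
    (𝒩.right V).inv v =
      (λ_ (dualObj X)).inv ≫ coev X ▷ dualObj X ≫ (α_ (dualObj X) X (dualObj X)).hom ≫
        dualObj X ◁ ((ℳ.left V).inv v ▷ dualObj X ≫ (α_ (𝒜.F.obj V) X (dualObj X)).hom ≫
          𝒜.F.obj V ◁ ev X ≫ (ρ_ (𝒜.F.obj V)).hom)

/-! ### The bicategory of modules -/

namespace HopfIn

variable (𝒜 : HopfIn T)

/-- The number `|A| = dim A`. -/
def size : ℝ := Module.finrank ℂ 𝒜.A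

theorem size_pos : 0 < 𝒜.size := by
  have : Nontrivial 𝒜.A := by
    refine ⟨⟨1, 0, fun h => ?_⟩⟩
    have := congrArg (Coalgebra.counit (R := ℂ) (A := 𝒜.A)) h
    rw [Bialgebra.counit_one, map_zero] at this
    exact one_ne_zero this
  exact Nat.cast_pos.2 Module.finrank_pos

/-- The factor `ω_A = |A|^{-1/2}` of the unit constraints. -/
def ω : ℂ := ((𝒜.size ^ (-(1 / 2) : ℝ) : ℝ) : ℂ)

theorem ω_ne_zero : 𝒜.ω ≠ 0 :=
  Complex.ofReal_ne_zero.2 (Real.rpow_pos_of_pos 𝒜.size_pos _).ne'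

/-- The unit object `F(A^*) = ⨁ F(V) ⊗ V^*`, the sum over the irreducible modules `V`. -/
abbrev unitObj : T := 𝒜.F.obj (HRep.funs 𝒜.A)

/-- Evaluation at `1`, as a functional on `A^*`. -/
def evalOne : Module.Dual ℂ (HRep.funs 𝒜.A) :=
  (Module.Dual.eval ℂ 𝒜.A 1 : Module.Dual ℂ (Module.Dual ℂ 𝒜.A))

/-- The algebra structure of the unit object, with its product multiplied by `ω_A` (and its unit
divided by `ω_A`). -/
@[reducible]
def unitMon : MonObj 𝒜.unitObj :=
  letI := 𝒜.F.monObjObj (HRep.funs 𝒜.A)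
  { one := 𝒜.ω⁻¹ • MonObj.one
    mul := 𝒜.ω • MonObj.mul
    one_mul := by
      rw [MonoidalLinear.smul_whiskerRight, Linear.smul_comp, Linear.comp_smul, smul_smul,
        inv_mul_cancel₀ 𝒜.ω_ne_zero, one_smul, MonObj.one_mul]
    mul_one := by
      rw [MonoidalLinear.whiskerLeft_smul, Linear.smul_comp, Linear.comp_smul, smul_smul,
        inv_mul_cancel₀ 𝒜.ω_ne_zero, one_smul, MonObj.mul_one]
    mul_assoc := by
      rw [MonoidalLinear.smul_whiskerRight, MonoidalLinear.whiskerLeft_smul, Linear.smul_comp,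
        Linear.smul_comp, Linear.comp_smul, Linear.comp_smul, Linear.comp_smul, Linear.comp_smul,
        MonObj.mul_assoc] }

/-- The algebra `F(A^*)`, with its product multiplied by `ω_A`. -/
def alg : Mon T :=
  letI := 𝒜.unitMon
  ⟨𝒜.unitObj⟩

end HopfIn

open HopfIn

/-- The bicategory `M(T)`: its objects are the Hopf algebras realized in `T`. An `A`-`B` module `X`
amounts to an `F(A^*)`-`G(B^*)` bimodule (see `ModuleStr.cell`), the 2-morphisms are the morphisms
of `T` that commute with the actions, the composition is `X ⊗_B Y`, the unit is `F(A^*)`, and the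
unit constraints are the actions, which are multiplied by `ω_A` as the product of `A.alg` is. -/
instance bicategory : Bicategory (HopfIn T) where
  Hom 𝒜 ℬ := Bimod 𝒜.alg ℬ.alg
  homCategory 𝒜 ℬ := (inferInstance : Category (Bimod 𝒜.alg ℬ.alg))
  id 𝒜 := Bimod.regular 𝒜.alg
  comp M N := Bimod.tensorBimod M N
  whiskerLeft L _ _ f := Bimod.whiskerLeft L f
  whiskerRight f N := Bimod.whiskerRight f N
  associator := Bimod.associatorBimod
  leftUnitor := Bimod.leftUnitorBimod
  rightUnitor := Bimod.rightUnitorBimod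
  whiskerLeft_id _ _ := Bimod.whiskerLeft_id_bimod
  whiskerLeft_comp M _ _ _ f g := Bimod.whiskerLeft_comp_bimod M f g
  id_whiskerLeft := Bimod.id_whiskerLeft_bimod
  comp_whiskerLeft M N _ _ f := Bimod.comp_whiskerLeft_bimod M N f
  id_whiskerRight _ _ := Bimod.id_whiskerRight_bimod
  comp_whiskerRight f g Q := Bimod.comp_whiskerRight_bimod f g Q
  whiskerRight_id := Bimod.whiskerRight_id_bimod
  whiskerRight_comp := Bimod.whiskerRight_comp_bimod
  whisker_assoc M _ _ f P := Bimod.whisker_assoc_bimod M f P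
  whisker_exchange := Bimod.whisker_exchange_bimod
  pentagon := Bimod.pentagon_bimod
  triangle := Bimod.triangle_bimod

namespace ModuleStr

open Functor.LaxMonoidal

variable {𝒜 ℬ : HopfIn T} {X : T} (ℳ : ModuleStr 𝒜 ℬ X)

theorem evalOne_mul :
    𝒜.evalOne ∘ₗ HRep.lin (HRep.funsMul (A := 𝒜.A)) =
      TensorProduct.dualDistrib ℂ (HRep.funs 𝒜.A) (HRep.funs 𝒜.A) (𝒜.evalOne ⊗ₜ 𝒜.evalOne) := by
  refine TensorProduct.ext' fun (f g : Module.Dual ℂ 𝒜.A) => ?_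
  change TensorProduct.dualDistrib ℂ 𝒜.A 𝒜.A (f ⊗ₜ g) (Coalgebra.comul (R := ℂ) (1 : 𝒜.A)) =
    f 1 * g 1
  rw [Bialgebra.comul_one]
  rfl

theorem evalOne_one :
    𝒜.evalOne ∘ₗ HRep.lin (HRep.funsOne (A := 𝒜.A)) = LinearMap.id (R := ℂ) (M := ℂ) := by
  refine LinearMap.ext fun (z : ℂ) => ?_
  change z * Coalgebra.counit (R := ℂ) (1 : 𝒜.A) = z
  rw [Bialgebra.counit_one, mul_one]

/-- The left action of the algebra `F(A^*)` given by the trivialization at `A^*`. -/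
def actLeft : 𝒜.unitObj ⊗ X ⟶ X := (ℳ.left (HRep.funs 𝒜.A)).hom 𝒜.evalOne

/-- The right action of the algebra `G(B^*)` given by the trivialization at `B^*`. -/
def actRight : X ⊗ ℬ.unitObj ⟶ X := (ℳ.right (HRep.funs ℬ.A)).hom ℬ.evalOne

theorem actLeft_one :
    (ε 𝒜.F ≫ 𝒜.F.map HRep.funsOne) ▷ X ≫ ℳ.actLeft = (λ_ X).hom := by
  rw [comp_whiskerRight, Category.assoc, actLeft, ℳ.left_natural]
  exact (congrArg (fun f => _ ≫ (ℳ.left (𝟙_ (HRep 𝒜.A))).hom f) evalOne_one).trans ℳ.left_unit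

theorem actRight_one :
    X ◁ (ε ℬ.F ≫ ℬ.F.map HRep.funsOne) ≫ ℳ.actRight = (ρ_ X).hom := by
  rw [whiskerLeft_comp, Category.assoc, actRight, ℳ.right_natural]
  exact (congrArg (fun f => _ ≫ (ℳ.right (𝟙_ (HRep ℬ.A))).hom f) evalOne_one).trans ℳ.right_unit

theorem actLeft_mul :
    (μ 𝒜.F _ _ ≫ 𝒜.F.map HRep.funsMul) ▷ X ≫ ℳ.actLeft =
      (α_ 𝒜.unitObj 𝒜.unitObj X).hom ≫ 𝒜.unitObj ◁ ℳ.actLeft ≫ ℳ.actLeft := by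
  rw [comp_whiskerRight, Category.assoc, actLeft, ℳ.left_natural, ← ℳ.left_mul]
  exact congrArg (fun f => _ ≫ (ℳ.left (HRep.funs 𝒜.A ⊗ HRep.funs 𝒜.A)).hom f) evalOne_mul

theorem actRight_mul :
    X ◁ (μ ℬ.F _ _ ≫ ℬ.F.map HRep.funsMul) ≫ ℳ.actRight =
      (α_ X ℬ.unitObj ℬ.unitObj).inv ≫ ℳ.actRight ▷ ℬ.unitObj ≫ ℳ.actRight := by
  rw [whiskerLeft_comp, Category.assoc, actRight, ℳ.right_natural, ← ℳ.right_mul]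
  exact congrArg (fun f => _ ≫ (ℳ.right (HRep.funs ℬ.A ⊗ HRep.funs ℬ.A)).hom f) evalOne_mul

/-- The 1-morphism `A ⟶ B` of `M(T)` given by an `A`-`B` module. The unit constraints
`F(A^*) ⊗ X ⟶ X` and `X ⊗ G(B^*) ⟶ X` are the trivializations multiplied by `ω_A` and `ω_B`. -/
def cell : 𝒜 ⟶ ℬ :=
  show Bimod 𝒜.alg ℬ.alg from
  { X := X
    actLeft := 𝒜.ω • ℳ.actLeft
    actRight := ℬ.ω • ℳ.actRight
    one_actLeft := by
      change (𝒜.ω⁻¹ • (ε 𝒜.F ≫ 𝒜.F.map HRep.funsOne)) ▷ X ≫ (𝒜.ω • ℳ.actLeft) = _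
      rw [MonoidalLinear.smul_whiskerRight, Linear.smul_comp, Linear.comp_smul, smul_smul,
        inv_mul_cancel₀ 𝒜.ω_ne_zero, one_smul, actLeft_one]
    left_assoc := by
      change (𝒜.ω • (μ 𝒜.F _ _ ≫ 𝒜.F.map HRep.funsMul)) ▷ X ≫ (𝒜.ω • ℳ.actLeft) =
        (α_ 𝒜.unitObj 𝒜.unitObj X).hom ≫ 𝒜.unitObj ◁ (𝒜.ω • ℳ.actLeft) ≫ (𝒜.ω • ℳ.actLeft)
      rw [MonoidalLinear.smul_whiskerRight, MonoidalLinear.whiskerLeft_smul]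
      simp only [Linear.smul_comp, Linear.comp_smul]
      rw [actLeft_mul]
    actRight_one := by
      change X ◁ (ℬ.ω⁻¹ • (ε ℬ.F ≫ ℬ.F.map HRep.funsOne)) ≫ (ℬ.ω • ℳ.actRight) = _
      rw [MonoidalLinear.whiskerLeft_smul, Linear.smul_comp, Linear.comp_smul, smul_smul,
        inv_mul_cancel₀ ℬ.ω_ne_zero, one_smul, actRight_one]
    right_assoc := by
      change X ◁ (ℬ.ω • (μ ℬ.F _ _ ≫ ℬ.F.map HRep.funsMul)) ≫ (ℬ.ω • ℳ.actRight) =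
        (α_ X ℬ.unitObj ℬ.unitObj).inv ≫ (ℬ.ω • ℳ.actRight) ▷ ℬ.unitObj ≫ (ℬ.ω • ℳ.actRight)
      rw [MonoidalLinear.smul_whiskerRight, MonoidalLinear.whiskerLeft_smul]
      simp only [Linear.smul_comp, Linear.comp_smul]
      rw [actRight_mul]
    middle_assoc := by
      change (𝒜.ω • ℳ.actLeft) ▷ ℬ.unitObj ≫ (ℬ.ω • ℳ.actRight) =
        (α_ 𝒜.unitObj X ℬ.unitObj).hom ≫ 𝒜.unitObj ◁ (ℬ.ω • ℳ.actRight) ≫ (𝒜.ω • ℳ.actLeft)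
      rw [MonoidalLinear.smul_whiskerRight, MonoidalLinear.whiskerLeft_smul]
      simp only [Linear.smul_comp, Linear.comp_smul]
      rw [smul_comm, actLeft, actRight, ℳ.commute] }

/-- The character `a ↦ tr(b ↦ ab)` of the regular representation, that is, the element
`∑ dim(V) ∑ vⱼ ⊗ vⱼ^*` of `A^* = ⨁ V ⊗ V^*`. -/
def regChar (𝒜 : HopfIn T) : HRep.funs 𝒜.A :=
  (LinearMap.trace ℂ 𝒜.A ∘ₗ LinearMap.mul ℂ 𝒜.A : Module.Dual ℂ 𝒜.A)

/-- For a pairing `p : X ⊗ Z ⟶ 1`, the morphism `X ⊗ Z ⟶ F(A^*)` which is the sum, over the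
irreducible modules `V` with weight `dim(V)`, of
`X ⊗ Z ⟶ X ⊗ V ⊗ V^* ⊗ Z ⟶ F(V) ⊗ X ⊗ Z ⊗ V^* ⟶ F(V) ⊗ V^*`. -/
def weightedPairing {Z : T} (p : X ⊗ Z ⟶ 𝟙_ T) : X ⊗ Z ⟶ 𝒜.unitObj :=
  (ℳ.left (HRep.funs 𝒜.A)).inv (regChar 𝒜) ▷ Z ≫ (α_ 𝒜.unitObj X Z).hom ≫
    𝒜.unitObj ◁ p ≫ (ρ_ 𝒜.unitObj).hom

end ModuleStr

/-- The projection `X ⊗ Y ⟶ X ⊗_B Y` onto the composition of 1-morphisms. -/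
def proj {𝒜 ℬ 𝒞 : HopfIn T} (M : Bimod 𝒜.alg ℬ.alg) (N : Bimod ℬ.alg 𝒞.alg) :
    M.X ⊗ N.X ⟶ (M.tensorBimod N).X :=
  coequalizer.π _ _

/-- The factor `|A|^{-1/4} |B|^{-1/4}`. -/
def normFactor (𝒜 ℬ : HopfIn T) : ℂ :=
  ((𝒜.size ^ (-(1 / 4) : ℝ) * ℬ.size ^ (-(1 / 4) : ℝ) : ℝ) : ℂ)

/-- The normalized Frobenius duality of `M(T)` at an `A`-`B` module `X`. The dual 1-morphism is
`X^*` with the transposed trivializing isomorphisms, and the pairings `X ⊗_B X^* ⟶ F(A^*)` and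
`X^* ⊗_A X ⟶ G(B^*)` of the two rigidity pairs are induced by the weighted sums above, multiplied
by `|A|^{-1/4} |B|^{-1/4}`. (The copairings are determined by the pairings.) -/
structure NormalizedDuality {𝒜 ℬ : HopfIn T} {X : T} (ℳ : ModuleStr 𝒜 ℬ X) where
  /-- The dual module `X^*`. -/
  dual : ModuleStr ℬ 𝒜 (dualObj X)
  isTranspose : ℳ.IsTranspose dual
  /-- The rigidity pair `X^* ⊗_A X ⟶ 1_B`, `1_A ⟶ X ⊗_B X^*`. -/
  pairStar : Bicategory.Adjunction ℳ.cell dual.cell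
  /-- The rigidity pair `X ⊗_B X^* ⟶ 1_A`, `1_B ⟶ X^* ⊗_A X`. -/
  pair : Bicategory.Adjunction dual.cell ℳ.cell
  pairStar_counit : proj dual.cell ℳ.cell ≫ Bimod.Hom.hom pairStar.counit =
    normFactor 𝒜 ℬ • dual.weightedPairing (evStar X)
  pair_counit : proj ℳ.cell dual.cell ≫ Bimod.Hom.hom pair.counit =
    normFactor 𝒜 ℬ • ℳ.weightedPairing (ev X)

/-- The dimension of the 1-morphism `X` is the scalar `d`: the composites
`1_A ⟶ X ⊗_B X^* ⟶ 1_A` and `1_B ⟶ X^* ⊗_A X ⟶ 1_B` are `d` times the identity. -/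
def NormalizedDuality.HasDim {𝒜 ℬ : HopfIn T} {X : T} {ℳ : ModuleStr 𝒜 ℬ X}
    (D : NormalizedDuality ℳ) (d : ℂ) : Prop :=
  Bimod.Hom.hom (D.pairStar.unit ≫ D.pair.counit) = d • 𝟙 𝒜.unitObj ∧
    Bimod.Hom.hom (D.pair.unit ≫ D.pairStar.counit) = d • 𝟙 ℬ.unitObj

end TensorCategory

end HopfBicat

end

noncomputable section

namespace HopfBicat

/-! ### Finite-dimensional Hopf algebras with involutive antipode -/

section Hopf

open HopfAlgebra Coalgebra

variable {A : Type} [Ring A] [HopfAlgebra ℂ A]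

/-! The realization of `A` in `T` forces its antipode `S` to be an involution. Then the character
`χ` of the regular representation is a two-sided integral in `A^*`, and the normalized duality is
built from `χ`.

Involutive antipode. `F(V^*)` is dual to `F(V)` through the evaluation `V^* ⊗ V ⟶ ℂ`. Since `F` is
full, the Frobenius pairing on the other side comes from a module map `V ⊗ V^* ⟶ ℂ`. Naturality
makes this map `v ⊗ f ↦ f(g v)` for one element `g` of `A`, multiplicativity makes `g` group-like,
and `dim F(A) = dim A` says that `g` has trace `|A|` on `A`. A group-like element has finite order,
so its eigenvalues are roots of unity; as they sum to `|A|`, they are all `1`, and `g = 1`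
(`HopfIn.pivot_eq_one`). So the plain evaluation on `V ⊗ V^*` is `A`-linear, which for the regular
representation says `S(a₂) a₁ = ε(a)` and yields `S² = 1` (`HopfIn.antipode_antipode`).

Dual modules. The inverse of the trivialization at `V` is the action of `V^*`, bent by the duality
of `F(V)`. Since that duality is the Frobenius one, a pairing is balanced for two actions exactly
when the reversed pairing is invariant for them (`IsFrob.balanced_iff_invariant`). Hence the
transposed actions form a module on `X^*`, and all four compatibilities of `DualModules` hold.

Rigidity pairs. The weighted pairing inserts `χ` through an inverse trivialization. It is linear
over `F(A^*)` because `χ` is an integral (`regTrace_integral_left`, `regTrace_integral_right`). The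
copairing lets `G(B^*)` act on the copairing of `X`. The triangle composites produce `χ(1) = |A|`,
and the normalization satisfies `n² ω_A |A| = ω_B` for `n = |A|^{-1/4} |B|^{-1/4}`.

Dimension. By linearity the composite `F(A^*) ⟶ X ⊗_B X^* ⟶ F(A^*)` is determined by a morphism `1 ⟶
F(A^*)`. Such morphisms are multiples of the unit, and evaluation at the normalized integral of `A`
shows that the multiple is `dim X`; the factors contribute `n² = ω_A ω_B`. Counits determine units,
so every normalized duality gives the same scalar. -/

/-- If `S(a₂) a₁ = ε(a)`, then the antipode is an involution. -/
theorem antipode_involutive_of_twist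
    (h : ∀ a : A, LinearMap.mul' ℂ A (TensorProduct.map (antipode ℂ) LinearMap.id
      (TensorProduct.comm ℂ A A (comul (R := ℂ) a))) = algebraMap ℂ A (counit (R := ℂ) a)) (a : A) :
    antipode ℂ (antipode ℂ a) = a := by
  -- Applying `S` to the hypothesis gives `S(c₁) S²(c₂) = ε(c)`. So `S²` is a right convolution
  -- inverse of `S`, while the identity is a left one.
  have h1 : WithConv.toConv (antipode ℂ (A := A)) *
      WithConv.toConv (antipode ℂ (A := A) ∘ₗ antipode ℂ (A := A)) = 1 := by
    ext c
    rw [(ℛ ℂ c).convMul_apply]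
    have := congrArg (antipode ℂ (A := A)) (h c)
    rw [← (ℛ ℂ c).eq] at this
    simp only [map_sum, TensorProduct.comm_tmul, TensorProduct.map_tmul, LinearMap.mul'_apply,
      antipode_mul_antidistrib, LinearMap.id_apply] at this
    simp only [LinearMap.comp_apply, this, LinearMap.convOne_apply]
    rw [Algebra.algebraMap_eq_smul_one, map_smul, antipode_one]
  have h2 := left_inv_eq_right_inv (LinearMap.id_mul_antipode (R := ℂ) (C := A)) h1
  exact (LinearMap.congr_fun (congrArg WithConv.ofConv h2) a).symm

variable (hS : ∀ a : A, antipode ℂ (antipode ℂ a) = a)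
include hS

/-- The injective map `S` turns `a₂ S(a₁)` into `S²(a₁) S(a₂) = a₁ S(a₂)`, to which the antipode
axiom applies. -/
theorem mul_antipode_flip (a : A) :
    LinearMap.mul' ℂ A (TensorProduct.map LinearMap.id (antipode ℂ)
      (TensorProduct.comm ℂ A A (comul (R := ℂ) a))) = algebraMap ℂ A (counit (R := ℂ) a) := by
  have hi : Function.Injective (antipode ℂ (A := A)) := fun x y hxy => by
    rw [← hS x, hxy, hS]
  apply hi
  have := sum_mul_antipode_eq_algebraMap_counit (R := ℂ) (ℛ ℂ a)
  rw [← (ℛ ℂ a).eq]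
  simp only [map_sum, TensorProduct.comm_tmul, TensorProduct.map_tmul, LinearMap.mul'_apply,
      antipode_mul_antidistrib, LinearMap.id_apply, hS, this]
  rw [Algebra.algebraMap_eq_smul_one, map_smul, antipode_one]

theorem antipode_mul_flip (a : A) :
    LinearMap.mul' ℂ A (TensorProduct.map (antipode ℂ) LinearMap.id
      (TensorProduct.comm ℂ A A (comul (R := ℂ) a))) = algebraMap ℂ A (counit (R := ℂ) a) := by
  have hi : Function.Injective (antipode ℂ (A := A)) := fun x y hxy => by
    rw [← hS x, hxy, hS]
  apply hi
  have := sum_antipode_mul_eq_algebraMap_counit (R := ℂ) (ℛ ℂ a)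
  rw [← (ℛ ℂ a).eq]
  simp only [map_sum, TensorProduct.comm_tmul, TensorProduct.map_tmul, LinearMap.mul'_apply,
      antipode_mul_antidistrib, LinearMap.id_apply, hS, this]
  rw [Algebra.algebraMap_eq_smul_one, map_smul, antipode_one]

end Hopf

/-! ### Duals of modules over a Hopf algebra -/

namespace HRep

open HopfAlgebra Coalgebra

section Dual

variable {A : Type} [Ring A] [HopfAlgebra ℂ A]

/-- The dual module, on which `a` acts by the transpose of the action of `S(a)`. -/
def dual (V : HRep A) : HRep A where
  carrier := Module.Dual ℂ V
  ρ := AlgHom.ofLinearMap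
    { toFun := fun a => Module.Dual.transpose (R := ℂ) (V.ρ (antipode ℂ a))
      map_add' := fun a b => by rw [map_add, map_add, map_add]
      map_smul' := fun z a => by rw [map_smul, map_smul, map_smul]; rfl }
    (by
      change Module.Dual.transpose (R := ℂ) (V.ρ (antipode ℂ 1)) = 1
      rw [antipode_one, map_one]; rfl)
    (fun a b => by
      change Module.Dual.transpose (R := ℂ) (V.ρ (antipode ℂ (a * b))) = _
      rw [antipode_mul_antidistrib, map_mul]; rfl)

/-- A functional on `V` as a vector of the dual module. -/
def dualVec (V : HRep A) : Module.Dual ℂ V ≃ₗ[ℂ] (dual V).carrier := LinearEquiv.refl _ _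

/-- A vector of `V` as a functional on the dual module. -/
def bidual (V : HRep A) : V.carrier →ₗ[ℂ] Module.Dual ℂ (dual V) := Module.Dual.eval ℂ V

/-- The evaluation `V^* ⊗ V ⟶ ℂ` as a linear map. -/
def evalLin (V : HRep A) : (dual V).carrier ⊗[ℂ] V.carrier →ₗ[ℂ] (triv A).carrier :=
  contractLeft ℂ V

/-- The evaluation `V ⊗ V^* ⟶ ℂ` as a linear map. -/
def evalLin' (V : HRep A) : V.carrier ⊗[ℂ] (dual V).carrier →ₗ[ℂ] (triv A).carrier :=
  contractLeft ℂ V ∘ₗ (TensorProduct.comm ℂ V (Module.Dual ℂ V)).toLinearMap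

/-- The canonical element of `V ⊗ V^*`. -/
def coevElt (V : HRep A) : V.carrier ⊗[ℂ] (dual V).carrier := coevaluation ℂ V 1

/-- The canonical element of `V^* ⊗ V`. -/
def coevElt' (V : HRep A) : (dual V).carrier ⊗[ℂ] V.carrier :=
  TensorProduct.comm ℂ V (Module.Dual ℂ V) (coevaluation ℂ V 1)

theorem counit_smul_lin {V W : HRep A} (f : V.carrier ⊗[ℂ] W.carrier →ₗ[ℂ] (triv A).carrier) (a : A) :
    f ∘ₗ TensorProduct.map (V.ρ (algebraMap ℂ A (counit (R := ℂ) a))) LinearMap.id =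
      (triv A).ρ a ∘ₗ f := by
  rw [AlgHom.commutes]
  refine TensorProduct.ext' fun v w => ?_
  rw [LinearMap.comp_apply, TensorProduct.map_tmul, Module.algebraMap_end_apply,
    ← TensorProduct.smul_tmul', map_smul]
  rfl

/-- An element of a module on which `a` acts by `ε(a)`, as a morphism. -/
def ofInvariant {V : HRep A} (x : V.carrier) (h : ∀ a, V.ρ a x = counit (R := ℂ) a • x) :
    𝟙_ (HRep A) ⟶ V :=
  ofLin (V := triv A) (LinearMap.toSpanSingleton ℂ V.carrier x) fun a =>
    LinearMap.ext fun (z : ℂ) => by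
      change (counit (R := ℂ) a * z) • x = V.ρ a (z • x)
      rw [map_smul, h, smul_smul, mul_comm]

/-- The evaluation `V^* ⊗ V ⟶ ℂ`. -/
def evalDual (V : HRep A) : dual V ⊗ V ⟶ 𝟙_ (HRep A) :=
  ofLin (V := tensor (dual V) V) (W := triv A) (evalLin V) fun a => by
    have h : ∀ t : A ⊗[ℂ] A, evalLin V ∘ₗ act₂ (dual V) V t =
        evalLin V ∘ₗ TensorProduct.map LinearMap.id
          (V.ρ (LinearMap.mul' ℂ A ((antipode ℂ).rTensor A t))) := by
      intro t
      induction t with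
      | zero => simp only [map_zero, TensorProduct.map_zero_right]
      | add x y hx hy =>
        simp only [map_add, TensorProduct.map_add_right, LinearMap.comp_add]
        rw [← hx, ← hy]
      | tmul x y =>
        refine TensorProduct.ext' fun f w => ?_
        rw [act₂_tmul, LinearMap.rTensor_tmul, LinearMap.mul'_apply, map_mul]
        rfl
    refine (h (comul (R := ℂ) a)).trans ?_
    rw [mul_antipode_rTensor_comul_apply, AlgHom.commutes]
    refine TensorProduct.ext' fun f w => ?_
    rw [LinearMap.comp_apply, TensorProduct.map_tmul, Module.algebraMap_end_apply,
      TensorProduct.tmul_smul, map_smul]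
    rfl

/-- Under `V ⊗ V^* ≅ End V` the canonical element is the identity, so both sides become `g`. -/
theorem transpose_coevaluation (V : HRep A) (g : Module.End ℂ V) :
    TensorProduct.map LinearMap.id (Module.Dual.transpose (R := ℂ) g) (coevaluation ℂ V 1) =
      TensorProduct.map g LinearMap.id (coevaluation ℂ V 1) := by
  have hinj : Function.Injective ((dualTensorHom ℂ V V) ∘ₗ
      (TensorProduct.comm ℂ V (Module.Dual ℂ V)).toLinearMap) := by
    rw [LinearMap.coe_comp]
    refine Function.Injective.comp ?_ (LinearEquiv.injective _)
    intro x y hxy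
    apply (dualTensorHomEquiv ℂ V V).injective
    simpa using hxy
  have key : ∀ h : Module.End ℂ V, ((dualTensorHom ℂ V V) ∘ₗ
      (TensorProduct.comm ℂ V (Module.Dual ℂ V)).toLinearMap) (coevaluation ℂ V 1) = LinearMap.id := by
    intro _
    ext x
    simp only [coevaluation_apply_one, LinearMap.comp_apply, LinearEquiv.coe_coe, map_sum,
      TensorProduct.comm_tmul, LinearMap.sum_apply, dualTensorHom_apply, LinearMap.id_apply]
    exact (Module.Basis.ofVectorSpace ℂ V).sum_repr x
  have h1 : ∀ x : V ⊗[ℂ] Module.Dual ℂ V, ((dualTensorHom ℂ V V) ∘ₗ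
      (TensorProduct.comm ℂ V (Module.Dual ℂ V)).toLinearMap)
        (TensorProduct.map LinearMap.id (Module.Dual.transpose (R := ℂ) g) x) =
      ((dualTensorHom ℂ V V) ∘ₗ
      (TensorProduct.comm ℂ V (Module.Dual ℂ V)).toLinearMap) x ∘ₗ g := by
    intro x
    induction x with
    | zero => simp
    | add x y hx hy => rw [map_add, map_add, map_add, hx, hy, LinearMap.add_comp]
    | tmul x f => ext y; simp [Module.Dual.transpose_apply]
  have h2 : ∀ x : V ⊗[ℂ] Module.Dual ℂ V, ((dualTensorHom ℂ V V) ∘ₗ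
      (TensorProduct.comm ℂ V (Module.Dual ℂ V)).toLinearMap)
        (TensorProduct.map g LinearMap.id x) =
      g ∘ₗ ((dualTensorHom ℂ V V) ∘ₗ
      (TensorProduct.comm ℂ V (Module.Dual ℂ V)).toLinearMap) x := by
    intro x
    induction x with
    | zero => simp
    | add x y hx hy => rw [map_add, map_add, map_add, hx, hy, LinearMap.comp_add]
    | tmul x f => ext y; simp
  apply hinj
  rw [h1, h2, key g, LinearMap.id_comp, LinearMap.comp_id]

/-- Moving the action from `V^*` to `V` reduces the invariance of the canonical element to `a₁ S(a₂)
= ε(a)`, or to `a₂ S(a₁) = ε(a)` for the flipped order. -/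
theorem map_dual_coevElt (V : HRep A) (g : Module.End ℂ V) (a : A) :
    TensorProduct.map g ((dual V).ρ a) (coevElt V) =
      TensorProduct.map (g * V.ρ (antipode ℂ a)) LinearMap.id (coevElt V) := by
  have := congrArg (TensorProduct.map g LinearMap.id)
    (transpose_coevaluation V (V.ρ (antipode ℂ a)))
  simp only [TensorProduct.map_map] at this
  exact this

theorem counit_smul_coevElt (V : HRep A) (a : A) :
    TensorProduct.map (V.ρ (algebraMap ℂ A (counit (R := ℂ) a))) LinearMap.id (coevElt V) =
      counit (R := ℂ) a • coevElt V := by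
  rw [AlgHom.commutes]
  generalize coevElt V = x
  induction x with
  | zero => simp
  | add x y hx hy => rw [map_add, hx, hy, smul_add]
  | tmul v f => rw [TensorProduct.map_tmul, Module.algebraMap_end_apply, TensorProduct.smul_tmul']; rfl

/-- The coevaluation `ℂ ⟶ V ⊗ V^*`. -/
def coevalDual (V : HRep A) : 𝟙_ (HRep A) ⟶ V ⊗ dual V :=
  ofInvariant (V := tensor V (dual V)) (coevElt V) fun a => by
    have h : ∀ t : A ⊗[ℂ] A, act₂ V (dual V) t (coevElt V) =
        TensorProduct.map (V.ρ (LinearMap.mul' ℂ A ((antipode ℂ).lTensor A t))) LinearMap.id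
          (coevElt V) := by
      intro t
      induction t with
      | zero => simp only [map_zero, TensorProduct.map_zero_left]
      | add x y hx hy =>
        simp only [map_add, TensorProduct.map_add_left, LinearMap.add_apply]
        rw [← hx, ← hy]
      | tmul x y =>
        rw [act₂_tmul, LinearMap.lTensor_tmul, LinearMap.mul'_apply, map_mul, map_dual_coevElt]
    refine (h (comul (R := ℂ) a)).trans ?_
    rw [mul_antipode_lTensor_comul_apply]
    exact counit_smul_coevElt V a

theorem lin_coevalDual (V : HRep A) : lin (coevalDual V) = coevaluation ℂ V := by
  refine LinearMap.ext_ring ?_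
  exact one_smul _ _

/-- The dual module is a right dual object. -/
@[reducible]
def dualPairing (V : HRep A) : ExactPairing V (dual V) where
  coevaluation' := coevalDual V
  evaluation' := evalDual V
  coevaluation_evaluation' := hom_ext (by
    refine Eq.trans ?_ (contractLeft_assoc_coevaluation ℂ V)
    rw [← lin_coevalDual]; rfl)
  evaluation_coevaluation' := hom_ext (by
    refine Eq.trans ?_ (contractLeft_assoc_coevaluation' ℂ V)
    rw [← lin_coevalDual]; rfl)

end Dual

/-! ### Duality on the other side, for an involutive antipode -/

section Flip

variable {A : Type} [Ring A] [HopfAlgebra ℂ A]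
variable (hS : ∀ a : A, antipode ℂ (antipode ℂ a) = a)
include hS

/-- The evaluation `V ⊗ V^* ⟶ ℂ`, if the antipode is an involution. -/
def evalFlip (V : HRep A) : V ⊗ dual V ⟶ 𝟙_ (HRep A) :=
  ofLin (V := tensor V (dual V)) (W := triv A) (evalLin' V) fun a => by
    have h : ∀ t : A ⊗[ℂ] A, evalLin' V ∘ₗ act₂ V (dual V) t =
        evalLin' V ∘ₗ
          TensorProduct.map (V.ρ (LinearMap.mul' ℂ A (TensorProduct.map (antipode ℂ) LinearMap.id
            (TensorProduct.comm ℂ A A t)))) LinearMap.id := by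
      intro t
      induction t with
      | zero => simp only [map_zero, TensorProduct.map_zero_left]
      | add x y hx hy =>
        simp only [map_add, TensorProduct.map_add_left, LinearMap.comp_add]
        rw [← hx, ← hy]
      | tmul x y =>
        refine TensorProduct.ext' fun w f => ?_
        rw [act₂_tmul, TensorProduct.comm_tmul, TensorProduct.map_tmul, LinearMap.mul'_apply,
          map_mul]
        rfl
    refine (h (comul (R := ℂ) a)).trans ?_
    rw [antipode_mul_flip hS]
    exact counit_smul_lin _ _

/-- The coevaluation `ℂ ⟶ V^* ⊗ V`, if the antipode is an involution. -/
def coevalFlip (V : HRep A) : 𝟙_ (HRep A) ⟶ dual V ⊗ V :=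
  ofInvariant (V := tensor (dual V) V) (coevElt' V) fun a => by
    have h : ∀ t : A ⊗[ℂ] A, act₂ (dual V) V t (coevElt' V) =
        TensorProduct.comm ℂ V.carrier (dual V).carrier
          (TensorProduct.map (V.ρ (LinearMap.mul' ℂ A (TensorProduct.map LinearMap.id (antipode ℂ)
            (TensorProduct.comm ℂ A A t)))) LinearMap.id (coevElt V)) := by
      intro t
      induction t with
      | zero => simp only [map_zero, TensorProduct.map_zero_left]; exact (map_zero _).symm
      | add x y hx hy =>
        simp only [map_add, TensorProduct.map_add_left, LinearMap.add_apply]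
        rw [← hx, ← hy]
      | tmul x y =>
        rw [act₂_tmul, TensorProduct.comm_tmul, TensorProduct.map_tmul, LinearMap.mul'_apply,
          map_mul, LinearMap.id_apply, ← map_dual_coevElt]
        exact TensorProduct.map_comm _ _ _
    refine (h (comul (R := ℂ) a)).trans ?_
    rw [mul_antipode_flip hS, counit_smul_coevElt, map_smul]
    rfl

omit hS in
theorem coevElt'_eq (V : HRep A) : coevElt' V =
    ∑ i, dualVec V ((Module.Basis.ofVectorSpace ℂ V).coord i) ⊗ₜ[ℂ]
      Module.Basis.ofVectorSpace ℂ V i := by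
  rw [coevElt', coevaluation_apply_one, map_sum]
  rfl

omit hS in
theorem zigzag_left (V : HRep A) (v : V.carrier) (z : ℂ) :
    TensorProduct.map (evalLin' V) LinearMap.id ((TensorProduct.assoc ℂ V.carrier (dual V).carrier
      V.carrier).symm (v ⊗ₜ (z • coevElt' V))) = (1 : ℂ) ⊗ₜ[ℂ] (z • v) := by
  rw [coevElt'_eq, TensorProduct.tmul_smul, TensorProduct.tmul_sum, map_smul, map_smul, map_sum,
    map_sum, TensorProduct.tmul_smul]
  conv_rhs => rw [← (Module.Basis.ofVectorSpace ℂ V).sum_repr v, TensorProduct.tmul_sum]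
  congr 1
  refine Finset.sum_congr rfl fun i _ => ?_
  rw [← TensorProduct.smul_tmul, smul_eq_mul, mul_one]
  rfl

omit hS in
theorem zigzag_right (V : HRep A) (z : ℂ) (f : (dual V).carrier) :
    TensorProduct.map LinearMap.id (evalLin' V) (TensorProduct.assoc ℂ (dual V).carrier V.carrier
      (dual V).carrier ((z • coevElt' V) ⊗ₜ f)) = (z • f) ⊗ₜ[ℂ] (1 : ℂ) := by
  rw [coevElt'_eq, ← TensorProduct.smul_tmul', TensorProduct.sum_tmul, map_smul, map_smul, map_sum,
    map_sum, ← TensorProduct.smul_tmul']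
  have hf : f = ∑ i, ((dualVec V).symm f (Module.Basis.ofVectorSpace ℂ V i)) •
      dualVec V ((Module.Basis.ofVectorSpace ℂ V).coord i) :=
    ((Module.Basis.ofVectorSpace ℂ V).sum_dual_apply_smul_coord f).symm
  conv_rhs => rw [hf, TensorProduct.sum_tmul]
  congr 1
  refine Finset.sum_congr rfl fun i _ => ?_
  rw [TensorProduct.smul_tmul, smul_eq_mul, mul_one]
  rfl

/-- The dual module is a left dual object, if the antipode is an involution. -/
@[reducible]
def flipPairing (V : HRep A) : ExactPairing (dual V) V where
  coevaluation' := coevalFlip hS V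
  evaluation' := evalFlip hS V
  coevaluation_evaluation' := hom_ext (by
    refine TensorProduct.ext' fun v (z : ℂ) => ?_
    exact zigzag_left V v z)
  evaluation_coevaluation' := hom_ext (by
    refine TensorProduct.ext' fun (z : ℂ) f => ?_
    exact zigzag_right V z f)

end Flip
end HRep

/-! ### The regular character is an integral -/

section Integral

open HopfAlgebra Coalgebra

variable {A : Type} [Ring A] [HopfAlgebra ℂ A]

/-- In Sweedler notation the left side is `y₁ ⊗ y₂ S(y₃)`. This identity and the three variants
after it collapse the operator products in the proofs that the regular character is an integral. -/
theorem comul_mul_antipode (y : A) :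
    TensorProduct.map LinearMap.id (LinearMap.mul' ℂ A ∘ₗ (antipode ℂ).lTensor A)
      (TensorProduct.assoc ℂ A A A ((comul (R := ℂ) (A := A)).rTensor A (comul (R := ℂ) y))) =
      y ⊗ₜ 1 := by
  rw [coassoc_apply]
  have : ∀ t : A ⊗[ℂ] A, TensorProduct.map LinearMap.id
      (LinearMap.mul' ℂ A ∘ₗ (antipode ℂ).lTensor A) ((comul (R := ℂ) (A := A)).lTensor A t) =
      TensorProduct.map LinearMap.id (Algebra.linearMap ℂ A) ((counit (R := ℂ)).lTensor A t) := by
    intro t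
    induction t with
    | zero => simp
    | add x y hx hy => simp only [map_add, hx, hy]
    | tmul p q => simp
  rw [this, lTensor_counit_comul]
  simp

/-- Here the expression is `y₁ ⊗ y₃ S(y₂)`; a product in this order collapses only because `S` is an
involution. -/
theorem comul_antipode_mul (hS : ∀ a : A, antipode ℂ (antipode ℂ a) = a) (y : A) :
    TensorProduct.map LinearMap.id (LinearMap.mul' ℂ A ∘ₗ
        TensorProduct.map LinearMap.id (antipode ℂ) ∘ₗ (TensorProduct.comm ℂ A A).toLinearMap)
      (TensorProduct.assoc ℂ A A A ((comul (R := ℂ) (A := A)).rTensor A (comul (R := ℂ) y))) =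
      y ⊗ₜ 1 := by
  rw [coassoc_apply]
  have : ∀ t : A ⊗[ℂ] A, TensorProduct.map LinearMap.id
      (LinearMap.mul' ℂ A ∘ₗ TensorProduct.map LinearMap.id (antipode ℂ) ∘ₗ
        (TensorProduct.comm ℂ A A).toLinearMap) ((comul (R := ℂ) (A := A)).lTensor A t) =
      TensorProduct.map LinearMap.id (Algebra.linearMap ℂ A) ((counit (R := ℂ)).lTensor A t) := by
    intro t
    induction t with
    | zero => simp
    | add x y hx hy => simp only [map_add, hx, hy]
    | tmul p q =>
      simp only [LinearMap.lTensor_tmul, TensorProduct.map_tmul, LinearMap.comp_apply,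
        LinearEquiv.coe_coe, mul_antipode_flip hS, Algebra.linearMap_apply]
  rw [this, lTensor_counit_comul]
  simp

theorem antipode_mul_comul (hS : ∀ a : A, antipode ℂ (antipode ℂ a) = a) (y : A) :
    TensorProduct.map (LinearMap.mul' ℂ A ∘ₗ
        TensorProduct.map LinearMap.id (antipode ℂ) ∘ₗ (TensorProduct.comm ℂ A A).toLinearMap)
      LinearMap.id
      ((TensorProduct.assoc ℂ A A A).symm
        ((comul (R := ℂ) (A := A)).lTensor A (comul (R := ℂ) y))) = 1 ⊗ₜ y := by
  rw [coassoc_symm_apply]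
  have : ∀ t : A ⊗[ℂ] A, TensorProduct.map
      (LinearMap.mul' ℂ A ∘ₗ TensorProduct.map LinearMap.id (antipode ℂ) ∘ₗ
        (TensorProduct.comm ℂ A A).toLinearMap) LinearMap.id
          ((comul (R := ℂ) (A := A)).rTensor A t) =
      TensorProduct.map (Algebra.linearMap ℂ A) LinearMap.id ((counit (R := ℂ)).rTensor A t) := by
    intro t
    induction t with
    | zero => simp
    | add x y hx hy => simp only [map_add, hx, hy]
    | tmul p q =>
      simp only [LinearMap.rTensor_tmul, TensorProduct.map_tmul, LinearMap.comp_apply,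
        LinearEquiv.coe_coe, mul_antipode_flip hS, Algebra.linearMap_apply]
  rw [this, rTensor_counit_comul]
  simp

theorem mul_antipode_comul (y : A) :
    TensorProduct.map (LinearMap.mul' ℂ A ∘ₗ (antipode ℂ).lTensor A) LinearMap.id
      ((TensorProduct.assoc ℂ A A A).symm
        ((comul (R := ℂ) (A := A)).lTensor A (comul (R := ℂ) y))) = 1 ⊗ₜ y := by
  rw [coassoc_symm_apply]
  have : ∀ t : A ⊗[ℂ] A, TensorProduct.map
      (LinearMap.mul' ℂ A ∘ₗ (antipode ℂ).lTensor A) LinearMap.id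
          ((comul (R := ℂ) (A := A)).rTensor A t) =
      TensorProduct.map (Algebra.linearMap ℂ A) LinearMap.id ((counit (R := ℂ)).rTensor A t) := by
    intro t
    induction t with
    | zero => simp
    | add x y hx hy => simp only [map_add, hx, hy]
    | tmul p q => simp
  rw [this, rTensor_counit_comul]
  simp

variable [FiniteDimensional ℂ A]

variable (A) in
/-- The character of the regular representation. -/
def regTrace : Module.Dual ℂ A := LinearMap.trace ℂ A ∘ₗ LinearMap.mul ℂ A

theorem regTrace_one : regTrace A 1 = Module.finrank ℂ A := by
  have : LinearMap.mul ℂ A 1 = LinearMap.id := LinearMap.ext fun x => by simp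
  rw [regTrace, LinearMap.comp_apply, this, LinearMap.trace_id]

/-- Contraction of the second factor with `φ`. -/
def contractRight (φ : Module.Dual ℂ A) : A ⊗[ℂ] A →ₗ[ℂ] A :=
  (TensorProduct.rid ℂ A).toLinearMap ∘ₗ φ.lTensor A

/-- Contraction of the first factor with `φ`. -/
def contractLeft' (φ : Module.Dual ℂ A) : A ⊗[ℂ] A →ₗ[ℂ] A :=
  (TensorProduct.lid ℂ A).toLinearMap ∘ₗ φ.rTensor A

theorem contractRight_tmul (φ : Module.Dual ℂ A) (p q : A) :
    contractRight φ (p ⊗ₜ q) = φ q • p := rfl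

theorem contractLeft'_tmul (φ : Module.Dual ℂ A) (p q : A) :
    contractLeft' φ (p ⊗ₜ q) = φ p • q := rfl

theorem contractRight_mul_tmul (φ : Module.Dual ℂ A) (t : A ⊗[ℂ] A) (p q : A) :
    contractRight φ (t * p ⊗ₜ q) = contractRight (φ ∘ₗ LinearMap.mulRight ℂ q) t * p := by
  induction t with
  | zero => simp
  | add t t' h h' => simp only [map_add, add_mul, h, h']
  | tmul p' q' =>
    rw [Algebra.TensorProduct.tmul_mul_tmul, contractRight_tmul, contractRight_tmul,
      smul_mul_assoc]
    rfl

theorem contractLeft'_mul_tmul (φ : Module.Dual ℂ A) (t : A ⊗[ℂ] A) (p q : A) :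
    contractLeft' φ (t * p ⊗ₜ q) = contractLeft' (φ ∘ₗ LinearMap.mulRight ℂ p) t * q := by
  induction t with
  | zero => simp
  | add t t' h h' => simp only [map_add, add_mul, h, h']
  | tmul p' q' =>
    rw [Algebra.TensorProduct.tmul_mul_tmul, contractLeft'_tmul, contractLeft'_tmul,
      smul_mul_assoc]
    rfl

theorem sum_coord_mul {n : ℕ} (b : Module.Basis (Fin n) ℂ A) (φ : Module.Dual ℂ A) (q s : A) :
    ∑ j, b.coord j s * φ (q * b j) = φ (q * s) := by
  conv_rhs => rw [← b.sum_repr s, Finset.mul_sum, map_sum]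
  exact Finset.sum_congr rfl fun j _ => by rw [mul_smul_comm, map_smul, smul_eq_mul]; rfl

theorem sum_contractRight {n : ℕ} (b : Module.Basis (Fin n) ℂ A) (φ : Module.Dual ℂ A) (s : A)
    (t : A ⊗[ℂ] A) :
    ∑ j, b.coord j s • contractRight (φ ∘ₗ LinearMap.mulRight ℂ (b j)) t =
      contractRight (φ ∘ₗ LinearMap.mulRight ℂ s) t := by
  induction t with
  | zero => simp
  | add t t' h h' => simp only [map_add, smul_add, Finset.sum_add_distrib, h, h']
  | tmul p q =>
    simp only [contractRight_tmul, smul_smul, ← Finset.sum_smul]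
    exact congrArg (· • p) (sum_coord_mul b φ q s)

theorem sum_contractLeft' {n : ℕ} (b : Module.Basis (Fin n) ℂ A) (φ : Module.Dual ℂ A) (s : A)
    (t : A ⊗[ℂ] A) :
    ∑ j, b.coord j s • contractLeft' (φ ∘ₗ LinearMap.mulRight ℂ (b j)) t =
      contractLeft' (φ ∘ₗ LinearMap.mulRight ℂ s) t := by
  induction t with
  | zero => simp
  | add t t' h h' => simp only [map_add, smul_add, Finset.sum_add_distrib, h, h']
  | tmul p q =>
    simp only [contractLeft'_tmul, smul_smul, ← Finset.sum_smul]
    exact congrArg (· • q) (sum_coord_mul b φ p s)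

/-- Cyclicity of the trace, summed over a family: `∑ VⱼUⱼ` and `∑ UⱼVⱼ` have the same trace. The
integral property is proved by exhibiting such a family. -/
theorem regTrace_eq_of_sum {n : ℕ} (U V : Fin n → A →ₗ[ℂ] A) (y x : A) (c : ℂ)
    (h1 : ∑ j, V j ∘ₗ U j = LinearMap.mul ℂ A y) (h2 : ∑ j, U j ∘ₗ V j = c • LinearMap.mul ℂ A x) :
    regTrace A y = c * regTrace A x := by
  rw [regTrace, LinearMap.comp_apply, ← h1, map_sum]
  rw [Finset.sum_congr rfl fun j _ => LinearMap.trace_comp_comm' (U j) (V j)]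
  rw [← map_sum, h2, map_smul, smul_eq_mul]
  rfl

variable (hS : ∀ a : A, antipode ℂ (antipode ℂ a) = a)
include hS

/-- Take `Uⱼ(y) = bⱼ^*(S(y₂)) y₁` and `Vⱼ(z) = φ((xz)₂ bⱼ) (xz)₁`. Summation over the basis gives `∑
VⱼUⱼ(y) = φ(x₂ y₂ S(y₃)) x₁ y₁ = φ(x₂) x₁ y`. With `w = xz` it gives `∑ UⱼVⱼ(z) = φ(w₃ S(w₂)) w₁ =
φ(1) x z`, where the involutivity of `S` enters. The traces are `χ(x₁) φ(x₂)` and `φ(1) χ(x)`. -/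
theorem regTrace_integral_right (φ : Module.Dual ℂ A) (x : A) :
    TensorProduct.dualDistrib ℂ A A (regTrace A ⊗ₜ φ) (comul (R := ℂ) x) = φ 1 * regTrace A x := by
  let b := Module.finBasis ℂ A
  let U : Fin (Module.finrank ℂ A) → A →ₗ[ℂ] A := fun j =>
    contractRight (b.coord j ∘ₗ antipode ℂ) ∘ₗ comul
  let V : Fin (Module.finrank ℂ A) → A →ₗ[ℂ] A := fun j =>
    contractRight (φ ∘ₗ LinearMap.mulRight ℂ (b j)) ∘ₗ comul ∘ₗ LinearMap.mulLeft ℂ x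
  have h1 : ∑ j, V j ∘ₗ U j = LinearMap.mul ℂ A (contractRight φ (comul (R := ℂ) x)) := by
    refine LinearMap.ext fun y => ?_
    rw [LinearMap.sum_apply]
    have e1 : ∀ t : A ⊗[ℂ] A, ∑ j, V j (contractRight (b.coord j ∘ₗ antipode ℂ) t) =
        contractRight φ (comul (R := ℂ) x * TensorProduct.map LinearMap.id
          (LinearMap.mul' ℂ A ∘ₗ (antipode ℂ).lTensor A)
          (TensorProduct.assoc ℂ A A A ((comul (R := ℂ) (A := A)).rTensor A t))) := by
      intro t
      induction t with
      | zero => simp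
      | add t t' h h' => simp only [map_add, Finset.sum_add_distrib, h, h', mul_add]
      | tmul p s =>
        simp only [contractRight_tmul, map_smul]
        refine (sum_contractRight b φ _ _).trans ?_
        rw [LinearMap.comp_apply, LinearMap.mulLeft_apply, Bialgebra.comul_mul,
          LinearMap.rTensor_tmul]
        generalize comul (R := ℂ) p = D
        induction D with
        | zero => simp
        | add t t' h h' => simp only [map_add, TensorProduct.add_tmul, mul_add, h, h']
        | tmul p q =>
          rw [contractRight_mul_tmul, TensorProduct.assoc_tmul, TensorProduct.map_tmul,
            contractRight_mul_tmul]
          congr 3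
          ext z
          simp [mul_assoc]
    refine (e1 _).trans ?_
    rw [comul_mul_antipode, contractRight_mul_tmul]
    congr 3
    ext z
    simp
  have h2 : ∑ j, U j ∘ₗ V j = φ 1 • LinearMap.mul ℂ A x := by
    refine LinearMap.ext fun z => ?_
    rw [LinearMap.sum_apply]
    have e1 : ∀ t : A ⊗[ℂ] A,
        ∑ j, U j (contractRight (φ ∘ₗ LinearMap.mulRight ℂ (b j)) t) =
        contractRight φ (TensorProduct.map LinearMap.id (LinearMap.mul' ℂ A ∘ₗ
            TensorProduct.map LinearMap.id (antipode ℂ) ∘ₗ (TensorProduct.comm ℂ A A).toLinearMap)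
          (TensorProduct.assoc ℂ A A A ((comul (R := ℂ) (A := A)).rTensor A t))) := by
      intro t
      induction t with
      | zero => simp
      | add t t' h h' => simp only [map_add, Finset.sum_add_distrib, h, h']
      | tmul p s =>
        simp only [contractRight_tmul, map_smul, U, LinearMap.comp_apply, LinearMap.rTensor_tmul]
        generalize comul (R := ℂ) p = D
        induction D with
        | zero => simp
        | add t t' h h' =>
          simp only [map_add, TensorProduct.add_tmul, smul_add, Finset.sum_add_distrib, h, h']
        | tmul p q =>
          rw [TensorProduct.assoc_tmul, TensorProduct.map_tmul, contractRight_tmul]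
          simp only [contractRight_tmul, smul_smul, ← Finset.sum_smul, LinearMap.comp_apply,
            LinearMap.mulRight_apply, mul_comm (φ _)]
          rw [sum_coord_mul]
          simp
    refine (e1 _).trans ?_
    rw [LinearMap.comp_apply, comul_antipode_mul hS]
    rfl
  rw [← regTrace_eq_of_sum U V _ x (φ 1) h1 h2]
  generalize comul (R := ℂ) x = t
  induction t with
  | zero => simp
  | add t t' h h' => simp only [map_add, h, h']
  | tmul p q => simp [contractRight_tmul, mul_comm]

/-- The mirror image, contracting first tensor factors. Involutivity now enters in `∑ VⱼUⱼ`, through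
`y₂ S(y₁) ⊗ y₃ = 1 ⊗ y`. -/
theorem regTrace_integral_left (φ : Module.Dual ℂ A) (x : A) :
    TensorProduct.dualDistrib ℂ A A (φ ⊗ₜ regTrace A) (comul (R := ℂ) x) = φ 1 * regTrace A x := by
  let b := Module.finBasis ℂ A
  let U : Fin (Module.finrank ℂ A) → A →ₗ[ℂ] A := fun j =>
    contractLeft' (b.coord j ∘ₗ antipode ℂ) ∘ₗ comul
  let V : Fin (Module.finrank ℂ A) → A →ₗ[ℂ] A := fun j =>
    contractLeft' (φ ∘ₗ LinearMap.mulRight ℂ (b j)) ∘ₗ comul ∘ₗ LinearMap.mulLeft ℂ x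
  have h1 : ∑ j, V j ∘ₗ U j = LinearMap.mul ℂ A (contractLeft' φ (comul (R := ℂ) x)) := by
    refine LinearMap.ext fun y => ?_
    rw [LinearMap.sum_apply]
    have e1 : ∀ t : A ⊗[ℂ] A, ∑ j, V j (contractLeft' (b.coord j ∘ₗ antipode ℂ) t) =
        contractLeft' φ (comul (R := ℂ) x * TensorProduct.map (LinearMap.mul' ℂ A ∘ₗ
            TensorProduct.map LinearMap.id (antipode ℂ) ∘ₗ (TensorProduct.comm ℂ A A).toLinearMap)
          LinearMap.id
          ((TensorProduct.assoc ℂ A A A).symm ((comul (R := ℂ) (A := A)).lTensor A t))) := by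
      intro t
      induction t with
      | zero => simp
      | add t t' h h' => simp only [map_add, Finset.sum_add_distrib, h, h', mul_add]
      | tmul s p =>
        simp only [contractLeft'_tmul, map_smul]
        refine (sum_contractLeft' b φ _ _).trans ?_
        rw [LinearMap.comp_apply, LinearMap.mulLeft_apply, Bialgebra.comul_mul,
          LinearMap.lTensor_tmul]
        generalize comul (R := ℂ) p = D
        induction D with
        | zero => simp
        | add t t' h h' => simp only [map_add, TensorProduct.tmul_add, mul_add, h, h']
        | tmul p q =>
          rw [contractLeft'_mul_tmul, TensorProduct.assoc_symm_tmul, TensorProduct.map_tmul,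
            contractLeft'_mul_tmul]
          congr 3
          ext z
          simp [mul_assoc]
    refine (e1 _).trans ?_
    rw [antipode_mul_comul hS, contractLeft'_mul_tmul]
    congr 3
    ext z
    simp
  have h2 : ∑ j, U j ∘ₗ V j = φ 1 • LinearMap.mul ℂ A x := by
    refine LinearMap.ext fun z => ?_
    rw [LinearMap.sum_apply]
    have e1 : ∀ t : A ⊗[ℂ] A,
        ∑ j, U j (contractLeft' (φ ∘ₗ LinearMap.mulRight ℂ (b j)) t) =
        contractLeft' φ (TensorProduct.map (LinearMap.mul' ℂ A ∘ₗ (antipode ℂ).lTensor A)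
          LinearMap.id
          ((TensorProduct.assoc ℂ A A A).symm ((comul (R := ℂ) (A := A)).lTensor A t))) := by
      intro t
      induction t with
      | zero => simp
      | add t t' h h' => simp only [map_add, Finset.sum_add_distrib, h, h']
      | tmul s p =>
        simp only [contractLeft'_tmul, map_smul, U, LinearMap.comp_apply, LinearMap.lTensor_tmul]
        generalize comul (R := ℂ) p = D
        induction D with
        | zero => simp
        | add t t' h h' =>
          simp only [map_add, TensorProduct.tmul_add, smul_add, Finset.sum_add_distrib, h, h']
        | tmul p q =>
          rw [TensorProduct.assoc_symm_tmul, TensorProduct.map_tmul, contractLeft'_tmul]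
          simp only [contractLeft'_tmul, smul_smul, ← Finset.sum_smul, LinearMap.comp_apply,
            LinearMap.mulRight_apply, mul_comm (φ _)]
          rw [sum_coord_mul]
          simp
    refine (e1 _).trans ?_
    rw [LinearMap.comp_apply, mul_antipode_comul]
    rfl
  rw [← regTrace_eq_of_sum U V _ x (φ 1) h1 h2]
  generalize comul (R := ℂ) x = t
  induction t with
  | zero => simp
  | add t t' h h' => simp only [map_add, h, h']
  | tmul p q => simp [contractLeft'_tmul]

/-- A finite-dimensional semisimple Hopf algebra has a normalized integral. -/
theorem exists_integral [IsSemisimpleRing A] :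
    ∃ l : A, (∀ a, a * l = counit (R := ℂ) a • l) ∧ (∀ a, l * a = counit (R := ℂ) a • l) ∧
      counit (R := ℂ) l = 1 := by
  -- The kernel of the counit is a left ideal. Semisimplicity gives a complementary left ideal `J`,
  -- and the integral is the component `j` of `1` in `J`: the element `a j - ε(a) j` lies in both
  -- ideals.
  let K : Submodule A A :=
    { carrier := {a | counit (R := ℂ) a = 0}
      add_mem' := fun {a b} (ha : counit a = 0) (hb : counit b = 0) => by
        change counit (a + b) = (0 : ℂ)
        rw [map_add, ha, hb, add_zero]
      zero_mem' := map_zero _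
      smul_mem' := fun c a (ha : counit a = 0) => by
        change counit (c * a) = (0 : ℂ)
        rw [Bialgebra.counit_mul, ha, mul_zero] }
  obtain ⟨J, hJ⟩ := exists_isCompl K
  obtain ⟨k, hk, j, hj, hkj⟩ := Submodule.mem_sup.1
    (hJ.sup_eq_top ▸ Submodule.mem_top : (1 : A) ∈ K ⊔ J)
  have hk' : counit (R := ℂ) k = 0 := hk
  have hεj : counit (R := ℂ) j = 1 := by
    have := congrArg (counit (R := ℂ)) hkj
    rwa [map_add, hk', zero_add, Bialgebra.counit_one] at this
  have hleft : ∀ a, a * j = counit (R := ℂ) a • j := fun a => by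
    have h1 : a * j - counit (R := ℂ) a • j ∈ K := by
      change counit (R := ℂ) (a * j - counit (R := ℂ) a • j) = 0
      rw [map_sub, Bialgebra.counit_mul, map_smul, hεj, smul_eq_mul, sub_self]
    have h2 : a * j - counit (R := ℂ) a • j ∈ J := by
      refine J.sub_mem (J.smul_mem a hj) ?_
      rw [← one_mul j, ← smul_mul_assoc]
      exact J.smul_mem _ hj
    exact sub_eq_zero.1 ((Submodule.disjoint_def.1 hJ.disjoint) _ h1 h2)
  have hright : ∀ a, antipode ℂ j * a = counit (R := ℂ) a • antipode ℂ j := fun a => by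
    rw [← hS a, ← antipode_mul_antidistrib, hleft, map_smul, hS, counit_antipode]
  -- Since `S(j)` is a right integral and `j` a left one, both equal the product `S(j) j`.
  have hjj : antipode ℂ j = j := by
    have h1 := hright j
    rw [hleft, counit_antipode, hεj, one_smul, one_smul] at h1
    exact h1.symm
  refine ⟨j, hleft, fun a => ?_, hεj⟩
  have := hright a
  rwa [hjj] at this

-- Left multiplication by `l` is the rank-one operator `a ↦ ε(a) l`, whose trace is `ε(l)`.
omit hS in
theorem regTrace_integral {l : A} (hl : ∀ a, l * a = counit (R := ℂ) a • l)
    (h1 : counit (R := ℂ) l = 1) : regTrace A l = 1 := by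
  have : LinearMap.mul ℂ A l = LinearMap.toSpanSingleton ℂ A l ∘ₗ counit :=
    LinearMap.ext hl
  rw [regTrace, LinearMap.comp_apply, this, LinearMap.trace_comp_comm']
  have : (counit (R := ℂ) (A := A)) ∘ₗ LinearMap.toSpanSingleton ℂ A l = LinearMap.id := by
    ext; simp [h1]
  rw [this, LinearMap.trace_id, Module.finrank_self, Nat.cast_one]

end Integral

/-! ### Group-like elements of trace equal to the dimension -/

/-- The eigenvalues are roots of unity, so their real parts are at most `1`; as they sum to `dim V`,
each eigenvalue is `1`. Then `∑ Lⁱ` over `i < n` has only the eigenvalue `n ≠ 0`. It is therefore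
invertible, and `(L - 1) ∑ Lⁱ = Lⁿ - 1 = 0` forces `L = 1`. -/
theorem eq_one_of_pow_eq_one_of_trace {V : Type} [AddCommGroup V] [Module ℂ V]
    [FiniteDimensional ℂ V] (L : Module.End ℂ V) {n : ℕ} (hn : 0 < n) (hL : L ^ n = 1)
    (ht : LinearMap.trace ℂ V L = Module.finrank ℂ V) : L = 1 := by
  by_cases hV : Nontrivial V
  swap
  · rw [not_nontrivial_iff_subsingleton] at hV
    exact Subsingleton.elim _ _
  have hpow : ∀ μ ∈ spectrum ℂ L, μ ^ n = 1 := fun μ hμ => by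
    have h := spectrum.subset_polynomial_aeval L (Polynomial.X ^ n) ⟨μ, hμ, rfl⟩
    simp only [Polynomial.eval_pow, Polynomial.eval_X, map_pow, Polynomial.aeval_X, hL,
      spectrum.one_eq] at h
    exact h
  have hre : ∀ μ ∈ L.charpoly.roots, 0 ≤ 1 - μ.re := fun μ hμ => by
    have h1 : ‖μ‖ = 1 := Complex.norm_eq_one_of_pow_eq_one
      (hpow μ ((Module.End.mem_spectrum_iff_isRoot_charpoly L μ).2
        (Polynomial.isRoot_of_mem_roots hμ))) hn.ne'
    linarith [Complex.re_le_norm μ]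
  have hs : L.charpoly.Splits := IsAlgClosed.splits _
  have hsum := Module.End.trace_eq_sum_roots_charpoly_of_splits hs
  have hcard : Multiset.card L.charpoly.roots = Module.finrank ℂ V := by
    rw [← hs.natDegree_eq_card_roots, LinearMap.charpoly_natDegree]
  have hzero : (L.charpoly.roots.map fun μ => 1 - μ.re).sum = 0 := by
    rw [Multiset.sum_map_sub, Multiset.map_const', Multiset.sum_replicate, hcard]
    have : (L.charpoly.roots.map fun μ => μ.re).sum = (L.charpoly.roots.sum).re :=
      (map_multiset_sum Complex.reAddGroupHom _).symm
    rw [this, ← hsum, ht]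
    simp
  have hone : ∀ μ ∈ spectrum ℂ L, μ = 1 := fun μ hμ => by
    have hr : μ ∈ L.charpoly.roots := (Polynomial.mem_roots (LinearMap.charpoly_monic L).ne_zero).2
      ((Module.End.mem_spectrum_iff_isRoot_charpoly L μ).1 hμ)
    have h0 : 1 - μ.re = 0 := Multiset.all_zero_of_le_zero_le_of_sum_eq_zero
      (Multiset.forall_mem_map_iff.2 hre) hzero
      _ (Multiset.mem_map_of_mem (fun μ : ℂ => 1 - μ.re) hr)
    have h1 : ‖μ‖ = 1 := Complex.norm_eq_one_of_pow_eq_one (hpow μ hμ) hn.ne'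
    have h2 : μ.re = ‖μ‖ := by rw [h1]; linarith
    have h3 := Complex.re_eq_norm.1 h2
    rw [Complex.nonneg_iff] at h3
    exact Complex.ext (by simp; linarith) (by simp [← h3.2])
  have hu : IsUnit (∑ i ∈ Finset.range n, L ^ i) := by
    rw [← spectrum.zero_notMem_iff ℂ]
    intro h0
    have e : ∑ i ∈ Finset.range n, L ^ i =
        Polynomial.aeval L (∑ i ∈ Finset.range n, (Polynomial.X : Polynomial ℂ) ^ i) := by simp
    rw [e, spectrum.map_polynomial_aeval_of_nonempty L _
      (spectrum.nonempty_of_isAlgClosed_of_finiteDimensional ℂ L)] at h0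
    obtain ⟨μ, hμ, h⟩ := h0
    rw [hone μ hμ] at h
    simp at h
    omega
  have hz : (L - 1) * ∑ i ∈ Finset.range n, L ^ i = 0 := by
    rw [mul_geom_sum, hL, sub_self]
  exact sub_eq_zero.1 ((hu.mul_left_eq_zero).1 hz)

/-- Group-like elements are linearly independent, so they form a finite group, and left
multiplication by `g` has finite order. -/
theorem isGroupLikeElem_eq_one {A : Type} [Ring A] [HopfAlgebra ℂ A] [FiniteDimensional ℂ A]
    {g : A} (hg : IsGroupLikeElem ℂ g)
    (ht : LinearMap.trace ℂ A (LinearMap.mul ℂ A g) = Module.finrank ℂ A) : g = 1 := by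
  have : Finite (GroupLike ℂ A) :=
    (linearIndep_groupLikeVal (R := ℂ) (A := A)).finite
  have h1 := pow_orderOf_eq_one (⟨g, hg⟩ : GroupLike ℂ A)
  have h2 : g ^ orderOf (⟨g, hg⟩ : GroupLike ℂ A) = 1 := congrArg GroupLike.val h1
  have h3 := eq_one_of_pow_eq_one_of_trace (LinearMap.mul ℂ A g) (orderOf_pos _)
    (by
      change (Algebra.lmul ℂ A g) ^ _ = 1
      rw [← map_pow, h2, map_one]) ht
  simpa using LinearMap.congr_fun h3 1

/-! ### Duality pairs -/

section DualPair

variable {T : Type u} [Category.{v} T] [MonoidalCategory T]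

/-- A rigidity pair `p : U ⊗ L ⟶ 1`, `q : 1 ⟶ L ⊗ U`. -/
structure DualPair (U L : T) where
  p : U ⊗ L ⟶ 𝟙_ T
  q : 𝟙_ T ⟶ L ⊗ U
  zig : U ◁ q ⊗≫ p ▷ U = ⊗𝟙.hom
  zag : q ▷ L ⊗≫ L ◁ p = ⊗𝟙.hom

/-- The rigidity pair of an exact pairing. -/
def DualPair.ofExact {U L : T} (P : ExactPairing L U) : DualPair U L where
  p := P.evaluation'
  q := P.coevaluation'
  zig := by let := P; exact ExactPairing.coevaluation_evaluation'' L U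
  zag := by let := P; exact ExactPairing.evaluation_coevaluation'' L U

namespace DualPair

variable {U L : T} (P : DualPair U L) {W R : T}

/-- Transposition of `U` to the left. -/
def lm (f : U ⊗ W ⟶ R) : W ⟶ L ⊗ R := 𝟙 _ ⊗≫ P.q ▷ W ⊗≫ L ◁ f

/-- The inverse of `lm`. -/
def le (a : W ⟶ L ⊗ R) : U ⊗ W ⟶ R := U ◁ a ⊗≫ P.p ▷ R ⊗≫ 𝟙 _

/-- Transposition of `L` to the right. -/
def rm (f : W ⊗ L ⟶ R) : W ⟶ R ⊗ U := 𝟙 _ ⊗≫ W ◁ P.q ⊗≫ f ▷ U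

/-- The inverse of `rm`. -/
def re (a : W ⟶ R ⊗ U) : W ⊗ L ⟶ R := a ▷ L ⊗≫ R ◁ P.p ⊗≫ 𝟙 _

theorem le_lm (f : U ⊗ W ⟶ R) : P.le (P.lm f) = f := by
  calc _ = 𝟙 _ ⊗≫ U ◁ P.q ▷ W ⊗≫ (((U ⊗ L) ◁ f) ≫ P.p ▷ R) ⊗≫ 𝟙 _ := by
        simp only [le, lm]; monoidal
    _ = 𝟙 _ ⊗≫ (U ◁ P.q ⊗≫ P.p ▷ U) ▷ W ⊗≫ f ⊗≫ 𝟙 _ := by rw [whisker_exchange]; monoidal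
    _ = f := by rw [P.zig]; monoidal

theorem lm_le (a : W ⟶ L ⊗ R) : P.lm (P.le a) = a := by
  calc _ = 𝟙 _ ⊗≫ (P.q ▷ W ≫ (L ⊗ U) ◁ a) ⊗≫ L ◁ P.p ▷ R ⊗≫ 𝟙 _ := by
        simp only [le, lm]; monoidal
    _ = 𝟙 _ ⊗≫ a ⊗≫ (P.q ▷ L ⊗≫ L ◁ P.p) ▷ R ⊗≫ 𝟙 _ := by rw [← whisker_exchange]; monoidal
    _ = a := by rw [P.zag]; monoidal

theorem re_rm (f : W ⊗ L ⟶ R) : P.re (P.rm f) = f := by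
  calc _ = 𝟙 _ ⊗≫ W ◁ P.q ▷ L ⊗≫ (f ▷ (U ⊗ L) ≫ R ◁ P.p) ⊗≫ 𝟙 _ := by
        simp only [re, rm]; monoidal
    _ = 𝟙 _ ⊗≫ W ◁ (P.q ▷ L ⊗≫ L ◁ P.p) ⊗≫ f ⊗≫ 𝟙 _ := by rw [← whisker_exchange]; monoidal
    _ = f := by rw [P.zag]; monoidal

theorem rm_re (a : W ⟶ R ⊗ U) : P.rm (P.re a) = a := by
  calc _ = 𝟙 _ ⊗≫ (W ◁ P.q ≫ a ▷ (L ⊗ U)) ⊗≫ R ◁ P.p ▷ U ⊗≫ 𝟙 _ := by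
        simp only [re, rm]; monoidal
    _ = 𝟙 _ ⊗≫ a ⊗≫ R ◁ (U ◁ P.q ⊗≫ P.p ▷ U) ⊗≫ 𝟙 _ := by rw [whisker_exchange]; monoidal
    _ = a := by rw [P.zig]; monoidal

theorem le_injective {a b : W ⟶ L ⊗ R} (h : P.le a = P.le b) : a = b := by
  rw [← P.lm_le a, h, P.lm_le]

theorem re_injective {a b : W ⟶ R ⊗ U} (h : P.re a = P.re b) : a = b := by
  rw [← P.rm_re a, h, P.rm_re]

theorem cancel_left {a b : W ⟶ L} (h : U ◁ a ≫ P.p = U ◁ b ≫ P.p) : a = b := by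
  have : a ≫ (ρ_ L).inv = b ≫ (ρ_ L).inv := P.le_injective (by
    have e : ∀ a : W ⟶ L, P.le (a ≫ (ρ_ L).inv) = U ◁ a ≫ P.p := fun a => by
      simp only [le]; monoidal
    rw [e, e, h])
  simpa using this

theorem cancel_right {a b : W ⟶ U} (h : a ▷ L ≫ P.p = b ▷ L ≫ P.p) : a = b := by
  have : a ≫ (λ_ U).inv = b ≫ (λ_ U).inv := P.re_injective (by
    have e : ∀ a : W ⟶ U, P.re (a ≫ (λ_ U).inv) = a ▷ L ≫ P.p := fun a => by
      simp only [re]; monoidal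
    rw [e, e, h])
  simpa using this

/-- The morphism `W ⟶ L` given by a pairing of `U` and `W`. -/
def mateL (f : U ⊗ W ⟶ 𝟙_ T) : W ⟶ L := P.lm f ≫ (ρ_ L).hom

/-- The morphism `W ⟶ U` given by a pairing of `W` and `L`. -/
def mateR (f : W ⊗ L ⟶ 𝟙_ T) : W ⟶ U := P.rm f ≫ (λ_ U).hom

theorem mateL_p (f : U ⊗ W ⟶ 𝟙_ T) : U ◁ P.mateL f ≫ P.p = f := by
  refine Eq.trans ?_ (P.le_lm f)
  simp only [mateL, le]; monoidal

theorem mateR_p (f : W ⊗ L ⟶ 𝟙_ T) : P.mateR f ▷ L ≫ P.p = f := by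
  refine Eq.trans ?_ (P.re_rm f)
  simp only [mateR, re]; monoidal

/-- A copairing is determined by its pairing: under the bijection `re` both sides become the zigzag,
hence a canonical isomorphism. -/
theorem q_comp {U' : T} (Q : DualPair U' L) (a : U ⟶ U') (h : a ▷ L ≫ Q.p = P.p) :
    P.q ≫ L ◁ a = Q.q := by
  apply Q.re_injective
  calc _ = 𝟙 _ ⊗≫ P.q ▷ L ⊗≫ L ◁ (a ▷ L ≫ Q.p) ⊗≫ 𝟙 _ := by simp only [re]; monoidal
    _ = 𝟙 _ ⊗≫ (P.q ▷ L ⊗≫ L ◁ P.p) ⊗≫ 𝟙 _ := by rw [h]; monoidal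
    _ = 𝟙 _ ⊗≫ (Q.q ▷ L ⊗≫ L ◁ Q.p) ⊗≫ 𝟙 _ := by rw [P.zag, Q.zag]
    _ = _ := by simp only [re]; monoidal

/-- Two objects paired with the same object are isomorphic. -/
def isoLeft {U' : T} (Q : DualPair U' L) : U ≅ U' where
  hom := Q.mateR P.p
  inv := P.mateR Q.p
  hom_inv_id := P.cancel_right (by
    rw [comp_whiskerRight, Category.assoc, mateR_p, mateR_p, id_whiskerRight, Category.id_comp])
  inv_hom_id := Q.cancel_right (by
    rw [comp_whiskerRight, Category.assoc, mateR_p, mateR_p, id_whiskerRight, Category.id_comp])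

theorem isoLeft_hom_p {U' : T} (Q : DualPair U' L) : (P.isoLeft Q).hom ▷ L ≫ Q.p = P.p :=
  Q.mateR_p _

end DualPair

/-- The pairing of tensor products. -/
def tensorPairing {U V L M : T} (p : U ⊗ L ⟶ 𝟙_ T) (r : V ⊗ M ⟶ 𝟙_ T) :
    (U ⊗ V) ⊗ (M ⊗ L) ⟶ 𝟙_ T :=
  𝟙 _ ⊗≫ U ◁ r ▷ L ⊗≫ p

theorem tensorPairing_right {U V L M L' M' : T} (p : U ⊗ L ⟶ 𝟙_ T) (r : V ⊗ M ⟶ 𝟙_ T)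
    (θ : L' ⟶ L) (ψ : M' ⟶ M) :
    tensorPairing (U ◁ θ ≫ p) (V ◁ ψ ≫ r) = (U ⊗ V) ◁ (ψ ⊗ₘ θ) ≫ tensorPairing p r := by
  simp only [tensorPairing, tensorHom_def']
  calc _ = 𝟙 _ ⊗≫ U ◁ V ◁ ψ ▷ L' ⊗≫ U ◁ (r ▷ L' ≫ 𝟙_ T ◁ θ) ⊗≫ p := by monoidal
    _ = 𝟙 _ ⊗≫ U ◁ (V ◁ (ψ ▷ L' ≫ M ◁ θ)) ⊗≫ U ◁ r ▷ L ⊗≫ p := by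
        rw [← whisker_exchange]; monoidal
    _ = _ := by rw [← whisker_exchange]; monoidal

theorem tensorPairing_left {U V L M L' M' : T} (p : L ⊗ U ⟶ 𝟙_ T) (r : M ⊗ V ⟶ 𝟙_ T)
    (θ : L' ⟶ L) (ψ : M' ⟶ M) :
    tensorPairing (ψ ▷ V ≫ r) (θ ▷ U ≫ p) = (ψ ⊗ₘ θ) ▷ (U ⊗ V) ≫ tensorPairing r p := by
  simp only [tensorPairing, MonoidalCategory.tensorHom_def]
  calc _ = 𝟙 _ ⊗≫ M' ◁ θ ▷ U ▷ V ⊗≫ (M' ◁ p ≫ ψ ▷ 𝟙_ T) ▷ V ⊗≫ r := by monoidal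
    _ = 𝟙 _ ⊗≫ (M' ◁ θ ≫ ψ ▷ L) ▷ U ▷ V ⊗≫ M ◁ p ▷ V ⊗≫ r := by
        rw [whisker_exchange]; monoidal
    _ = _ := by rw [whisker_exchange]; monoidal

/-! ### Images of pairings under a monoidal functor -/

section Map

open Functor.LaxMonoidal Functor.OplaxMonoidal

variable {C : Type*} [Category* C] [MonoidalCategory C] (F : C ⥤ T) [F.Monoidal]

/-- The image of a pairing under a monoidal functor. -/
def mapPairing {U L : C} (p : U ⊗ L ⟶ 𝟙_ C) : F.obj U ⊗ F.obj L ⟶ 𝟙_ T :=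
  μ F U L ≫ F.map p ≫ η F

/-- The image of a copairing under a monoidal functor. -/
def mapCopairing {U L : C} (q : 𝟙_ C ⟶ L ⊗ U) : 𝟙_ T ⟶ F.obj L ⊗ F.obj U :=
  ε F ≫ F.map q ≫ δ F L U

theorem mapPairing_left {U U' L : C} (f : U' ⟶ U) (p : U ⊗ L ⟶ 𝟙_ C) :
    F.map f ▷ F.obj L ≫ mapPairing F p = mapPairing F (f ▷ L ≫ p) := by
  simp [mapPairing]

theorem mapPairing_right {U L L' : C} (f : L' ⟶ L) (p : U ⊗ L ⟶ 𝟙_ C) :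
    F.obj U ◁ F.map f ≫ mapPairing F p = mapPairing F (U ◁ f ≫ p) := by
  simp [mapPairing]

/-- Through this, the multiplicativity of the duality of `T` can be read as a statement about tensor
products of modules. -/
theorem tensorPairing_mapPairing {U V L M : C} (p : U ⊗ L ⟶ 𝟙_ C) (r : V ⊗ M ⟶ 𝟙_ C) :
    tensorPairing (mapPairing F p) (mapPairing F r) =
      (μ F U V ⊗ₘ μ F M L) ≫ mapPairing F (tensorPairing p r) := by
  have e : F.map (tensorPairing p r) = F.map ((α_ U V (M ⊗ L)).hom ≫ U ◁ (α_ V M L).inv ≫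
      U ◁ r ▷ L ≫ U ◁ (λ_ L).hom ≫ p) := by
    simp [tensorPairing, monoidalComp]
  simp only [mapPairing, e, Functor.map_comp, Functor.Monoidal.map_associator,
    Functor.Monoidal.map_associator_inv, Functor.Monoidal.map_whiskerLeft,
    Functor.Monoidal.map_whiskerRight, Functor.Monoidal.map_leftUnitor, Category.assoc,
    Functor.Monoidal.μ_δ_assoc, whiskerLeft_comp]
  simp only [← whiskerLeft_comp_assoc, ← comp_whiskerRight_assoc, Functor.Monoidal.μ_δ_assoc]
  rw [tensorHom_def', Category.assoc, ← comp_whiskerRight_assoc, Functor.Monoidal.μ_δ]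
  have e2 : F.obj U ◁ F.obj V ◁ μ F M L ≫ F.obj U ◁ F.obj V ◁ δ F M L = 𝟙 _ := by
    rw [← whiskerLeft_comp, ← whiskerLeft_comp, Functor.Monoidal.μ_δ, whiskerLeft_id,
      whiskerLeft_id]
  simp only [id_whiskerRight, Category.id_comp, tensor_whiskerLeft, whiskerLeft_comp, Category.assoc,
    Iso.inv_hom_id_assoc, reassoc_of% e2, tensorPairing]
  monoidal

/-- The image of a rigidity pair under a monoidal functor. -/
def DualPair.map {U L : C} (P : DualPair U L) : DualPair (F.obj U) (F.obj L) where
  p := mapPairing F P.p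
  q := mapCopairing F P.q
  zig := by
    have e : U ◁ P.q ≫ (α_ _ _ _).inv ≫ P.p ▷ U = (ρ_ U).hom ≫ (λ_ U).inv := by
      simpa [monoidalComp] using P.zig
    have := congrArg (fun f => F.obj U ◁ ε F ≫ μ F _ _ ≫ F.map f ≫
      δ F _ _ ≫ η F ▷ F.obj U) e
    simp only [Functor.map_comp, Functor.Monoidal.map_associator_inv,
      Functor.Monoidal.map_whiskerLeft, Functor.Monoidal.map_rightUnitor,
      Functor.Monoidal.map_leftUnitor_inv, Functor.Monoidal.map_whiskerRight, Category.assoc,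
      Functor.Monoidal.μ_δ_assoc] at this
    simp [-Functor.OplaxMonoidal.associativity_inv_assoc,
      -Functor.LaxMonoidal.associativity_inv_assoc] at this
    simpa [monoidalComp, mapPairing, mapCopairing] using this
  zag := by
    have e : P.q ▷ L ≫ (α_ _ _ _).hom ≫ L ◁ P.p = (λ_ L).hom ≫ (ρ_ L).inv := by
      simpa [monoidalComp] using P.zag
    have := congrArg (fun f => ε F ▷ F.obj L ≫ μ F _ _ ≫ F.map f ≫
      δ F _ _ ≫ F.obj L ◁ η F) e
    simp only [Functor.map_comp, Functor.Monoidal.map_associator,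
      Functor.Monoidal.map_whiskerLeft, Functor.Monoidal.map_rightUnitor_inv,
      Functor.Monoidal.map_leftUnitor, Functor.Monoidal.map_whiskerRight, Category.assoc,
      Functor.Monoidal.μ_δ_assoc] at this
    simp [-Functor.OplaxMonoidal.associativity_assoc,
      -Functor.LaxMonoidal.associativity_assoc] at this
    simpa [monoidalComp, mapPairing, mapCopairing] using this

theorem mapPairing_injective [F.Faithful] {U L : C} {p p' : U ⊗ L ⟶ 𝟙_ C}
    (h : mapPairing F p = mapPairing F p') : p = p' := by
  apply F.map_injective
  rw [mapPairing, mapPairing, cancel_epi, cancel_mono] at h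
  exact h

theorem mapPairing_surjective [F.Full] {U L : C} (p : F.obj U ⊗ F.obj L ⟶ 𝟙_ T) :
    ∃ m : U ⊗ L ⟶ 𝟙_ C, mapPairing F m = p :=
  ⟨F.preimage (δ F U L ≫ p ≫ ε F), by simp [mapPairing]⟩

end Map

end DualPair

/-! ### Frobenius pairs, independently of the chosen dual object -/

section Frob

variable {T : Type u} [Category.{v} T] [Abelian T] [Linear ℂ T] [MonoidalCategory T]
  [FrobeniusDuality T]

/-- The rigidity pair of `ε_X`. -/
def frobPair (X : T) : DualPair X (dualObj X) := DualPair.ofExact (FrobeniusDuality.pair X)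

/-- The rigidity pair of `ε_{X^*}`. -/
def frobPairStar (X : T) : DualPair (dualObj X) X := DualPair.ofExact (FrobeniusDuality.pairStar X)

theorem frobPair_p (X : T) : (frobPair X).p = ev X := rfl

theorem frobPair_q (X : T) : (frobPair X).q = coev X := rfl

/-- The pairings `p` and `p'` are the two pairings of the Frobenius duality, up to an
identification of `L` with the dual object of `U`. -/
def IsFrob {U L : T} (p : U ⊗ L ⟶ 𝟙_ T) (p' : L ⊗ U ⟶ 𝟙_ T) : Prop :=
  ∃ θ : L ≅ dualObj U, p = U ◁ θ.hom ≫ ev U ∧ p' = θ.hom ▷ U ≫ evStar U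

theorem isFrob_ev (X : T) : IsFrob (ev X) (evStar X) := ⟨Iso.refl _, by simp, by simp⟩

/-- Each side says that `k` is the transpose of `f` for one of the two rigidity pairs, and
naturality of the duality says that the two transposes coincide. -/
theorem transpose_iff {U V : T} (f : U ⟶ V) (k : dualObj V ⟶ dualObj U) :
    U ◁ k ≫ ev U = f ▷ dualObj V ≫ ev V ↔ k ▷ U ≫ evStar U = dualObj V ◁ f ≫ evStar V := by
  have h := FrobeniusDuality.natural f
  have h1 : (frobPair U).mateL (f ▷ dualObj V ≫ ev V) =
      (frobPairStar U).mateR (dualObj V ◁ f ≫ evStar V) := by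
    refine Eq.trans ?_ (h.trans ?_)
    · simp only [DualPair.mateL, DualPair.lm]
      simp [monoidalComp, frobPair, DualPair.ofExact, ev]
    · simp only [DualPair.mateR, DualPair.rm]
      simp [monoidalComp, frobPairStar, DualPair.ofExact, evStar]
  constructor
  · intro hk
    have : k = (frobPair U).mateL (f ▷ dualObj V ≫ ev V) :=
      (frobPair U).cancel_left (by rw [DualPair.mateL_p]; exact hk)
    rw [this, h1]
    exact (frobPairStar U).mateR_p _
  · intro hk
    have : k = (frobPairStar U).mateR (dualObj V ◁ f ≫ evStar V) :=
      (frobPairStar U).cancel_right (by rw [DualPair.mateR_p]; exact hk)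
    rw [this, ← h1]
    exact (frobPair U).mateL_p _

/-- Conjugating by the identifications with the chosen dual objects frees `transpose_iff` from that
choice, so that it applies to objects such as `F(V^*)`. -/
theorem IsFrob.natural {U V L M : T} {p : U ⊗ L ⟶ 𝟙_ T} {p' : L ⊗ U ⟶ 𝟙_ T} {r : V ⊗ M ⟶ 𝟙_ T}
    {r' : M ⊗ V ⟶ 𝟙_ T} (hU : IsFrob p p') (hV : IsFrob r r') (f : U ⟶ V) (k : M ⟶ L) :
    U ◁ k ≫ p = f ▷ M ≫ r ↔ k ▷ U ≫ p' = M ◁ f ≫ r' := by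
  obtain ⟨θ, rfl, rfl⟩ := hU
  obtain ⟨ψ, rfl, rfl⟩ := hV
  have h := transpose_iff f (ψ.inv ≫ k ≫ θ.hom)
  have e1 : U ◁ (ψ.inv ≫ k ≫ θ.hom) ≫ ev U = f ▷ dualObj V ≫ ev V ↔
      U ◁ k ≫ U ◁ θ.hom ≫ ev U = f ▷ M ≫ V ◁ ψ.hom ≫ ev V := by
    rw [← cancel_epi (U ◁ ψ.hom)]
    simp [← whisker_exchange_assoc]
  have e2 : (ψ.inv ≫ k ≫ θ.hom) ▷ U ≫ evStar U = dualObj V ◁ f ≫ evStar V ↔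
      k ▷ U ≫ θ.hom ▷ U ≫ evStar U = M ◁ f ≫ ψ.hom ▷ V ≫ evStar V := by
    rw [← cancel_epi (ψ.hom ▷ U)]
    simp [whisker_exchange_assoc]
  rw [← e1, ← e2, h]

theorem IsFrob.tensor {U V L M : T} {p : U ⊗ L ⟶ 𝟙_ T} {p' : L ⊗ U ⟶ 𝟙_ T} {r : V ⊗ M ⟶ 𝟙_ T}
    {r' : M ⊗ V ⟶ 𝟙_ T} (hU : IsFrob p p') (hV : IsFrob r r') :
    IsFrob (tensorPairing p r) (tensorPairing r' p') := by
  obtain ⟨θ, h3, h4⟩ := hU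
  obtain ⟨ψ, h5, h6⟩ := hV
  obtain ⟨φ, h1, h2⟩ := FrobeniusDuality.multiplicative U V
  have h1' : ev (U ⊗ V) = (U ⊗ V) ◁ φ.hom ≫ tensorPairing (ev U) (ev V) := h1.trans (by
    simp [tensorPairing, monoidalComp, ev])
  have h2' : evStar (U ⊗ V) = φ.hom ▷ (U ⊗ V) ≫ tensorPairing (evStar V) (evStar U) := h2.trans (by
    simp [tensorPairing, monoidalComp, evStar])
  refine ⟨(ψ ⊗ᵢ θ) ≪≫ φ.symm, ?_, ?_⟩
  · rw [h1', h3, h5, tensorPairing_right, ← whiskerLeft_comp_assoc]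
    simp
  · rw [h2', h4, h6, tensorPairing_left, ← comp_whiskerRight_assoc]
    simp

end Frob

open Coalgebra HopfAlgebra

/-! ### Pairings of modules as bilinear forms, and the regular representation -/

namespace HRep

variable {A : Type} [Ring A] [HopfAlgebra ℂ A]

/-- The transpose of an `A`-linear map. -/
def dualMap {V W : HRep A} (h : V ⟶ W) : dual W ⟶ dual V :=
  ofLin (V := dual W) (W := dual V) (Module.Dual.transpose (R := ℂ) (lin h)) fun a => by
    refine LinearMap.ext fun (f : Module.Dual ℂ W) => LinearMap.ext fun v => ?_
    exact congrArg f (LinearMap.congr_fun (lin_comm h (antipode ℂ a)).symm v)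

theorem lin_dualMap {V W : HRep A} (h : V ⟶ W) (f : Module.Dual ℂ W) :
    lin (dualMap h) (dualVec W f) = dualVec V (f ∘ₗ lin h) := rfl

/-- The left regular representation. -/
def regRep (A : Type) [Ring A] [HopfAlgebra ℂ A] [FiniteDimensional ℂ A] : HRep A where
  carrier := A
  ρ := Algebra.lmul ℂ A

/-- An element of `A` as a vector of the regular representation. -/
def regVec [FiniteDimensional ℂ A] : A ≃ₗ[ℂ] (regRep A).carrier := LinearEquiv.refl _ _

/-- A pairing of modules as a bilinear form. -/
def form {U L : HRep A} (p : U ⊗ L ⟶ 𝟙_ (HRep A)) : U.carrier →ₗ[ℂ] L.carrier →ₗ[ℂ] ℂ :=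
  TensorProduct.curry (lin p : U.carrier ⊗[ℂ] L.carrier →ₗ[ℂ] ℂ)

theorem form_injective {U L : HRep A} {p p' : U ⊗ L ⟶ 𝟙_ (HRep A)} (h : form p = form p') :
    p = p' :=
  hom_ext (TensorProduct.ext h)

theorem form_left {U U' L : HRep A} (f : U' ⟶ U) (p : U ⊗ L ⟶ 𝟙_ (HRep A)) (u : U') (l : L) :
    form (f ▷ L ≫ p) u l = form p (lin f u) l := rfl

theorem form_right {U L L' : HRep A} (f : L' ⟶ L) (p : U ⊗ L ⟶ 𝟙_ (HRep A)) (u : U) (l : L') :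
    form (U ◁ f ≫ p) u l = form p u (lin f l) := rfl

theorem form_tensorPairing {U V L M : HRep A} (p : U ⊗ L ⟶ 𝟙_ (HRep A)) (r : V ⊗ M ⟶ 𝟙_ (HRep A))
    (u : U) (v : V) (l : L) (m : M) :
    form (tensorPairing p r) (u ⊗ₜ[ℂ] v) (m ⊗ₜ[ℂ] l) = form r v m * form p u l := by
  have e : tensorPairing p r = (α_ U V (M ⊗ L)).hom ≫ U ◁ (α_ V M L).inv ≫
      U ◁ r ▷ L ≫ U ◁ (λ_ L).hom ≫ p := by simp [tensorPairing, monoidalComp]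
  rw [e]
  exact ((form p u).map_smul (form r v m) l)

variable [FiniteDimensional ℂ A]

/-- The morphism from the regular representation given by a vector. -/
def ofVec (V : HRep A) (v : V) : regRep A ⟶ V :=
  ofLin (V := regRep A) (W := V) (LinearMap.applyₗ v ∘ₗ V.ρ.toLinearMap) fun a =>
    LinearMap.ext fun (b : A) => by
      change V.ρ (a * b) v = V.ρ a (V.ρ b v)
      rw [map_mul]
      rfl

theorem lin_ofVec (V : HRep A) (v : V) (a : A) : lin (ofVec V v) (regVec a) = V.ρ a v := rfl

/-- The action of `A ⊗ A` on the tensor square of the regular representation. -/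
def regAct₂ : A ⊗[ℂ] A →ₐ[ℂ] Module.End ℂ (A ⊗[ℂ] A) := act₂ (regRep A) (regRep A)

theorem regAct₂_eq (t : A ⊗[ℂ] A) : regAct₂ t = LinearMap.mulLeft ℂ t := by
  induction t with
  | zero => rw [map_zero]; ext; simp
  | add t t' h h' => rw [map_add, h, h']; ext; simp [add_mul]
  | tmul c d =>
    refine TensorProduct.ext' fun c' d' => ?_
    rw [LinearMap.mulLeft_apply, Algebra.TensorProduct.tmul_mul_tmul]
    exact LinearMap.congr_fun (act₂_tmul (regRep A) (regRep A) c d) _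

/-- An element of `A ⊗ A` as a vector of the tensor square of the regular representation. -/
def regVec₂ : A ⊗[ℂ] A ≃ₗ[ℂ] (regRep A ⊗ regRep A : HRep A).carrier := LinearEquiv.refl _ _

/-- The comultiplication as a morphism of regular representations. -/
def regComul (A : Type) [Ring A] [HopfAlgebra ℂ A] [FiniteDimensional ℂ A] :
    regRep A ⟶ regRep A ⊗ regRep A :=
  ofLin (V := regRep A) (W := tensor (regRep A) (regRep A)) (comul (R := ℂ) (A := A)) fun a =>
    LinearMap.ext fun (b : A) => (Bialgebra.comul_mul a b).trans
      (LinearMap.congr_fun (regAct₂_eq (comul (R := ℂ) a)) (comul (R := ℂ) b)).symm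

/-- The order of `ψ` and `φ` is reversed because `(U ⊗ V)^* = V^* ⊗ U^*`. -/
theorem form_evalDual_square (φ ψ : Module.Dual ℂ A) (x : A ⊗[ℂ] A) :
    form (tensorPairing (evalDual (regRep A)) (evalDual (regRep A)))
      (dualVec (regRep A) ψ ⊗ₜ[ℂ] dualVec (regRep A) φ) (regVec₂ x) =
        TensorProduct.dualDistrib ℂ A A (φ ⊗ₜ ψ) x := by
  induction x with
  | zero => simp
  | add x y hx hy => rw [map_add, map_add, map_add, hx, hy]
  | tmul a b => exact form_tensorPairing _ _ _ _ _ _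

end HRep

theorem eq_of_dualDistrib {V : Type} [AddCommGroup V] [Module ℂ V] [FiniteDimensional ℂ V]
    {x y : V ⊗[ℂ] V} (h : ∀ φ ψ : Module.Dual ℂ V, TensorProduct.dualDistrib ℂ V V (φ ⊗ₜ ψ) x =
      TensorProduct.dualDistrib ℂ V V (φ ⊗ₜ ψ) y) : x = y := by
  let b := Module.finBasis ℂ V
  have e : ∀ (i j) (x : V ⊗[ℂ] V), (b.tensorProduct b).repr x (i, j) =
      TensorProduct.dualDistrib ℂ V V (b.coord i ⊗ₜ b.coord j) x := fun i j x => by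
    induction x with
    | zero => simp
    | add x y hx hy => rw [map_add, map_add, Finsupp.add_apply, hx, hy]
    | tmul x y => simp [mul_comm]
  refine (b.tensorProduct b).ext_elem fun ⟨i, j⟩ => ?_
  rw [e, e, h]

attribute [local instance] Abelian.hasFiniteBiproducts

/-! ### The pivot of a realized Hopf algebra is trivial -/

section Realized

variable {T : Type u} [Category.{v} T] [Abelian T] [Linear ℂ T] [MonoidalCategory T]
  [MonoidalPreadditive T] [MonoidalLinear ℂ T] [SemisimpleTensorCategory T] [FrobeniusDuality T]

open HRep Functor.LaxMonoidal Functor.OplaxMonoidal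

namespace HopfIn

variable (𝒜 : HopfIn T)

/-- `F(V^*)` and the dual object of `F(V)` are both paired with `F(V)`, hence isomorphic.
Transported along this isomorphism, `ε` becomes a morphism `F(V) ⊗ F(V^*) ⟶ 1`, which comes from a
module map because `F` is full. -/
theorem exists_twist (V : HRep 𝒜.A) : ∃ m : V ⊗ dual V ⟶ 𝟙_ (HRep 𝒜.A),
    IsFrob (mapPairing 𝒜.F m) (mapPairing 𝒜.F (evalDual V)) := by
  let D : DualPair (𝒜.F.obj (dual V)) (𝒜.F.obj V) := (DualPair.ofExact (dualPairing V)).map 𝒜.F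
  obtain ⟨m, hm⟩ := mapPairing_surjective 𝒜.F
    (𝒜.F.obj V ◁ (D.isoLeft (frobPairStar (𝒜.F.obj V))).hom ≫ ev (𝒜.F.obj V))
  exact ⟨m, D.isoLeft (frobPairStar (𝒜.F.obj V)), hm, (D.isoLeft_hom_p _).symm⟩

/-- The pairing of `V` and `V^*` that corresponds to the pairing `ε` of `F(V)`. -/
def twist (V : HRep 𝒜.A) : V ⊗ dual V ⟶ 𝟙_ (HRep 𝒜.A) := (𝒜.exists_twist V).choose

theorem isFrob_twist (V : HRep 𝒜.A) :
    IsFrob (mapPairing 𝒜.F (𝒜.twist V)) (mapPairing 𝒜.F (evalDual V)) :=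
  (𝒜.exists_twist V).choose_spec

/-- For `evalDual` the corresponding identity is the definition of `dualMap`; `IsFrob.natural`
carries it to the other pairing. -/
theorem twist_natural {V W : HRep 𝒜.A} (h : V ⟶ W) :
    V ◁ dualMap h ≫ 𝒜.twist V = h ▷ dual W ≫ 𝒜.twist W := by
  apply mapPairing_injective 𝒜.F
  rw [← mapPairing_right, ← mapPairing_left,
    (𝒜.isFrob_twist V).natural (𝒜.isFrob_twist W), mapPairing_left, mapPairing_right]
  exact congrArg (mapPairing 𝒜.F) (form_injective rfl)

/-- The element of `A` by which the two pairings of `F(V)` and its dual differ. -/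
def pivot : 𝒜.A := (Module.evalEquiv ℂ 𝒜.A).symm
  (form (𝒜.twist (regRep 𝒜.A)) (regVec (1 : 𝒜.A)) ∘ₗ (dualVec (regRep 𝒜.A)).toLinearMap)

theorem apply_pivot (f : Module.Dual ℂ 𝒜.A) :
    form (𝒜.twist (regRep 𝒜.A)) (regVec (1 : 𝒜.A)) (dualVec (regRep 𝒜.A) f) = f 𝒜.pivot :=
  (LinearMap.congr_fun ((Module.evalEquiv ℂ 𝒜.A).apply_symm_apply _) f).symm

/-- A Yoneda argument: `v` is the image of `1` under `a ↦ a v`, so naturality reduces to the regular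
representation, where the pivot is defined. -/
theorem form_twist (V : HRep 𝒜.A) (v : V) (f : Module.Dual ℂ V) :
    form (𝒜.twist V) v (dualVec V f) = f (V.ρ 𝒜.pivot v) := by
  have h := congrArg (fun p => form p (regVec (1 : 𝒜.A)) (dualVec V f)) (𝒜.twist_natural (ofVec V v))
  simp only [form_left, form_right, lin_dualMap, lin_ofVec, map_one] at h
  exact h.symm.trans (𝒜.apply_pivot _)

/-- `k0` is the transpose of the comultiplication for `evalDual`. By multiplicativity the tensor
squares of the two pairings again form a Frobenius pair, so by naturality `k0` is also the transpose
for `twist`. -/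
theorem exists_comul_transpose :
    ∃ k0 : dual (regRep 𝒜.A) ⊗ dual (regRep 𝒜.A) ⟶ dual (regRep 𝒜.A),
      k0 ▷ regRep 𝒜.A ≫ evalDual (regRep 𝒜.A) =
        (dual (regRep 𝒜.A) ⊗ dual (regRep 𝒜.A)) ◁ regComul 𝒜.A ≫
          tensorPairing (evalDual (regRep 𝒜.A)) (evalDual (regRep 𝒜.A)) ∧
      regRep 𝒜.A ◁ k0 ≫ 𝒜.twist (regRep 𝒜.A) =
        regComul 𝒜.A ▷ (dual (regRep 𝒜.A) ⊗ dual (regRep 𝒜.A)) ≫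
          tensorPairing (𝒜.twist (regRep 𝒜.A)) (𝒜.twist (regRep 𝒜.A)) := by
  let R := regRep 𝒜.A
  let k0 : dual R ⊗ dual R ⟶ dual R := (DualPair.ofExact (dualPairing R)).mateR
    ((dual R ⊗ dual R) ◁ regComul 𝒜.A ≫ tensorPairing (evalDual R) (evalDual R))
  have hk : k0 ▷ R ≫ evalDual R =
      (dual R ⊗ dual R) ◁ regComul 𝒜.A ≫ tensorPairing (evalDual R) (evalDual R) :=
    (DualPair.ofExact (dualPairing R)).mateR_p _
  have hF := (𝒜.isFrob_twist R).natural ((𝒜.isFrob_twist R).tensor (𝒜.isFrob_twist R))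
    (𝒜.F.map (regComul 𝒜.A) ≫ δ 𝒜.F R R) (μ 𝒜.F (dual R) (dual R) ≫ 𝒜.F.map k0)
  have h2 : R ◁ k0 ≫ 𝒜.twist R =
      regComul 𝒜.A ▷ (dual R ⊗ dual R) ≫ tensorPairing (𝒜.twist R) (𝒜.twist R) := by
    apply mapPairing_injective 𝒜.F
    have := hF.2 (by
      rw [tensorPairing_mapPairing, comp_whiskerRight, Category.assoc, mapPairing_left, hk,
        tensorHom_def', whiskerLeft_comp, Category.assoc, Category.assoc,
        Functor.Monoidal.whiskerLeft_δ_μ_assoc, whisker_exchange_assoc, mapPairing_right])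
    rw [tensorPairing_mapPairing, MonoidalCategory.tensorHom_def, comp_whiskerRight,
      Category.assoc, Category.assoc, Functor.Monoidal.whiskerRight_δ_μ_assoc, ← whisker_exchange_assoc, mapPairing_left,
      whiskerLeft_comp, Category.assoc, mapPairing_right, cancel_epi] at this
    exact this
  exact ⟨k0, hk, h2⟩

/-- For the pivot `g`, pair `1` with `y = k0(ψ ⊗ φ)` through `twist`. The definition of `g` gives
`y(g) = (φ ⊗ ψ)(Δ g)`; transposing `k0` back gives `φ(g) ψ(g)`, because `Δ(1) = 1 ⊗ 1`. -/
theorem comul_pivot : comul (R := ℂ) 𝒜.pivot = 𝒜.pivot ⊗ₜ 𝒜.pivot := by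
  obtain ⟨k0, hk, h2⟩ := 𝒜.exists_comul_transpose
  refine eq_of_dualDistrib fun φ ψ => ?_
  let y := lin k0 (dualVec (regRep 𝒜.A) ψ ⊗ₜ[ℂ] dualVec (regRep 𝒜.A) φ)
  have h3 : form (𝒜.twist (regRep 𝒜.A)) (regVec 1) y =
      form (tensorPairing (𝒜.twist (regRep 𝒜.A)) (𝒜.twist (regRep 𝒜.A)))
        (regVec₂ (comul (R := ℂ) (1 : 𝒜.A)))
        (dualVec (regRep 𝒜.A) ψ ⊗ₜ[ℂ] dualVec (regRep 𝒜.A) φ) :=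
    congrArg (fun p => form p (regVec (1 : 𝒜.A))
      (dualVec (regRep 𝒜.A) ψ ⊗ₜ[ℂ] dualVec (regRep 𝒜.A) φ)) h2
  have h4 : form (evalDual (regRep 𝒜.A)) y (regVec 𝒜.pivot) =
      form (tensorPairing (evalDual (regRep 𝒜.A)) (evalDual (regRep 𝒜.A)))
        (dualVec (regRep 𝒜.A) ψ ⊗ₜ[ℂ] dualVec (regRep 𝒜.A) φ)
        (regVec₂ (comul (R := ℂ) 𝒜.pivot)) :=
    congrArg (fun p => form p (dualVec (regRep 𝒜.A) ψ ⊗ₜ[ℂ] dualVec (regRep 𝒜.A) φ)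
      (regVec 𝒜.pivot)) hk
  have h5 : form (𝒜.twist (regRep 𝒜.A)) (regVec 1) y =
      form (evalDual (regRep 𝒜.A)) y (regVec 𝒜.pivot) :=
    𝒜.apply_pivot ((dualVec (regRep 𝒜.A)).symm y)
  rw [← form_evalDual_square, ← h4, ← h5, h3, Bialgebra.comul_one]
  refine (form_tensorPairing _ _ _ _ _ _).trans ?_
  exact (congrArg₂ (· * ·) (𝒜.apply_pivot ψ) (𝒜.apply_pivot φ)).trans (mul_comm _ _)

/-- The scalar `1 ⟶ F(A) ⊗ F(A)^* ⟶ 1` is the image of the coevaluation followed by `twist`, that is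
`∑ bᵢ^*(g bᵢ)`. The realization prescribes its value. -/
theorem trace_pivot :
    LinearMap.trace ℂ 𝒜.A (LinearMap.mul ℂ 𝒜.A 𝒜.pivot) = Module.finrank ℂ 𝒜.A := by
  let R := regRep 𝒜.A
  obtain ⟨θ, h1, h2⟩ := 𝒜.isFrob_twist R
  have h3 : mapCopairing 𝒜.F (coevalDual R) ≫ 𝒜.F.obj R ◁ θ.hom = coevStar (𝒜.F.obj R) :=
    ((DualPair.ofExact (dualPairing R)).map 𝒜.F).q_comp (frobPairStar (𝒜.F.obj R)) θ.hom h2.symm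
  have h4 := dim_spec (𝒜.F.obj R)
  rw [← h3, Category.assoc, ← h1, 𝒜.dim_obj] at h4
  classical
  have h5 : coevalDual R ≫ 𝒜.twist R =
      (LinearMap.trace ℂ 𝒜.A (LinearMap.mul ℂ 𝒜.A 𝒜.pivot)) • 𝟙 (𝟙_ (HRep 𝒜.A)) := by
    refine hom_ext (LinearMap.ext_ring ?_)
    have h6 : lin (coevalDual R) (1 : ℂ) = ∑ i, Module.Basis.ofVectorSpace ℂ 𝒜.A i ⊗ₜ[ℂ]
        (Module.Basis.ofVectorSpace ℂ 𝒜.A).coord i := by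
      rw [lin_coevalDual]
      exact coevaluation_apply_one ℂ 𝒜.A
    have h7 : lin (coevalDual R ≫ 𝒜.twist R) (1 : ℂ) = ∑ i, form (𝒜.twist R)
        (regVec (Module.Basis.ofVectorSpace ℂ 𝒜.A i))
        (dualVec R ((Module.Basis.ofVectorSpace ℂ 𝒜.A).coord i)) :=
      (congrArg (lin (𝒜.twist R)) h6).trans (map_sum (lin (𝒜.twist R)) _ _)
    refine h7.trans (Eq.trans ?_ (mul_one (LinearMap.trace ℂ 𝒜.A (LinearMap.mul ℂ 𝒜.A 𝒜.pivot))).symm)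
    rw [LinearMap.trace_eq_matrix_trace ℂ (Module.Basis.ofVectorSpace ℂ 𝒜.A), Matrix.trace]
    refine Finset.sum_congr rfl fun i _ => ?_
    rw [Matrix.diag_apply, LinearMap.toMatrix_apply]
    exact 𝒜.form_twist R _ _
  have h8 : mapCopairing 𝒜.F (coevalDual R) ≫ mapPairing 𝒜.F (𝒜.twist R) =
      (LinearMap.trace ℂ 𝒜.A (LinearMap.mul ℂ 𝒜.A 𝒜.pivot)) • 𝟙 (𝟙_ T) := by
    have : 𝒜.F.map (coevalDual R) ≫ 𝒜.F.map (𝒜.twist R) =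
        (LinearMap.trace ℂ 𝒜.A (LinearMap.mul ℂ 𝒜.A 𝒜.pivot)) • 𝟙 (𝒜.F.obj (𝟙_ _)) := by
      rw [← Functor.map_comp, h5, Functor.map_smul, CategoryTheory.Functor.map_id]
    rw [mapCopairing, mapPairing, Category.assoc, Category.assoc,
      Functor.Monoidal.δ_μ_assoc, reassoc_of% this]
    simp
  exact (SemisimpleTensorCategory.end_unit _).unique h8 h4

/-- The counit axiom turns `Δ(g) = g ⊗ g` into `ε(g) g = g`, and `g ≠ 0` because its trace is `|A|`.
-/
theorem isGroupLikeElem_pivot : IsGroupLikeElem ℂ 𝒜.pivot := by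
  refine ⟨?_, 𝒜.comul_pivot⟩
  have h := rTensor_counit_comul (R := ℂ) 𝒜.pivot
  rw [𝒜.comul_pivot, LinearMap.rTensor_tmul] at h
  have h1 : counit (R := ℂ) 𝒜.pivot • 𝒜.pivot = 𝒜.pivot := by
    simpa using congrArg (TensorProduct.lid ℂ 𝒜.A) h
  have h0 : 𝒜.pivot ≠ 0 := fun h0 => by
    have := 𝒜.trace_pivot
    rw [h0, map_zero, map_zero] at this
    have h2 := 𝒜.size_pos
    rw [size, Nat.cast_pos] at h2
    exact h2.ne' (by exact_mod_cast this.symm)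
  exact smul_left_injective ℂ h0 (h1.trans (one_smul ℂ _).symm)

theorem pivot_eq_one : 𝒜.pivot = 1 :=
  isGroupLikeElem_eq_one 𝒜.isGroupLikeElem_pivot 𝒜.trace_pivot

/-- With trivial pivot the plain evaluation `A ⊗ A^* ⟶ ℂ` is `A`-linear. Applied to `a · (1 ⊗ f)`,
this reads `f(S(a₂) a₁) = ε(a) f(1)`. -/
theorem antipode_antipode (a : 𝒜.A) : antipode ℂ (antipode ℂ a) = a := by
  refine antipode_involutive_of_twist (fun a => ?_) a
  let R := regRep 𝒜.A
  have hf : ∀ (f : Module.Dual ℂ 𝒜.A) (b : 𝒜.A),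
      form (𝒜.twist R) (regVec b) (dualVec R f) = f b := fun f b => by
    refine (𝒜.form_twist R _ _).trans ?_
    rw [𝒜.pivot_eq_one, map_one]
    rfl
  refine sub_eq_zero.1 ((Module.forall_dual_apply_eq_zero_iff ℂ _).1 fun f => ?_)
  rw [map_sub, sub_eq_zero]
  have h1 : (lin (𝒜.twist R) : _ →ₗ[ℂ] ℂ) ∘ₗ LinearMap.applyₗ (regVec 1 ⊗ₜ[ℂ] dualVec R f) ∘ₗ
      (act₂ R (dual R)).toLinearMap =
        f ∘ₗ LinearMap.mul' ℂ 𝒜.A ∘ₗ TensorProduct.map (antipode ℂ) LinearMap.id ∘ₗ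
          (TensorProduct.comm ℂ 𝒜.A 𝒜.A).toLinearMap := by
    refine TensorProduct.ext' fun b c => ?_
    have h2 : act₂ R (dual R) (b ⊗ₜ[ℂ] c) (regVec 1 ⊗ₜ[ℂ] dualVec R f) =
        regVec (b * 1) ⊗ₜ[ℂ] dualVec R (f ∘ₗ LinearMap.mulLeft ℂ (antipode ℂ c)) :=
      (LinearMap.congr_fun (act₂_tmul R (dual R) b c) _)
    refine (congrArg (lin (𝒜.twist R)) h2).trans ((hf _ _).trans ?_)
    rw [mul_one]
    rfl
  refine (LinearMap.congr_fun h1 (comul (R := ℂ) a)).symm.trans ?_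
  refine (LinearMap.congr_fun (lin_comm (𝒜.twist R) a) (regVec 1 ⊗ₜ[ℂ] dualVec R f)).trans ?_
  rw [Algebra.algebraMap_eq_smul_one, map_smul]
  exact congrArg (counit (R := ℂ) a * ·) (hf f 1)

/-- On the image of `F`, the Frobenius duality is therefore the ordinary duality of vector spaces.
-/
theorem isFrob_evalFlip (V : HRep 𝒜.A) :
    IsFrob (mapPairing 𝒜.F (evalFlip 𝒜.antipode_antipode V)) (mapPairing 𝒜.F (evalDual V)) := by
  have h : 𝒜.twist V = evalFlip 𝒜.antipode_antipode V := by
    refine form_injective (LinearMap.ext fun v => LinearMap.ext fun f => ?_)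
    refine (𝒜.form_twist V v ((dualVec V).symm f)).trans ?_
    rw [𝒜.pivot_eq_one, map_one]
    rfl
  rw [← h]
  exact 𝒜.isFrob_twist V

end HopfIn
end Realized

/-! ### Trivializing systems -/

section Systems

attribute [local instance] Abelian.hasFiniteBiproducts

variable {T : Type u} [Category.{v} T] [Abelian T] [Linear ℂ T] [MonoidalCategory T]

namespace MultipleIso

variable {Y X : T} {V : Type} [AddCommGroup V] [Module ℂ V] [FiniteDimensional ℂ V]
  (M : MultipleIso Y X V)

theorem ext_hom {Z : T} {a b : Z ⟶ Y} (h : ∀ f, a ≫ M.hom f = b ≫ M.hom f) : a = b := by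
  rw [← Category.comp_id a, ← Category.comp_id b, ← M.hom_inv (Module.finBasis ℂ V),
    Preadditive.comp_sum, Preadditive.comp_sum]
  exact Finset.sum_congr rfl fun i _ => by rw [← Category.assoc, h, Category.assoc]

theorem inv_eq {M N : MultipleIso Y X V} (h : M.hom = N.hom) (v : V) : M.inv v = N.inv v :=
  M.ext_hom fun f => by rw [M.inv_hom, h, N.inv_hom]

end MultipleIso

variable [MonoidalPreadditive T] [MonoidalLinear ℂ T] [SemisimpleTensorCategory T]
  [FrobeniusDuality T]

open HRep Functor.LaxMonoidal Functor.OplaxMonoidal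

namespace HRep

variable {A : Type} [Ring A] [HopfAlgebra ℂ A]

/-- The tensor product of functionals on modules. -/
def tprod {V W : HRep A} (f : Module.Dual ℂ V) (g : Module.Dual ℂ W) :
    Module.Dual ℂ (V ⊗ W : HRep A) :=
  TensorProduct.dualDistrib ℂ V W (f ⊗ₜ g)

/-- The identity functional on the trivial module. -/
def unitDual (A : Type) [Ring A] [HopfAlgebra ℂ A] : Module.Dual ℂ (𝟙_ (HRep A) : HRep A) :=
  (LinearMap.id : ℂ →ₗ[ℂ] ℂ)

theorem dual_ext {V W : HRep A} {f g : Module.Dual ℂ (V ⊗ W : HRep A)}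
    (h : ∀ (v : V) (w : W), f (v ⊗ₜ[ℂ] w : V.carrier ⊗[ℂ] W.carrier) =
      g (v ⊗ₜ[ℂ] w : V.carrier ⊗[ℂ] W.carrier)) : f = g :=
  TensorProduct.ext' h

theorem comp_coevalDual (V : HRep A) (f : Module.Dual ℂ V) (v : V) :
    tprod f (bidual V v) ∘ₗ lin (coevalDual V) = f v • unitDual A := by
  refine LinearMap.ext_ring ?_
  let b := Module.Basis.ofVectorSpace ℂ V
  have h : lin (coevalDual V) (1 : ℂ) = ∑ i, b i ⊗ₜ[ℂ] b.coord i := by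
    rw [lin_coevalDual]
    exact coevaluation_apply_one ℂ V
  refine (congrArg (tprod f (bidual V v)) h).trans ((map_sum (tprod f (bidual V v)) _ _).trans ?_)
  refine Eq.trans ?_ (mul_one (f v)).symm
  conv_rhs => rw [← b.sum_repr v, map_sum]
  exact Finset.sum_congr rfl fun i _ => (mul_comm _ _).trans (map_smul f _ _).symm

theorem comp_coevalFlip (hS : ∀ a : A, HopfAlgebra.antipode ℂ (HopfAlgebra.antipode ℂ a) = a)
    (V : HRep A) (f : Module.Dual ℂ V) (v : V) :
    tprod (bidual V v) f ∘ₗ lin (coevalFlip hS V) = f v • unitDual A := by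
  refine LinearMap.ext_ring ?_
  let b := Module.Basis.ofVectorSpace ℂ V
  have h : lin (coevalFlip hS V) (1 : ℂ) = ∑ i, dualVec V (b.coord i) ⊗ₜ[ℂ] b i :=
    (one_smul ℂ _).trans (coevElt'_eq V)
  refine (congrArg (tprod (bidual V v) f) h).trans ((map_sum (tprod (bidual V v) f) _ _).trans ?_)
  refine Eq.trans ?_ (mul_one (f v)).symm
  conv_rhs => rw [← b.sum_repr v, map_sum]
  exact Finset.sum_congr rfl fun i _ => (map_smul f _ _).symm

theorem sum_evalDual (V : HRep A) {n : ℕ} (b : Module.Basis (Fin n) ℂ V) :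
    ∑ i, tprod (bidual V (b i)) (b.coord i) = unitDual A ∘ₗ lin (evalDual V) := by
  refine dual_ext fun (f : Module.Dual ℂ V) v => ?_
  refine (LinearMap.sum_apply _ _ _).trans
    (Eq.trans ?_ ((map_sum f _ _).symm.trans (congrArg f (b.sum_repr v))))
  exact Finset.sum_congr rfl fun i _ => (mul_comm _ _).trans (map_smul f _ _).symm

theorem sum_evalFlip (hS : ∀ a : A, HopfAlgebra.antipode ℂ (HopfAlgebra.antipode ℂ a) = a)
    (V : HRep A) {n : ℕ} (b : Module.Basis (Fin n) ℂ V) :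
    ∑ i, tprod (b.coord i) (bidual V (b i)) = unitDual A ∘ₗ lin (evalFlip hS V) := by
  refine dual_ext fun v (f : Module.Dual ℂ V) => ?_
  refine (LinearMap.sum_apply _ _ _).trans
    (Eq.trans ?_ ((map_sum f _ _).symm.trans (congrArg f (b.sum_repr v))))
  exact Finset.sum_congr rfl fun i _ => (map_smul f _ _).symm

end HRep

/-- A natural, unital and multiplicative system of morphisms `F(V) ⊗ X ⟶ X ⊗ V`. -/
structure LeftSystem (𝒜 : HopfIn T) (X : T) where
  hom : ∀ V : HRep 𝒜.A, Module.Dual ℂ V →ₗ[ℂ] (𝒜.F.obj V ⊗ X ⟶ X)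
  natural : ∀ {V V' : HRep 𝒜.A} (h : V ⟶ V') (f : Module.Dual ℂ V'),
    𝒜.F.map h ▷ X ≫ hom V' f = hom V (f ∘ₗ HRep.lin h)
  unit : ε 𝒜.F ▷ X ≫ hom (𝟙_ (HRep 𝒜.A)) (unitDual 𝒜.A) = (λ_ X).hom
  mul : ∀ (V V' : HRep 𝒜.A) (f : Module.Dual ℂ V) (f' : Module.Dual ℂ V'),
    μ 𝒜.F V V' ▷ X ≫ hom (V ⊗ V') (tprod f f') =
      (α_ (𝒜.F.obj V) (𝒜.F.obj V') X).hom ≫ 𝒜.F.obj V ◁ hom V' f' ≫ hom V f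

/-- A natural, unital and multiplicative system of morphisms `X ⊗ G(W) ⟶ W ⊗ X`. -/
structure RightSystem (ℬ : HopfIn T) (X : T) where
  hom : ∀ W : HRep ℬ.A, Module.Dual ℂ W →ₗ[ℂ] (X ⊗ ℬ.F.obj W ⟶ X)
  natural : ∀ {W W' : HRep ℬ.A} (h : W ⟶ W') (f : Module.Dual ℂ W'),
    X ◁ ℬ.F.map h ≫ hom W' f = hom W (f ∘ₗ HRep.lin h)
  unit : X ◁ ε ℬ.F ≫ hom (𝟙_ (HRep ℬ.A)) (unitDual ℬ.A) = (ρ_ X).hom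
  mul : ∀ (W W' : HRep ℬ.A) (f : Module.Dual ℂ W) (f' : Module.Dual ℂ W'),
    X ◁ μ ℬ.F W W' ≫ hom (W ⊗ W') (tprod f f') =
      (α_ X (ℬ.F.obj W) (ℬ.F.obj W')).inv ≫ hom W f ▷ ℬ.F.obj W' ≫ hom W' f'

namespace LeftSystem

variable {𝒜 : HopfIn T} {X : T} (S : LeftSystem 𝒜 X)

/-- The inverse of the trivialization. -/
def inv (V : HRep 𝒜.A) : V.carrier →ₗ[ℂ] (X ⟶ 𝒜.F.obj V ⊗ X) where
  toFun v := (λ_ X).inv ≫ mapCopairing 𝒜.F (coevalDual V) ▷ X ≫ (α_ _ _ _).hom ≫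
    𝒜.F.obj V ◁ S.hom (dual V) (bidual V v)
  map_add' v w := by simp
  map_smul' c v := by simp

theorem inv_apply (V : HRep 𝒜.A) (v : V) :
    S.inv V v = (λ_ X).inv ≫ mapCopairing 𝒜.F (coevalDual V) ▷ X ≫ (α_ _ _ _).hom ≫
      𝒜.F.obj V ◁ S.hom (dual V) (bidual V v) := rfl

/-- Multiplicativity merges the two actions into that of `V ⊗ V^*`; naturality along the
coevaluation and unitality leave the scalar `f(v)`. -/
theorem inv_hom (V : HRep 𝒜.A) (v : V) (f : Module.Dual ℂ V) :
    S.inv V v ≫ S.hom V f = f v • 𝟙 X := by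
  have h : mapCopairing 𝒜.F (coevalDual V) ≫ μ 𝒜.F V (dual V) =
      ε 𝒜.F ≫ 𝒜.F.map (coevalDual V) := by simp [mapCopairing]
  rw [inv_apply, Category.assoc, Category.assoc, Category.assoc, ← S.mul,
    ← comp_whiskerRight_assoc, h, comp_whiskerRight_assoc, S.natural]
  have h2 := congrArg (S.hom (𝟙_ (HRep 𝒜.A))) (comp_coevalDual V f v)
  rw [map_smul] at h2
  refine (congrArg (fun x => (λ_ X).inv ≫ ε 𝒜.F ▷ X ≫ x) h2).trans ?_
  rw [Linear.comp_smul, S.unit, Linear.comp_smul, Iso.inv_hom_id]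

/-- Summed over a basis, the actions of `V` and `V^*` become the action of `V^* ⊗ V` through its
evaluation, hence the pairing of `F(V^*)` with `F(V)`. A zigzag remains. -/
theorem hom_inv (V : HRep 𝒜.A) {n : ℕ} (b : Module.Basis (Fin n) ℂ V) :
    ∑ i, S.hom V (b.coord i) ≫ S.inv V (b i) = 𝟙 (𝒜.F.obj V ⊗ X) := by
  let D : DualPair (𝒜.F.obj (dual V)) (𝒜.F.obj V) := (DualPair.ofExact (dualPairing V)).map 𝒜.F
  have h1 : ∑ i, 𝒜.F.obj (dual V) ◁ S.hom V (b.coord i) ≫ S.hom (dual V) (bidual V (b i)) =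
      (α_ _ _ _).inv ≫ D.p ▷ X ≫ (λ_ X).hom := by
    have h2 : ∀ i, 𝒜.F.obj (dual V) ◁ S.hom V (b.coord i) ≫ S.hom (dual V) (bidual V (b i)) =
        (α_ _ _ _).inv ≫ μ 𝒜.F (dual V) V ▷ X ≫ S.hom (dual V ⊗ V)
          (tprod (bidual V (b i)) (b.coord i)) := fun i => by
      rw [S.mul, Iso.inv_hom_id_assoc]
    have h4 : η 𝒜.F ▷ X ≫ (λ_ X).hom = S.hom (𝟙_ (HRep 𝒜.A)) (unitDual 𝒜.A) := by
      rw [← S.unit, Functor.Monoidal.whiskerRight_η_ε_assoc]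
    have h5 : D.p ▷ X ≫ (λ_ X).hom = μ 𝒜.F (dual V) V ▷ X ≫ 𝒜.F.map (evalDual V) ▷ X ≫
        S.hom (𝟙_ (HRep 𝒜.A)) (unitDual 𝒜.A) := by
      rw [← h4, ← comp_whiskerRight_assoc, ← comp_whiskerRight_assoc]
      simp only [Category.assoc]
      rfl
    rw [h5, S.natural, Finset.sum_congr rfl fun i _ => h2 i, ← Preadditive.comp_sum,
      ← Preadditive.comp_sum, ← map_sum, sum_evalDual]
  have h6 : ∀ i, S.hom V (b.coord i) ≫ S.inv V (b i) = (λ_ _).inv ≫ D.q ▷ _ ≫ (α_ _ _ _).hom ≫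
      𝒜.F.obj V ◁ (𝒜.F.obj (dual V) ◁ S.hom V (b.coord i) ≫ S.hom (dual V) (bidual V (b i))) :=
    fun i => by
      rw [inv_apply]
      change _ ≫ _ ≫ D.q ▷ X ≫ _ = _
      calc _ = 𝟙 _ ⊗≫ (𝟙_ T ◁ S.hom V (b.coord i) ≫ D.q ▷ X) ⊗≫
            𝒜.F.obj V ◁ S.hom (dual V) (bidual V (b i)) := by monoidal
        _ = _ := by rw [whisker_exchange]; monoidal
  rw [Finset.sum_congr rfl fun i _ => h6 i, ← Preadditive.comp_sum, ← Preadditive.comp_sum,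
    ← Preadditive.comp_sum, ← whiskerLeft_sum, h1]
  calc _ = 𝟙 _ ⊗≫ (D.q ▷ 𝒜.F.obj V ⊗≫ 𝒜.F.obj V ◁ D.p) ▷ X ⊗≫ 𝟙 _ := by monoidal
    _ = _ := by rw [D.zag]; monoidal

/-- The trivializing isomorphism. -/
def iso (V : HRep 𝒜.A) : MultipleIso (𝒜.F.obj V ⊗ X) X V where
  hom := S.hom V
  inv := S.inv V
  inv_hom := S.inv_hom V
  hom_inv := S.hom_inv V

end LeftSystem

namespace RightSystem

variable {ℬ : HopfIn T} {X : T} (S : RightSystem ℬ X)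

/-- The inverse of the trivialization. -/
def inv (W : HRep ℬ.A) : W.carrier →ₗ[ℂ] (X ⟶ X ⊗ ℬ.F.obj W) where
  toFun w := (ρ_ X).inv ≫ X ◁ mapCopairing ℬ.F (coevalFlip ℬ.antipode_antipode W) ≫
    (α_ _ _ _).inv ≫ S.hom (dual W) (bidual W w) ▷ ℬ.F.obj W
  map_add' v w := by simp
  map_smul' c v := by simp

theorem inv_apply (W : HRep ℬ.A) (w : W) :
    S.inv W w = (ρ_ X).inv ≫ X ◁ mapCopairing ℬ.F (coevalFlip ℬ.antipode_antipode W) ≫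
      (α_ _ _ _).inv ≫ S.hom (dual W) (bidual W w) ▷ ℬ.F.obj W := rfl

/-- As on the left, but the coevaluation needed is `ℂ ⟶ W^* ⊗ W`, which is a module map because the
antipode is an involution. -/
theorem inv_hom (W : HRep ℬ.A) (w : W) (f : Module.Dual ℂ W) :
    S.inv W w ≫ S.hom W f = f w • 𝟙 X := by
  have h : mapCopairing ℬ.F (coevalFlip ℬ.antipode_antipode W) ≫ μ ℬ.F (dual W) W =
      ε ℬ.F ≫ ℬ.F.map (coevalFlip ℬ.antipode_antipode W) := by simp [mapCopairing]
  rw [inv_apply, Category.assoc, Category.assoc, Category.assoc, ← S.mul,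
    ← whiskerLeft_comp_assoc, h, whiskerLeft_comp_assoc, S.natural, comp_coevalFlip, map_smul]
  rw [Linear.comp_smul, S.unit, Linear.comp_smul, Iso.inv_hom_id]

theorem hom_inv (W : HRep ℬ.A) {n : ℕ} (b : Module.Basis (Fin n) ℂ W) :
    ∑ i, S.hom W (b.coord i) ≫ S.inv W (b i) = 𝟙 (X ⊗ ℬ.F.obj W) := by
  let D : DualPair (ℬ.F.obj W) (ℬ.F.obj (dual W)) :=
    (DualPair.ofExact (flipPairing ℬ.antipode_antipode W)).map ℬ.F
  have h1 : ∑ i, S.hom W (b.coord i) ▷ ℬ.F.obj (dual W) ≫ S.hom (dual W) (bidual W (b i)) =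
      (α_ _ _ _).hom ≫ X ◁ D.p ≫ (ρ_ X).hom := by
    have h2 : ∀ i, S.hom W (b.coord i) ▷ ℬ.F.obj (dual W) ≫ S.hom (dual W) (bidual W (b i)) =
        (α_ _ _ _).hom ≫ X ◁ μ ℬ.F W (dual W) ≫ S.hom (W ⊗ dual W)
          (tprod (b.coord i) (bidual W (b i))) := fun i => by
      rw [S.mul, Iso.hom_inv_id_assoc]
    have h4 : X ◁ η ℬ.F ≫ (ρ_ X).hom = S.hom (𝟙_ (HRep ℬ.A)) (unitDual ℬ.A) := by
      rw [← S.unit, Functor.Monoidal.whiskerLeft_η_ε_assoc]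
    have h5 : X ◁ D.p ≫ (ρ_ X).hom = X ◁ μ ℬ.F W (dual W) ≫
        X ◁ ℬ.F.map (evalFlip ℬ.antipode_antipode W) ≫
        S.hom (𝟙_ (HRep ℬ.A)) (unitDual ℬ.A) := by
      rw [← h4, ← whiskerLeft_comp_assoc, ← whiskerLeft_comp_assoc]
      simp only [Category.assoc]
      rfl
    rw [h5, S.natural, Finset.sum_congr rfl fun i _ => h2 i, ← Preadditive.comp_sum,
      ← Preadditive.comp_sum, ← map_sum, sum_evalFlip]
  have h6 : ∀ i, S.hom W (b.coord i) ≫ S.inv W (b i) = (ρ_ _).inv ≫ _ ◁ D.q ≫ (α_ _ _ _).inv ≫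
      (S.hom W (b.coord i) ▷ ℬ.F.obj (dual W) ≫ S.hom (dual W) (bidual W (b i))) ▷ ℬ.F.obj W :=
    fun i => by
      rw [inv_apply]
      change _ ≫ _ ≫ X ◁ D.q ≫ _ = _
      calc _ = 𝟙 _ ⊗≫ (S.hom W (b.coord i) ▷ 𝟙_ T ≫ X ◁ D.q) ⊗≫
            S.hom (dual W) (bidual W (b i)) ▷ ℬ.F.obj W := by monoidal
        _ = _ := by rw [← whisker_exchange]; monoidal
  rw [Finset.sum_congr rfl fun i _ => h6 i, ← Preadditive.comp_sum, ← Preadditive.comp_sum,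
    ← Preadditive.comp_sum, ← sum_whiskerRight, h1]
  calc _ = 𝟙 _ ⊗≫ X ◁ (ℬ.F.obj W ◁ D.q ⊗≫ D.p ▷ ℬ.F.obj W) ⊗≫ 𝟙 _ := by monoidal
    _ = _ := by rw [D.zig]; monoidal

/-- The trivializing isomorphism. -/
def iso (W : HRep ℬ.A) : MultipleIso (X ⊗ ℬ.F.obj W) X W where
  hom := S.hom W
  inv := S.inv W
  inv_hom := S.inv_hom W
  hom_inv := S.hom_inv W

end RightSystem

namespace ModuleStr

variable {𝒜 ℬ : HopfIn T} {X : T} (ℳ : ModuleStr 𝒜 ℬ X)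

/-- The left trivializations of a module. -/
def leftSystem : LeftSystem 𝒜 X where
  hom V := (ℳ.left V).hom
  natural := ℳ.left_natural
  unit := ℳ.left_unit
  mul := ℳ.left_mul

/-- The right trivializations of a module. -/
def rightSystem : RightSystem ℬ X where
  hom V := (ℳ.right V).hom
  natural := ℳ.right_natural
  unit := ℳ.right_unit
  mul := ℳ.right_mul

/-- The inverse of a trivialization is unique, so the given one can be replaced by the action of the
dual module, bent by duality. -/
theorem left_inv_eq (V : HRep 𝒜.A) (v : V) : (ℳ.left V).inv v = ℳ.leftSystem.inv V v :=
  MultipleIso.inv_eq (M := ℳ.left V) (N := ℳ.leftSystem.iso V) rfl v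

theorem right_inv_eq (W : HRep ℬ.A) (w : W) : (ℳ.right W).inv w = ℳ.rightSystem.inv W w :=
  MultipleIso.inv_eq (M := ℳ.right W) (N := ℳ.rightSystem.iso W) rfl w

theorem left_inv_natural {V W : HRep 𝒜.A} (h : V ⟶ W) (v : V) :
    (ℳ.left V).inv v ≫ 𝒜.F.map h ▷ X = (ℳ.left W).inv (lin h v) :=
  (ℳ.left W).ext_hom fun f => by
    rw [Category.assoc, ℳ.left_natural, MultipleIso.inv_hom, MultipleIso.inv_hom]
    rfl

end ModuleStr

end Systems

/-! ### Transposes of actions -/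

section Transpose

variable {T : Type u} [Category.{v} T] [MonoidalCategory T]

theorem DualPair.whiskerLeft_lm_tensorPairing {X Z Y Y' : T} (P : DualPair Y Y') (p : X ⊗ Z ⟶ 𝟙_ T)
    (k : Y ⊗ Z ⟶ Z) :
    (X ⊗ Y) ◁ P.lm k ≫ tensorPairing p P.p = (α_ X Y Z).hom ≫ X ◁ k ≫ p := by
  calc _ = 𝟙 _ ⊗≫ X ◁ (P.le (P.lm k)) ⊗≫ p := by
        simp only [tensorPairing, le]; monoidal
    _ = _ := by rw [P.le_lm]; monoidal

/-- Bending `Y'` down by `re` turns the second equation into one between morphisms out of `(Z ⊗ X) ⊗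
Y`, which is the first equation up to an associator. -/
theorem DualPair.whiskerRight_tensorPairing_iff {X Z Y Y' : T} (P : DualPair Y' Y)
    (p : Z ⊗ X ⟶ 𝟙_ T) (f : X ⊗ Y ⟶ X) (k : Z ⟶ Y' ⊗ Z) :
    k ▷ (X ⊗ Y) ≫ tensorPairing P.p p = Z ◁ f ≫ p ↔
      k ▷ X ≫ (α_ Y' Z X).hom ≫ Y' ◁ p ≫ (ρ_ Y').hom =
        Z ◁ P.rm f ≫ (α_ Z X Y').inv ≫ p ▷ Y' ≫ (λ_ Y').hom := by
  have h1 : P.re ((k ▷ X ≫ (α_ Y' Z X).hom ≫ Y' ◁ p ≫ (ρ_ Y').hom) ≫ (λ_ Y').inv) =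
      (α_ _ _ _).hom ≫ k ▷ (X ⊗ Y) ≫ tensorPairing P.p p := by
    simp only [re, tensorPairing]; monoidal
  have h2 : P.re ((Z ◁ P.rm f ≫ (α_ Z X Y').inv ≫ p ▷ Y' ≫ (λ_ Y').hom) ≫ (λ_ Y').inv) =
      (α_ _ _ _).hom ≫ Z ◁ f ≫ p := by
    calc _ = 𝟙 _ ⊗≫ Z ◁ P.rm f ▷ Y ⊗≫ (p ▷ (Y' ⊗ Y) ≫ 𝟙_ T ◁ P.p) ⊗≫ 𝟙 _ := by
          simp only [re]; monoidal
      _ = 𝟙 _ ⊗≫ Z ◁ (P.re (P.rm f)) ⊗≫ p := by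
          rw [← whisker_exchange]; simp only [re]; monoidal
      _ = _ := by rw [P.re_rm]; monoidal
  constructor
  · intro h
    exact (cancel_mono _).1
      (P.re_injective (h1.trans ((congrArg (fun x => (α_ _ _ _).hom ≫ x) h).trans h2.symm)))
  · intro h
    rw [h, h2, cancel_epi] at h1
    exact h1.symm

end Transpose

section Transposition

attribute [local instance] Abelian.hasFiniteBiproducts

variable {T : Type u} [Category.{v} T] [Abelian T] [Linear ℂ T] [MonoidalCategory T]
  [FrobeniusDuality T]

/-- The balance condition says that `P.lm k : Z ⟶ Y' ⊗ Z` and `f` are transposes for the pairing of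
`X ⊗ Y` with `Y' ⊗ Z`. By multiplicativity and naturality of the duality they are then transposes
for the reversed pairings too. -/
theorem IsFrob.balanced_iff {X Z Y Y' : T} {p : X ⊗ Z ⟶ 𝟙_ T} {p' : Z ⊗ X ⟶ 𝟙_ T}
    (hX : IsFrob p p') (P : DualPair Y Y') (P' : DualPair Y' Y) (hY : IsFrob P.p P'.p)
    (f : X ⊗ Y ⟶ X) (k : Y ⊗ Z ⟶ Z) :
    f ▷ Z ≫ p = (α_ X Y Z).hom ≫ X ◁ k ≫ p ↔
      P.lm k ▷ X ≫ (α_ Y' Z X).hom ≫ Y' ◁ p' ≫ (ρ_ Y').hom =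
        Z ◁ P'.rm f ≫ (α_ Z X Y').inv ≫ p' ▷ Y' ≫ (λ_ Y').hom := by
  rw [← P.whiskerLeft_lm_tensorPairing, ← P'.whiskerRight_tensorPairing_iff,
    ← (hX.tensor hY).natural hX, eq_comm]

theorem IsFrob.balanced_iff' {X Z Y Y' : T} {p : X ⊗ Z ⟶ 𝟙_ T} {p' : Z ⊗ X ⟶ 𝟙_ T}
    (hX : IsFrob p p') (P : DualPair Y Y') (P' : DualPair Y' Y) (hY : IsFrob P'.p P.p)
    (f : Y ⊗ X ⟶ X) (k : Z ⊗ Y ⟶ Z) :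
    k ▷ X ≫ p' = (α_ Z Y X).hom ≫ Z ◁ f ≫ p' ↔
      P.lm f ▷ Z ≫ (α_ Y' X Z).hom ≫ Y' ◁ p ≫ (ρ_ Y').hom =
        X ◁ P'.rm k ≫ (α_ X Z Y').inv ≫ p ▷ Y' ≫ (λ_ Y').hom := by
  rw [← P.whiskerLeft_lm_tensorPairing, ← P'.whiskerRight_tensorPairing_iff,
    ← hX.natural (hY.tensor hX), eq_comm]

end Transposition

/-! ### Balanced and invariant pairings -/

section Modules

attribute [local instance] Abelian.hasFiniteBiproducts

variable {T : Type u} [Category.{v} T] [Abelian T] [Linear ℂ T] [MonoidalCategory T]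
  [MonoidalPreadditive T] [MonoidalLinear ℂ T] [SemisimpleTensorCategory T] [FrobeniusDuality T]

open HRep

namespace HRep

variable {A : Type} [Ring A] [HopfAlgebra ℂ A]
  (hS : ∀ a : A, HopfAlgebra.antipode ℂ (HopfAlgebra.antipode ℂ a) = a)

/-- A module as its bidual, if the antipode is an involution. -/
def bidualIso (V : HRep A) : V ≅ dual (dual V) :=
  mkIso (V := V) (W := dual (dual V)) (Module.evalEquiv ℂ V) fun a => by
    refine LinearMap.ext fun v => LinearMap.ext fun (f : Module.Dual ℂ V) => ?_
    change f (V.ρ a v) = f (V.ρ (HopfAlgebra.antipode ℂ (HopfAlgebra.antipode ℂ a)) v)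
    rw [hS]

theorem bidual_comp_bidualIso (V : HRep A) (f : Module.Dual ℂ V) :
    bidual (dual V) (dualVec V f) ∘ₗ lin (bidualIso hS V).hom = f := rfl

theorem evalDual_eq (V : HRep A) :
    dual V ◁ (bidualIso hS V).hom ≫ evalFlip hS (dual V) = evalDual V := form_injective rfl

theorem evalFlip_eq (V : HRep A) :
    (bidualIso hS V).hom ▷ dual V ≫ evalDual (dual V) = evalFlip hS V := form_injective rfl

end HRep

namespace HopfIn

variable (𝒜 : HopfIn T)

/-- This is `isFrob_evalFlip` for `V^*`, read through `V ≅ V^{**}`, which exchanges the two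
evaluations. -/
theorem isFrob_evalDual (V : HRep 𝒜.A) :
    IsFrob (mapPairing 𝒜.F (evalDual V)) (mapPairing 𝒜.F (evalFlip 𝒜.antipode_antipode V)) := by
  obtain ⟨θ, h1, h2⟩ := 𝒜.isFrob_evalFlip (dual V)
  refine ⟨𝒜.F.mapIso (bidualIso 𝒜.antipode_antipode V) ≪≫ θ, ?_, ?_⟩
  · rw [← evalDual_eq 𝒜.antipode_antipode, ← mapPairing_right, h1]
    simp
  · rw [← evalFlip_eq 𝒜.antipode_antipode, ← mapPairing_left, h2]
    simp

/-- The image of the duality of modules. -/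
def pairDual (V : HRep 𝒜.A) : DualPair (𝒜.F.obj (dual V)) (𝒜.F.obj V) :=
  (DualPair.ofExact (dualPairing V)).map 𝒜.F

/-- The image of the flipped duality of modules. -/
def pairFlip (V : HRep 𝒜.A) : DualPair (𝒜.F.obj V) (𝒜.F.obj (dual V)) :=
  (DualPair.ofExact (flipPairing 𝒜.antipode_antipode V)).map 𝒜.F

theorem isFrob_pairDual (V : HRep 𝒜.A) : IsFrob (𝒜.pairDual V).p (𝒜.pairFlip V).p :=
  𝒜.isFrob_evalDual V

theorem isFrob_pairFlip (V : HRep 𝒜.A) : IsFrob (𝒜.pairFlip V).p (𝒜.pairDual V).p :=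
  𝒜.isFrob_evalFlip V

end HopfIn

theorem LeftSystem.inv_eq_lm {𝒜 : HopfIn T} {X : T} (S : LeftSystem 𝒜 X) (V : HRep 𝒜.A) (v : V) :
    S.inv V v = (𝒜.pairDual V).lm (S.hom (dual V) (bidual V v)) := by
  rw [S.inv_apply]
  simp only [DualPair.lm, monoidalComp]
  simp
  rfl

theorem RightSystem.inv_eq_rm {ℬ : HopfIn T} {X : T} (S : RightSystem ℬ X) (W : HRep ℬ.A) (w : W) :
    S.inv W w = (ℬ.pairFlip W).rm (S.hom (dual W) (bidual W w)) := by
  rw [S.inv_apply]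
  simp only [DualPair.rm, monoidalComp]
  simp
  rfl

/-- A pairing is balanced for a right action on `X` and a left action on `Z`. -/
def Balanced {ℬ : HopfIn T} {X Z : T} (R : RightSystem ℬ X) (L : LeftSystem ℬ Z)
    (p : X ⊗ Z ⟶ 𝟙_ T) : Prop :=
  ∀ (W : HRep ℬ.A) (g : Module.Dual ℂ W),
    R.hom W g ▷ Z ≫ p = (α_ X (ℬ.F.obj W) Z).hom ≫ X ◁ L.hom W g ≫ p

/-- A pairing is invariant for a left action on `X` and a right action on `Z`. -/
def Invariant {𝒜 : HopfIn T} {X Z : T} (L : LeftSystem 𝒜 X) (R : RightSystem 𝒜 Z)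
    (p : X ⊗ Z ⟶ 𝟙_ T) : Prop :=
  ∀ (V : HRep 𝒜.A) (v : V),
    L.inv V v ▷ Z ≫ (α_ (𝒜.F.obj V) X Z).hom ≫ 𝒜.F.obj V ◁ p ≫ (ρ_ (𝒜.F.obj V)).hom =
      X ◁ R.inv V v ≫ (α_ X Z (𝒜.F.obj V)).inv ≫ p ▷ 𝒜.F.obj V ≫ (λ_ (𝒜.F.obj V)).hom

/-- Through `W ≅ W^{**}` a functional on `W` is evaluation at a vector of `W^*`, so it suffices to
consider dual modules. -/
theorem balanced_of_dual {ℬ : HopfIn T} {X Z : T} {R : RightSystem ℬ X} {L : LeftSystem ℬ Z}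
    {p : X ⊗ Z ⟶ 𝟙_ T} (h : ∀ (W : HRep ℬ.A) (w : W),
      R.hom (dual W) (bidual W w) ▷ Z ≫ p =
        (α_ X (ℬ.F.obj (dual W)) Z).hom ≫ X ◁ L.hom (dual W) (bidual W w) ≫ p) :
    Balanced R L p := fun W g => by
  rw [← bidual_comp_bidualIso ℬ.antipode_antipode W g, ← R.natural, ← L.natural,
    comp_whiskerRight, Category.assoc, h, whiskerLeft_comp]
  simp

/-- An inverse trivialization is the action of the dual module bent by a Frobenius duality, so
`IsFrob.balanced_iff` applies. A condition on `p` is thus traded for one on `p'`. -/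
theorem IsFrob.balanced_iff_invariant {ℬ : HopfIn T} {X Z : T} {p : X ⊗ Z ⟶ 𝟙_ T}
    {p' : Z ⊗ X ⟶ 𝟙_ T} (hX : IsFrob p p') (R : RightSystem ℬ X) (L : LeftSystem ℬ Z) :
    Balanced R L p ↔ Invariant L R p' := by
  constructor
  · intro h W w
    rw [L.inv_eq_lm, R.inv_eq_rm]
    exact (hX.balanced_iff _ _ (ℬ.isFrob_pairDual W) _ _).1 (h _ _)
  · intro h
    refine balanced_of_dual fun W w => ?_
    rw [hX.balanced_iff _ _ (ℬ.isFrob_pairDual W), ← L.inv_eq_lm, ← R.inv_eq_rm]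
    exact h W w

theorem IsFrob.balanced_iff_invariant' {𝒜 : HopfIn T} {X Z : T} {p : X ⊗ Z ⟶ 𝟙_ T}
    {p' : Z ⊗ X ⟶ 𝟙_ T} (hX : IsFrob p p') (L : LeftSystem 𝒜 X) (R : RightSystem 𝒜 Z) :
    Balanced R L p' ↔ Invariant L R p := by
  constructor
  · intro h W w
    rw [L.inv_eq_lm, R.inv_eq_rm]
    exact (hX.balanced_iff' _ _ (𝒜.isFrob_pairFlip W) _ _).1 (h _ _)
  · intro h
    refine balanced_of_dual fun W w => ?_
    rw [hX.balanced_iff' _ _ (𝒜.isFrob_pairFlip W), ← L.inv_eq_lm, ← R.inv_eq_rm]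
    exact h W w

end Modules

/-! ### The dual module -/

section DualModule

attribute [local instance] Abelian.hasFiniteBiproducts

variable {T : Type u} [Category.{v} T] [Abelian T] [Linear ℂ T] [MonoidalCategory T]
  [MonoidalPreadditive T] [MonoidalLinear ℂ T] [SemisimpleTensorCategory T] [FrobeniusDuality T]

open HRep Functor.LaxMonoidal

theorem DualPair.mateL_add {U L W : T} (P : DualPair U L) (f g : U ⊗ W ⟶ 𝟙_ T) :
    P.mateL (f + g) = P.mateL f + P.mateL g := by
  simp [mateL, lm, monoidalComp, MonoidalPreadditive.whiskerLeft_add]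

theorem DualPair.mateL_smul {U L W : T} (P : DualPair U L) (c : ℂ) (f : U ⊗ W ⟶ 𝟙_ T) :
    P.mateL (c • f) = c • P.mateL f := by
  simp [mateL, lm, monoidalComp]

theorem DualPair.mateR_add {U L W : T} (P : DualPair U L) (f g : W ⊗ L ⟶ 𝟙_ T) :
    P.mateR (f + g) = P.mateR f + P.mateR g := by
  simp [mateR, rm, monoidalComp, MonoidalPreadditive.add_whiskerRight]

theorem DualPair.mateR_smul {U L W : T} (P : DualPair U L) (c : ℂ) (f : W ⊗ L ⟶ 𝟙_ T) :
    P.mateR (c • f) = c • P.mateR f := by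
  simp [mateR, rm, monoidalComp]

/-- The transpose of a right action. -/
def RightSystem.transpose {ℬ : HopfIn T} {X Z : T} (R : RightSystem ℬ X) (P : DualPair X Z) :
    LeftSystem ℬ Z where
  hom W :=
    { toFun := fun g => P.mateL ((α_ X (ℬ.F.obj W) Z).inv ≫ R.hom W g ▷ Z ≫ P.p)
      map_add' := fun f g => by
        rw [map_add, MonoidalPreadditive.add_whiskerRight, Preadditive.add_comp,
          Preadditive.comp_add, P.mateL_add]
      map_smul' := fun c f => by
        rw [map_smul, MonoidalLinear.smul_whiskerRight, Linear.smul_comp, Linear.comp_smul,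
          P.mateL_smul]
        rfl }
  natural {W W'} h f := P.cancel_left (by
    simp only [LinearMap.coe_mk, AddHom.coe_mk]
    rw [whiskerLeft_comp, Category.assoc, P.mateL_p, P.mateL_p, ← R.natural]
    monoidal)
  unit := P.cancel_left (by
    simp only [LinearMap.coe_mk, AddHom.coe_mk]
    rw [whiskerLeft_comp, Category.assoc, P.mateL_p]
    calc _ = (α_ _ _ _).inv ≫ (X ◁ ε ℬ.F ≫ R.hom _ (unitDual ℬ.A)) ▷ Z ≫ P.p := by monoidal
      _ = _ := by rw [R.unit]; monoidal)
  mul W W' f f' := P.cancel_left (by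
    simp only [LinearMap.coe_mk, AddHom.coe_mk]
    rw [whiskerLeft_comp, Category.assoc, P.mateL_p]
    calc _ = (α_ _ _ _).inv ≫ (X ◁ μ ℬ.F W W' ≫ R.hom _ (tprod f f')) ▷ Z ≫ P.p := by monoidal
      _ = 𝟙 _ ⊗≫ R.hom W f ▷ ℬ.F.obj W' ▷ Z ⊗≫
          (X ◁ P.mateL ((α_ X (ℬ.F.obj W') Z).inv ≫ R.hom W' f' ▷ Z ≫ P.p) ≫ P.p) := by
        rw [R.mul, P.mateL_p]; monoidal
      _ = 𝟙 _ ⊗≫ (R.hom W f ▷ (ℬ.F.obj W' ⊗ Z) ≫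
          X ◁ P.mateL ((α_ X (ℬ.F.obj W') Z).inv ≫ R.hom W' f' ▷ Z ≫ P.p)) ⊗≫ P.p := by monoidal
      _ = 𝟙 _ ⊗≫ X ◁ ℬ.F.obj W ◁ P.mateL ((α_ X (ℬ.F.obj W') Z).inv ≫ R.hom W' f' ▷ Z ≫ P.p) ⊗≫
          (X ◁ P.mateL ((α_ X (ℬ.F.obj W) Z).inv ≫ R.hom W f ▷ Z ≫ P.p) ≫ P.p) := by
        rw [← whisker_exchange, P.mateL_p]; monoidal
      _ = _ := by monoidal)

theorem RightSystem.balanced_transpose {ℬ : HopfIn T} {X Z : T} (R : RightSystem ℬ X)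
    (P : DualPair X Z) : Balanced R (R.transpose P) P.p := fun W g => by
  change _ = _ ≫ X ◁ P.mateL _ ≫ P.p
  rw [P.mateL_p, Iso.hom_inv_id_assoc]

/-- The transpose of a left action. -/
def LeftSystem.transpose {𝒜 : HopfIn T} {X Z : T} (L : LeftSystem 𝒜 X) (P : DualPair Z X) :
    RightSystem 𝒜 Z where
  hom V :=
    { toFun := fun f => P.mateR ((α_ Z (𝒜.F.obj V) X).hom ≫ Z ◁ L.hom V f ≫ P.p)
      map_add' := fun f g => by
        rw [map_add, MonoidalPreadditive.whiskerLeft_add, Preadditive.add_comp,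
          Preadditive.comp_add, P.mateR_add]
      map_smul' := fun c f => by
        rw [map_smul, MonoidalLinear.whiskerLeft_smul, Linear.smul_comp, Linear.comp_smul,
          P.mateR_smul]
        rfl }
  natural {W W'} h f := P.cancel_right (by
    simp only [LinearMap.coe_mk, AddHom.coe_mk]
    rw [comp_whiskerRight, Category.assoc, P.mateR_p, P.mateR_p, ← L.natural]
    monoidal)
  unit := P.cancel_right (by
    simp only [LinearMap.coe_mk, AddHom.coe_mk]
    rw [comp_whiskerRight, Category.assoc, P.mateR_p]
    calc _ = (α_ _ _ _).hom ≫ Z ◁ (ε 𝒜.F ▷ X ≫ L.hom _ (unitDual 𝒜.A)) ≫ P.p := by monoidal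
      _ = _ := by rw [L.unit]; monoidal)
  mul V V' f f' := P.cancel_right (by
    simp only [LinearMap.coe_mk, AddHom.coe_mk]
    rw [comp_whiskerRight, Category.assoc, P.mateR_p]
    calc _ = (α_ _ _ _).hom ≫ Z ◁ (μ 𝒜.F V V' ▷ X ≫ L.hom _ (tprod f f')) ≫ P.p := by monoidal
      _ = 𝟙 _ ⊗≫ Z ◁ 𝒜.F.obj V ◁ L.hom V' f' ⊗≫
          (P.mateR ((α_ Z (𝒜.F.obj V) X).hom ≫ Z ◁ L.hom V f ≫ P.p) ▷ X ≫ P.p) := by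
        rw [L.mul, P.mateR_p]; monoidal
      _ = 𝟙 _ ⊗≫ ((Z ⊗ 𝒜.F.obj V) ◁ L.hom V' f' ≫
          P.mateR ((α_ Z (𝒜.F.obj V) X).hom ≫ Z ◁ L.hom V f ≫ P.p) ▷ X) ⊗≫ P.p := by monoidal
      _ = 𝟙 _ ⊗≫ P.mateR ((α_ Z (𝒜.F.obj V) X).hom ≫ Z ◁ L.hom V f ≫ P.p) ▷ 𝒜.F.obj V' ▷ X ⊗≫
          (P.mateR ((α_ Z (𝒜.F.obj V') X).hom ≫ Z ◁ L.hom V' f' ≫ P.p) ▷ X ≫ P.p) := by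
        rw [whisker_exchange, P.mateR_p]; monoidal
      _ = _ := by monoidal)

theorem LeftSystem.balanced_transpose {𝒜 : HopfIn T} {X Z : T} (L : LeftSystem 𝒜 X)
    (P : DualPair Z X) : Balanced (L.transpose P) L P.p := fun _ _ => P.mateR_p _

/-- The `A`-`B` module `X` and the `B`-`A` module `Z` are dual with respect to the rigidity pairs
`P` and `P'`. -/
structure DualModules {𝒜 ℬ : HopfIn T} {X Z : T} (ℳ : ModuleStr 𝒜 ℬ X) (𝒩 : ModuleStr ℬ 𝒜 Z)
    (P : DualPair X Z) (P' : DualPair Z X) : Prop where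
  balanced : Balanced ℳ.rightSystem 𝒩.leftSystem P.p
  invariant : Invariant ℳ.leftSystem 𝒩.rightSystem P.p
  balanced' : Balanced 𝒩.rightSystem ℳ.leftSystem P'.p
  invariant' : Invariant 𝒩.leftSystem ℳ.rightSystem P'.p

theorem DualModules.symm {𝒜 ℬ : HopfIn T} {X Z : T} {ℳ : ModuleStr 𝒜 ℬ X} {𝒩 : ModuleStr ℬ 𝒜 Z}
    {P : DualPair X Z} {P' : DualPair Z X} (h : DualModules ℳ 𝒩 P P') : DualModules 𝒩 ℳ P' P :=
  ⟨h.balanced', h.invariant', h.balanced, h.invariant⟩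

namespace ModuleStr

variable {𝒜 ℬ : HopfIn T} {X : T} (ℳ : ModuleStr 𝒜 ℬ X)

theorem left_comp_right_inv (V : HRep 𝒜.A) (f : Module.Dual ℂ V) (W : HRep ℬ.A) (w : W) :
    (ℳ.left V).hom f ≫ (ℳ.right W).inv w =
      𝒜.F.obj V ◁ (ℳ.right W).inv w ≫ (α_ _ _ _).inv ≫ (ℳ.left V).hom f ▷ ℬ.F.obj W :=
  (ℳ.right W).ext_hom fun g => by
    rw [Category.assoc, (ℳ.right W).inv_hom, Category.assoc, Category.assoc, ℳ.commute,
      Iso.inv_hom_id_assoc, ← whiskerLeft_comp_assoc, (ℳ.right W).inv_hom]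
    simp

/-- The two actions on `Z` are transposed through different pairings. Invariance turns the one
transposed through `P` into a statement about `L.inv` and `P'`. Tested against `P'`, the commutation
of `L.inv` with `R.hom` then reduces to that of the original actions. -/
theorem commute_transpose {Z : T} (P : DualPair X Z) (P' : DualPair Z X)
    (hP : IsFrob P.p P'.p) (V : HRep 𝒜.A) (W : HRep ℬ.A) (f : Module.Dual ℂ V)
    (g : Module.Dual ℂ W) :
    (ℳ.rightSystem.transpose P).hom W g ▷ 𝒜.F.obj V ≫ (ℳ.leftSystem.transpose P').hom V f =
      (α_ _ _ _).hom ≫ ℬ.F.obj W ◁ (ℳ.leftSystem.transpose P').hom V f ≫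
        (ℳ.rightSystem.transpose P).hom W g := by
  set L := ℳ.rightSystem.transpose P with hL
  set R := ℳ.leftSystem.transpose P' with hR
  have c2 : R.hom V f ▷ X ≫ P'.p = (α_ _ _ _).hom ≫ Z ◁ (ℳ.left V).hom f ≫ P'.p :=
    ℳ.leftSystem.balanced_transpose P' V f
  have c4 : Invariant L ℳ.rightSystem P'.p :=
    (hP.balanced_iff_invariant _ _).1 (ℳ.rightSystem.balanced_transpose P)
  have key : ∀ w, R.hom V f ≫ L.inv W w =
      L.inv W w ▷ 𝒜.F.obj V ≫ (α_ _ _ _).hom ≫ ℬ.F.obj W ◁ R.hom V f := fun w => by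
    have hr := ℳ.left_comp_right_inv V f W w
    have hw := c4 W w
    rw [← ℳ.right_inv_eq] at hw
    apply P'.re_injective
    calc _ = 𝟙 _ ⊗≫ R.hom V f ▷ X ⊗≫ (L.inv W w ▷ X ≫ (α_ _ _ _).hom ≫ ℬ.F.obj W ◁ P'.p ≫
            (ρ_ (ℬ.F.obj W)).hom) ⊗≫ 𝟙 _ := by simp only [DualPair.re]; monoidal
      _ = 𝟙 _ ⊗≫ (R.hom V f ▷ X ≫ Z ◁ (ℳ.right W).inv w) ⊗≫ P'.p ▷ ℬ.F.obj W ⊗≫ 𝟙 _ := by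
          rw [hw]; monoidal
      _ = 𝟙 _ ⊗≫ (Z ⊗ 𝒜.F.obj V) ◁ (ℳ.right W).inv w ⊗≫ (R.hom V f ▷ X ≫ P'.p) ▷ ℬ.F.obj W ⊗≫
            𝟙 _ := by rw [← whisker_exchange]; monoidal
      _ = 𝟙 _ ⊗≫ Z ◁ (𝒜.F.obj V ◁ (ℳ.right W).inv w ≫ (α_ _ _ _).inv ≫
            (ℳ.left V).hom f ▷ ℬ.F.obj W) ⊗≫ P'.p ▷ ℬ.F.obj W ⊗≫ 𝟙 _ := by
          rw [c2]; monoidal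
      _ = 𝟙 _ ⊗≫ Z ◁ (ℳ.left V).hom f ⊗≫ (Z ◁ (ℳ.right W).inv w ≫ (α_ _ _ _).inv ≫
            P'.p ▷ ℬ.F.obj W ≫ (λ_ (ℬ.F.obj W)).hom) ⊗≫ 𝟙 _ := by rw [← hr]; monoidal
      _ = 𝟙 _ ⊗≫ (Z ◁ (ℳ.left V).hom f ≫ L.inv W w ▷ X) ⊗≫ ℬ.F.obj W ◁ P'.p ⊗≫ 𝟙 _ := by
          rw [← hw]; monoidal
      _ = 𝟙 _ ⊗≫ L.inv W w ▷ 𝒜.F.obj V ▷ X ⊗≫ ℬ.F.obj W ◁ ((α_ _ _ _).hom ≫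
            Z ◁ (ℳ.left V).hom f ≫ P'.p) ⊗≫ 𝟙 _ := by rw [whisker_exchange]; monoidal
      _ = 𝟙 _ ⊗≫ L.inv W w ▷ 𝒜.F.obj V ▷ X ⊗≫ ℬ.F.obj W ◁ (R.hom V f ▷ X ≫ P'.p) ⊗≫ 𝟙 _ := by
          rw [c2]
      _ = _ := by simp only [DualPair.re]; monoidal
  -- Inserting `∑ L.hom ≫ L.inv = 𝟙` in front of both sides makes `key` applicable to each term.
  have e : 𝟙 ((ℬ.F.obj W ⊗ Z) ⊗ 𝒜.F.obj V) = _ := (id_whiskerRight _ _).symm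
  rw [← L.hom_inv W (Module.finBasis ℂ W), sum_whiskerRight] at e
  rw [← Category.id_comp (L.hom W g ▷ 𝒜.F.obj V ≫ R.hom V f),
    ← Category.id_comp ((α_ _ _ _).hom ≫ ℬ.F.obj W ◁ R.hom V f ≫ L.hom W g), e,
    Preadditive.sum_comp, Preadditive.sum_comp]
  refine Finset.sum_congr rfl fun i _ => ?_
  have := key (Module.finBasis ℂ W i)
  have h2 : L.inv W (Module.finBasis ℂ W i) ▷ 𝒜.F.obj V ≫ (α_ _ _ _).hom ≫
      ℬ.F.obj W ◁ R.hom V f ≫ L.hom W g = g (Module.finBasis ℂ W i) • R.hom V f := by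
    rw [← reassoc_of% this, L.inv_hom, Linear.comp_smul, Category.comp_id]
  have h3 : L.inv W (Module.finBasis ℂ W i) ▷ 𝒜.F.obj V ≫ L.hom W g ▷ 𝒜.F.obj V ≫ R.hom V f =
      g (Module.finBasis ℂ W i) • R.hom V f := by
    rw [← comp_whiskerRight_assoc, L.inv_hom]
    simp
  rw [comp_whiskerRight, Category.assoc, Category.assoc, h2, h3]

/-- The dual module. -/
def dualModule : ModuleStr ℬ 𝒜 (dualObj X) where
  left := (ℳ.rightSystem.transpose (frobPair X)).iso
  right := (ℳ.leftSystem.transpose (frobPairStar X)).iso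
  left_natural := (ℳ.rightSystem.transpose (frobPair X)).natural
  right_natural := (ℳ.leftSystem.transpose (frobPairStar X)).natural
  left_unit := (ℳ.rightSystem.transpose (frobPair X)).unit
  right_unit := (ℳ.leftSystem.transpose (frobPairStar X)).unit
  left_mul := (ℳ.rightSystem.transpose (frobPair X)).mul
  right_mul := (ℳ.leftSystem.transpose (frobPairStar X)).mul
  commute V W f g := ℳ.commute_transpose (frobPair X) (frobPairStar X) (isFrob_ev X) W V g f

/-- The two defining formulas are the balance and the invariance of `ev X`, bent by its duality; the
conditions on `evStar X` follow because the two pairings form a Frobenius pair. -/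
theorem isTranspose_iff (𝒩 : ModuleStr ℬ 𝒜 (dualObj X)) :
    ℳ.IsTranspose 𝒩 ↔ DualModules ℳ 𝒩 (frobPair X) (frobPairStar X) := by
  have hb : (∀ (W : HRep ℬ.A) (g : Module.Dual ℂ W), (𝒩.left W).hom g = (frobPair X).mateL
      ((α_ X (ℬ.F.obj W) (dualObj X)).inv ≫ (ℳ.right W).hom g ▷ dualObj X ≫ ev X)) ↔
      Balanced ℳ.rightSystem 𝒩.leftSystem (ev X) := by
    refine forall₂_congr fun W g => ⟨fun h => ?_, fun h => ?_⟩
    · change (ℳ.right W).hom g ▷ _ ≫ _ = _ ≫ X ◁ (𝒩.left W).hom g ≫ (frobPair X).p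
      rw [h, DualPair.mateL_p, Iso.hom_inv_id_assoc]
    · refine (frobPair X).cancel_left ?_
      rw [DualPair.mateL_p]
      exact ((Iso.inv_comp_eq _).2 h).symm
  have hi : (∀ (V : HRep 𝒜.A) (v : V), (𝒩.right V).inv v = (frobPair X).lm
      ((ℳ.left V).inv v ▷ dualObj X ≫ (α_ (𝒜.F.obj V) X (dualObj X)).hom ≫
        𝒜.F.obj V ◁ ev X ≫ (ρ_ (𝒜.F.obj V)).hom)) ↔
      Invariant ℳ.leftSystem 𝒩.rightSystem (ev X) := by
    refine forall₂_congr fun V v => ?_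
    rw [ℳ.left_inv_eq, 𝒩.right_inv_eq]
    have e : X ◁ 𝒩.rightSystem.inv V v ≫ (α_ X (dualObj X) (𝒜.F.obj V)).inv ≫
        ev X ▷ 𝒜.F.obj V ≫ (λ_ (𝒜.F.obj V)).hom =
          (frobPair X).le (𝒩.rightSystem.inv V v) := by
      simp only [DualPair.le]
      rw [frobPair_p]
      monoidal
    rw [e]
    exact ⟨fun h => by rw [h, DualPair.le_lm], fun h => by rw [h, DualPair.lm_le]⟩
  constructor
  · intro h
    have h1 := hb.1 fun W g => (h.left W g).trans (by
      simp [DualPair.mateL, DualPair.lm, monoidalComp, frobPair_q])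
    have h2 := hi.1 fun V v => (h.right V v).trans (by
      simp [DualPair.lm, monoidalComp, frobPair_q])
    exact ⟨h1, h2, ((isFrob_ev X).balanced_iff_invariant' _ _).2 h2,
      ((isFrob_ev X).balanced_iff_invariant _ _).1 h1⟩
  · intro h
    refine ⟨fun W g => (hb.2 h.balanced W g).trans ?_, fun V v => (hi.2 h.invariant V v).trans ?_⟩
    · simp [DualPair.mateL, DualPair.lm, monoidalComp, frobPair_q]
    · simp [DualPair.lm, monoidalComp, frobPair_q]

theorem dualModules_dualModule :
    DualModules ℳ ℳ.dualModule (frobPair X) (frobPairStar X) := by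
  have h1 : Balanced ℳ.rightSystem ℳ.dualModule.leftSystem (ev X) :=
    ℳ.rightSystem.balanced_transpose (frobPair X)
  have h2 : Balanced ℳ.dualModule.rightSystem ℳ.leftSystem (evStar X) :=
    ℳ.leftSystem.balanced_transpose (frobPairStar X)
  exact ⟨h1, ((isFrob_ev X).balanced_iff_invariant' _ _).1 h2, h2,
    ((isFrob_ev X).balanced_iff_invariant _ _).1 h1⟩

end ModuleStr

end DualModule

/-! ### The weighted pairing -/

section WeightedPairing

attribute [local instance] Abelian.hasFiniteBiproducts

variable {T : Type u} [Category.{v} T] [Abelian T] [Linear ℂ T] [MonoidalCategory T]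
  [MonoidalPreadditive T] [MonoidalLinear ℂ T] [SemisimpleTensorCategory T] [FrobeniusDuality T]

open HRep Functor.LaxMonoidal Functor.OplaxMonoidal

namespace HRep

variable {A : Type} [Ring A] [HopfAlgebra ℂ A] [FiniteDimensional ℂ A]

/-- Evaluation at an element of `A` as a functional on the module `A^*`. -/
def evalAt : A ≃ₗ[ℂ] Module.Dual ℂ (funs A) := Module.evalEquiv ℂ A

/-- Evaluation at an element of `A ⊗ A` as a functional on `A^* ⊗ A^*`. -/
def evalAt₂ : A ⊗[ℂ] A →ₗ[ℂ] Module.Dual ℂ (funs A ⊗ funs A : HRep A) :=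
  (TensorProduct.dualDistrib ℂ A A).flip

theorem evalAt₂_tmul (a b : A) : evalAt₂ (a ⊗ₜ b) = tprod (evalAt a) (evalAt b) := by
  refine dual_ext fun f g => ?_
  rfl

theorem evalAt_comp_funsMul (a : A) :
    evalAt a ∘ₗ lin (funsMul (A := A)) = evalAt₂ (Coalgebra.comul (R := ℂ) a) := rfl

end HRep

namespace HopfIn

variable (𝒜 : HopfIn T)

/-- The product of `F(A^*)`, without the factor `ω_A`. -/
def mulUnit : 𝒜.unitObj ⊗ 𝒜.unitObj ⟶ 𝒜.unitObj :=
  μ 𝒜.F (funs 𝒜.A) (funs 𝒜.A) ≫ 𝒜.F.map funsMul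

end HopfIn

namespace ModuleStr

variable {𝒜 ℬ : HopfIn T} {X : T} (ℳ : ModuleStr 𝒜 ℬ X)

/-- Evaluation of a product in `A^*` at `a` splits through `Δ(a)`, and pairing the second factor
with `χ` leaves `χ(a₂) a₁ = χ(a) 1` by the integral property. -/
theorem inv_regChar_mul_hom (a : 𝒜.A) :
    𝒜.unitObj ◁ (ℳ.left (funs 𝒜.A)).inv (regChar 𝒜) ≫ (α_ _ _ _).inv ≫ 𝒜.mulUnit ▷ X ≫
      (ℳ.left (funs 𝒜.A)).hom (evalAt a) = regTrace 𝒜.A a • ℳ.actLeft := by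
  have h1 : ∀ t : 𝒜.A ⊗[ℂ] 𝒜.A, 𝒜.unitObj ◁ (ℳ.left (funs 𝒜.A)).inv (regChar 𝒜) ≫
      (α_ _ _ _).inv ≫ μ 𝒜.F (funs 𝒜.A) (funs 𝒜.A) ▷ X ≫
        (ℳ.left (funs 𝒜.A ⊗ funs 𝒜.A)).hom (evalAt₂ t) =
      (ℳ.left (funs 𝒜.A)).hom (evalAt (contractRight (regTrace 𝒜.A) t)) := fun t => by
    induction t with
    | zero => simp
    | add t t' h h' =>
      simp only [map_add, Preadditive.comp_add]
      rw [h, h']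
    | tmul a b =>
      rw [evalAt₂_tmul]
      refine (congrArg (fun x => _ ≫ _ ≫ x) (ℳ.left_mul _ _ (evalAt a) (evalAt b))).trans ?_
      rw [Iso.inv_hom_id_assoc, ← whiskerLeft_comp_assoc, MultipleIso.inv_hom,
        MonoidalLinear.whiskerLeft_smul, whiskerLeft_id, Linear.smul_comp, Category.id_comp,
        contractRight_tmul, map_smul, map_smul]
      rfl
  have h2 : contractRight (regTrace 𝒜.A) (Coalgebra.comul (R := ℂ) a) = regTrace 𝒜.A a • 1 := by
    refine (Module.evalEquiv ℂ 𝒜.A).injective (LinearMap.ext fun φ => ?_)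
    refine Eq.trans ?_ ((regTrace_integral_left 𝒜.antipode_antipode φ a).trans ?_)
    · change φ (contractRight (regTrace 𝒜.A) (Coalgebra.comul (R := ℂ) a)) = _
      generalize Coalgebra.comul (R := ℂ) a = t
      induction t with
      | zero => simp
      | add t t' h h' => simp only [map_add, h, h']
      | tmul a b => simp [contractRight_tmul, mul_comm]
    · change _ = φ (regTrace 𝒜.A a • 1)
      rw [map_smul, smul_eq_mul, mul_comm]
  rw [HopfIn.mulUnit, comp_whiskerRight, Category.assoc, ℳ.left_natural, evalAt_comp_funsMul, h1,
    h2, map_smul, map_smul]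
  rfl

theorem inv_regChar_hom_mul (b : ℬ.A) :
    (ℳ.right (funs ℬ.A)).inv (regChar ℬ) ▷ ℬ.unitObj ≫ (α_ _ _ _).hom ≫ X ◁ ℬ.mulUnit ≫
      (ℳ.right (funs ℬ.A)).hom (evalAt b) = regTrace ℬ.A b • ℳ.actRight := by
  have h1 : ∀ t : ℬ.A ⊗[ℂ] ℬ.A, (ℳ.right (funs ℬ.A)).inv (regChar ℬ) ▷ ℬ.unitObj ≫
      (α_ _ _ _).hom ≫ X ◁ μ ℬ.F (funs ℬ.A) (funs ℬ.A) ≫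
        (ℳ.right (funs ℬ.A ⊗ funs ℬ.A)).hom (evalAt₂ t) =
      (ℳ.right (funs ℬ.A)).hom (evalAt (contractLeft' (regTrace ℬ.A) t)) := fun t => by
    induction t with
    | zero => simp
    | add t t' h h' =>
      simp only [map_add, Preadditive.comp_add]
      rw [h, h']
    | tmul a b =>
      rw [evalAt₂_tmul]
      refine (congrArg (fun x => _ ≫ _ ≫ x) (ℳ.right_mul _ _ (evalAt a) (evalAt b))).trans ?_
      rw [Iso.hom_inv_id_assoc, ← comp_whiskerRight_assoc, MultipleIso.inv_hom,
        MonoidalLinear.smul_whiskerRight, id_whiskerRight, Linear.smul_comp, Category.id_comp,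
        contractLeft'_tmul, map_smul, map_smul]
      rfl
  have h2 : contractLeft' (regTrace ℬ.A) (Coalgebra.comul (R := ℂ) b) = regTrace ℬ.A b • 1 := by
    refine (Module.evalEquiv ℂ ℬ.A).injective (LinearMap.ext fun φ => ?_)
    refine Eq.trans ?_ ((regTrace_integral_right ℬ.antipode_antipode φ b).trans ?_)
    · change φ (contractLeft' (regTrace ℬ.A) (Coalgebra.comul (R := ℂ) b)) = _
      generalize Coalgebra.comul (R := ℂ) b = t
      induction t with
      | zero => simp
      | add t t' h h' => simp only [map_add, h, h']
      | tmul a b => simp [contractLeft'_tmul, mul_comm]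
    · change _ = φ (regTrace ℬ.A b • 1)
      rw [map_smul, smul_eq_mul, mul_comm]
  rw [HopfIn.mulUnit, whiskerLeft_comp, Category.assoc, ℳ.right_natural, evalAt_comp_funsMul, h1,
    h2, map_smul, map_smul]
  rfl

/-- The morphism `X ⟶ F(A^*) ⊗ X` given by `χ` is linear over `F(A^*)`, which multiplies the first
factor. On the component at `a` both sides are `χ(a)` times the action. -/
theorem actLeft_comp_inv :
    ℳ.actLeft ≫ (ℳ.left (funs 𝒜.A)).inv (regChar 𝒜) =
      𝒜.unitObj ◁ (ℳ.left (funs 𝒜.A)).inv (regChar 𝒜) ≫ (α_ _ _ _).inv ≫ 𝒜.mulUnit ▷ X :=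
  (ℳ.left (funs 𝒜.A)).ext_hom fun f => by
    obtain ⟨a, rfl⟩ := evalAt.surjective f
    rw [Category.assoc, MultipleIso.inv_hom, Category.assoc, Category.assoc,
      ℳ.inv_regChar_mul_hom, Linear.comp_smul, Category.comp_id]
    rfl

theorem actRight_comp_inv :
    ℳ.actRight ≫ (ℳ.right (funs ℬ.A)).inv (regChar ℬ) =
      (ℳ.right (funs ℬ.A)).inv (regChar ℬ) ▷ ℬ.unitObj ≫ (α_ _ _ _).hom ≫ X ◁ ℬ.mulUnit :=
  (ℳ.right (funs ℬ.A)).ext_hom fun f => by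
    obtain ⟨a, rfl⟩ := evalAt.surjective f
    rw [Category.assoc, MultipleIso.inv_hom, Category.assoc, Category.assoc,
      ℳ.inv_regChar_hom_mul, Linear.comp_smul, Category.comp_id]
    rfl

theorem regChar_evalOne (𝒜 : HopfIn T) : 𝒜.evalOne (regChar 𝒜) = 𝒜.size :=
  (regTrace_one (A := 𝒜.A)).trans (by simp [HopfIn.size])

/-- The action is the component at evaluation at `1`, and `χ(1) = |A|`. The constants of the
triangle identities come from here. -/
theorem inv_comp_actLeft :
    (ℳ.left (funs 𝒜.A)).inv (regChar 𝒜) ≫ ℳ.actLeft = (𝒜.size : ℂ) • 𝟙 X := by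
  rw [actLeft, MultipleIso.inv_hom, regChar_evalOne]

theorem inv_comp_actRight :
    (ℳ.right (funs ℬ.A)).inv (regChar ℬ) ≫ ℳ.actRight = (ℬ.size : ℂ) • 𝟙 X := by
  rw [actRight, MultipleIso.inv_hom, regChar_evalOne]

end ModuleStr

namespace DualModules

variable {𝒜 ℬ : HopfIn T} {X Z : T} {ℳ : ModuleStr 𝒜 ℬ X} {𝒩 : ModuleStr ℬ 𝒜 Z}
  {P : DualPair X Z} {P' : DualPair Z X} (h : DualModules ℳ 𝒩 P P')

include h

/-- Invariance lets `χ` be inserted on `Z` instead of `X`. This form suits the right action of `A`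
and the balance over `B`. -/
theorem weightedPairing_eq : ℳ.weightedPairing P.p =
    X ◁ (𝒩.right (funs 𝒜.A)).inv (ModuleStr.regChar 𝒜) ≫ (α_ _ _ _).inv ≫ P.p ▷ 𝒜.unitObj ≫
      (λ_ 𝒜.unitObj).hom := by
  rw [ModuleStr.weightedPairing, ℳ.left_inv_eq, 𝒩.right_inv_eq]
  exact h.invariant _ _

omit h in
theorem actLeft_weightedPairing (p : X ⊗ Z ⟶ 𝟙_ T) :
    ℳ.actLeft ▷ Z ≫ ℳ.weightedPairing p =
      (α_ _ _ _).hom ≫ 𝒜.unitObj ◁ ℳ.weightedPairing p ≫ 𝒜.mulUnit := by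
  have e := ℳ.actLeft_comp_inv
  set i := (ℳ.left (funs 𝒜.A)).inv (ModuleStr.regChar 𝒜) with hi
  simp only [ModuleStr.weightedPairing]
  rw [← hi]
  calc _ = 𝟙 _ ⊗≫ (ℳ.actLeft ≫ i) ▷ Z ⊗≫ 𝒜.unitObj ◁ p ⊗≫ 𝟙 _ := by monoidal
    _ = 𝟙 _ ⊗≫ 𝒜.unitObj ◁ i ▷ Z ⊗≫ (𝒜.mulUnit ▷ (X ⊗ Z) ≫ 𝒜.unitObj ◁ p) ⊗≫ 𝟙 _ := by
        rw [e]; monoidal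
    _ = _ := by rw [← whisker_exchange]; monoidal

theorem actRight_weightedPairing :
    X ◁ 𝒩.actRight ≫ ℳ.weightedPairing P.p =
      (α_ _ _ _).inv ≫ ℳ.weightedPairing P.p ▷ 𝒜.unitObj ≫ 𝒜.mulUnit := by
  have e := 𝒩.actRight_comp_inv
  rw [h.weightedPairing_eq]
  set i := (𝒩.right (funs 𝒜.A)).inv (ModuleStr.regChar 𝒜) with hi
  calc _ = 𝟙 _ ⊗≫ X ◁ (𝒩.actRight ≫ i) ⊗≫ P.p ▷ 𝒜.unitObj ⊗≫ 𝟙 _ := by monoidal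
    _ = 𝟙 _ ⊗≫ X ◁ i ▷ 𝒜.unitObj ⊗≫ ((X ⊗ Z) ◁ 𝒜.mulUnit ≫ P.p ▷ 𝒜.unitObj) ⊗≫ 𝟙 _ := by
        rw [e]; monoidal
    _ = _ := by rw [whisker_exchange]; monoidal

/-- With `χ` inserted on `Z`, its insertion commutes with the left action of `B` on `Z`, so the
balance of `P.p` suffices. -/
theorem balanced_weightedPairing :
    ℳ.actRight ▷ Z ≫ ℳ.weightedPairing P.p =
      (α_ _ _ _).hom ≫ X ◁ 𝒩.actLeft ≫ ℳ.weightedPairing P.p := by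
  have hb : ℳ.actRight ▷ Z ≫ P.p = (α_ _ _ _).hom ≫ X ◁ 𝒩.actLeft ≫ P.p := h.balanced _ _
  have e : 𝒩.actLeft ≫ (𝒩.right (funs 𝒜.A)).inv (ModuleStr.regChar 𝒜) = _ :=
    𝒩.left_comp_right_inv _ _ _ _
  rw [h.weightedPairing_eq]
  set i := (𝒩.right (funs 𝒜.A)).inv (ModuleStr.regChar 𝒜) with hi
  calc _ = 𝟙 _ ⊗≫ (ℳ.actRight ▷ Z ≫ X ◁ i) ⊗≫ P.p ▷ 𝒜.unitObj ⊗≫ 𝟙 _ := by monoidal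
    _ = 𝟙 _ ⊗≫ (X ⊗ ℬ.unitObj) ◁ i ⊗≫ (ℳ.actRight ▷ Z ≫ P.p) ▷ 𝒜.unitObj ⊗≫ 𝟙 _ := by
        rw [← whisker_exchange]; monoidal
    _ = 𝟙 _ ⊗≫ X ◁ (ℬ.unitObj ◁ i ≫ (α_ _ _ _).inv ≫ 𝒩.actLeft ▷ 𝒜.unitObj) ⊗≫
          P.p ▷ 𝒜.unitObj ⊗≫ 𝟙 _ := by rw [hb]; monoidal
    _ = 𝟙 _ ⊗≫ X ◁ (𝒩.actLeft ≫ i) ⊗≫ P.p ▷ 𝒜.unitObj ⊗≫ 𝟙 _ := by rw [e]; rfl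
    _ = _ := by monoidal

omit h in
variable (𝒩) (P) in
/-- The copairing induced by the action on `Z`. -/
def copair : ℬ.unitObj ⟶ Z ⊗ X :=
  (ρ_ _).inv ≫ ℬ.unitObj ◁ P.q ≫ (α_ _ _ _).inv ≫ 𝒩.actLeft ▷ X

/-- Bent by `P.le`, both sides become the right action on `X`: one by balance, the other by a
zigzag. -/
theorem copair_eq : copair 𝒩 P = (λ_ _).inv ≫ P.q ▷ ℬ.unitObj ≫ (α_ _ _ _).hom ≫
    Z ◁ ℳ.actRight := by
  have hb : ℳ.actRight ▷ Z ≫ P.p = (α_ _ _ _).hom ≫ X ◁ 𝒩.actLeft ≫ P.p := h.balanced _ _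
  apply P.le_injective
  have e1 : P.le (copair 𝒩 P) = ℳ.actRight := by
    calc _ = 𝟙 _ ⊗≫ (X ⊗ ℬ.unitObj) ◁ P.q ⊗≫ ((α_ _ _ _).hom ≫ X ◁ 𝒩.actLeft ≫ P.p) ▷ X ⊗≫
          𝟙 _ := by simp only [DualPair.le, copair]; monoidal
      _ = 𝟙 _ ⊗≫ ((X ⊗ ℬ.unitObj) ◁ P.q ≫ ℳ.actRight ▷ (Z ⊗ X)) ⊗≫ P.p ▷ X ⊗≫ 𝟙 _ := by
          rw [← hb]; monoidal
      _ = 𝟙 _ ⊗≫ ℳ.actRight ⊗≫ (X ◁ P.q ⊗≫ P.p ▷ X) ⊗≫ 𝟙 _ := by rw [whisker_exchange]; monoidal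
      _ = _ := by rw [P.zig]; monoidal
  rw [e1]
  symm
  calc _ = 𝟙 _ ⊗≫ X ◁ P.q ▷ ℬ.unitObj ⊗≫ ((X ⊗ Z) ◁ ℳ.actRight ≫ P.p ▷ X) ⊗≫ 𝟙 _ := by
        simp only [DualPair.le]; monoidal
    _ = 𝟙 _ ⊗≫ (X ◁ P.q ⊗≫ P.p ▷ X) ▷ ℬ.unitObj ⊗≫ ℳ.actRight ⊗≫ 𝟙 _ := by
        rw [whisker_exchange]; monoidal
    _ = _ := by rw [P.zig]; monoidal

/-- Since the actions on `Z` commute, the left one can be moved to the end. What precedes it is a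
zigzag of `P` around the insertion of `χ` followed by the right action, that is, the scalar `|A|`.
-/
theorem triangle_left :
    copair 𝒩 P ▷ Z ≫ (α_ _ _ _).hom ≫ Z ◁ ℳ.weightedPairing P.p ≫ 𝒩.actRight =
      (𝒜.size : ℂ) • 𝒩.actLeft := by
  have hc : 𝒩.actLeft ▷ 𝒜.unitObj ≫ 𝒩.actRight =
    (α_ _ _ _).hom ≫ ℬ.unitObj ◁ 𝒩.actRight ≫ 𝒩.actLeft := 𝒩.commute _ _ _ _
  have hi := 𝒩.inv_comp_actRight
  have e : (λ_ Z).inv ≫ P.q ▷ Z ≫ (α_ _ _ _).hom ≫ Z ◁ ℳ.weightedPairing P.p ≫ 𝒩.actRight =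
      (𝒜.size : ℂ) • 𝟙 Z := by
    rw [h.weightedPairing_eq]
    set i := (𝒩.right (funs 𝒜.A)).inv (ModuleStr.regChar 𝒜)
    calc _ = 𝟙 _ ⊗≫ (P.q ▷ Z ≫ (Z ⊗ X) ◁ i) ⊗≫ Z ◁ P.p ▷ 𝒜.unitObj ⊗≫ 𝒩.actRight := by monoidal
      _ = 𝟙 _ ⊗≫ i ⊗≫ (P.q ▷ Z ⊗≫ Z ◁ P.p) ▷ 𝒜.unitObj ⊗≫ 𝒩.actRight := by
          rw [← whisker_exchange]; monoidal
      _ = i ≫ 𝒩.actRight := by rw [P.zag]; monoidal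
      _ = _ := hi
  calc _ = 𝟙 _ ⊗≫ ℬ.unitObj ◁ P.q ▷ Z ⊗≫ (𝒩.actLeft ▷ (X ⊗ Z) ≫ Z ◁ ℳ.weightedPairing P.p) ⊗≫
        𝒩.actRight := by simp only [copair]; monoidal
    _ = 𝟙 _ ⊗≫ ℬ.unitObj ◁ P.q ▷ Z ⊗≫ ℬ.unitObj ◁ Z ◁ ℳ.weightedPairing P.p ⊗≫
        (𝒩.actLeft ▷ 𝒜.unitObj ≫ 𝒩.actRight) := by rw [← whisker_exchange]; monoidal
    _ = ℬ.unitObj ◁ ((λ_ Z).inv ≫ P.q ▷ Z ≫ (α_ _ _ _).hom ≫ Z ◁ ℳ.weightedPairing P.p ≫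
        𝒩.actRight) ≫ 𝒩.actLeft := by rw [hc]; monoidal
    _ = _ := by
        rw [e, MonoidalLinear.whiskerLeft_smul, whiskerLeft_id, Linear.smul_comp, Category.id_comp]

theorem triangle_right :
    X ◁ copair 𝒩 P ≫ (α_ _ _ _).inv ≫ ℳ.weightedPairing P.p ▷ X ≫ ℳ.actLeft =
      (𝒜.size : ℂ) • ℳ.actRight := by
  have hc : ℳ.actLeft ▷ ℬ.unitObj ≫ ℳ.actRight =
    (α_ _ _ _).hom ≫ 𝒜.unitObj ◁ ℳ.actRight ≫ ℳ.actLeft := ℳ.commute _ _ _ _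
  have hi := ℳ.inv_comp_actLeft
  have e : (ρ_ X).inv ≫ X ◁ P.q ≫ (α_ _ _ _).inv ≫ ℳ.weightedPairing P.p ▷ X ≫ ℳ.actLeft =
      (𝒜.size : ℂ) • 𝟙 X := by
    rw [ModuleStr.weightedPairing]
    set i := (ℳ.left (funs 𝒜.A)).inv (ModuleStr.regChar 𝒜)
    calc _ = 𝟙 _ ⊗≫ (X ◁ P.q ≫ i ▷ (Z ⊗ X)) ⊗≫ 𝒜.unitObj ◁ P.p ▷ X ⊗≫ ℳ.actLeft := by monoidal
      _ = 𝟙 _ ⊗≫ i ⊗≫ 𝒜.unitObj ◁ (X ◁ P.q ⊗≫ P.p ▷ X) ⊗≫ ℳ.actLeft := by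
          rw [whisker_exchange]; monoidal
      _ = i ≫ ℳ.actLeft := by rw [P.zig]; monoidal
      _ = _ := hi
  rw [h.copair_eq]
  calc _ = 𝟙 _ ⊗≫ X ◁ P.q ▷ ℬ.unitObj ⊗≫ ((X ⊗ Z) ◁ ℳ.actRight ≫ ℳ.weightedPairing P.p ▷ X) ⊗≫
        ℳ.actLeft := by monoidal
    _ = 𝟙 _ ⊗≫ X ◁ P.q ▷ ℬ.unitObj ⊗≫ ℳ.weightedPairing P.p ▷ X ▷ ℬ.unitObj ⊗≫
        ((α_ _ _ _).hom ≫ 𝒜.unitObj ◁ ℳ.actRight ≫ ℳ.actLeft) := by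
          rw [whisker_exchange]; monoidal
    _ = ((ρ_ X).inv ≫ X ◁ P.q ≫ (α_ _ _ _).inv ≫ ℳ.weightedPairing P.p ▷ X ≫
        ℳ.actLeft) ▷ ℬ.unitObj ≫ ℳ.actRight := by rw [← hc]; monoidal
    _ = _ := by
        rw [e, MonoidalLinear.smul_whiskerRight, id_whiskerRight, Linear.smul_comp,
          Category.id_comp]

end DualModules

end WeightedPairing

/-! ### Compositions of 1-morphisms -/

section Compositions

attribute [local instance] Abelian.hasFiniteBiproducts

variable {T : Type u} [Category.{v} T] [Abelian T] [Linear ℂ T] [MonoidalCategory T]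
  [MonoidalPreadditive T] [MonoidalLinear ℂ T] [SemisimpleTensorCategory T] [FrobeniusDuality T]

variable {𝒜 ℬ 𝒞 𝒟 : HopfIn T}

instance epi_proj (M : Bimod 𝒜.alg ℬ.alg) (N : Bimod ℬ.alg 𝒞.alg) : Epi (proj M N) :=
  inferInstanceAs (Epi (coequalizer.π _ _))

/-- By rigidity `Y ⊗ -` preserves colimits and hence epimorphisms. Identities on quotients, tensored
or not, can therefore be checked before passing to them. -/
instance epi_whiskerLeft_proj (Y : T) (M : Bimod 𝒜.alg ℬ.alg) (N : Bimod ℬ.alg 𝒞.alg) :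
    Epi (Y ◁ proj M N) :=
  inferInstanceAs (Epi ((tensorLeft Y).map (proj M N)))

instance epi_proj_whiskerRight (M : Bimod 𝒜.alg ℬ.alg) (N : Bimod ℬ.alg 𝒞.alg) (Y : T) :
    Epi (proj M N ▷ Y) :=
  inferInstanceAs (Epi ((tensorRight Y).map (proj M N)))

theorem whiskerLeft_proj_actLeft (M : Bimod 𝒜.alg ℬ.alg) (N : Bimod ℬ.alg 𝒞.alg) :
    𝒜.alg.X ◁ proj M N ≫ (M.tensorBimod N).actLeft =
      (α_ _ _ _).inv ≫ M.actLeft ▷ N.X ≫ proj M N :=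
  Bimod.TensorBimod.whiskerLeft_π_actLeft M N

theorem proj_whiskerRight_actRight (M : Bimod 𝒜.alg ℬ.alg) (N : Bimod ℬ.alg 𝒞.alg) :
    proj M N ▷ 𝒞.alg.X ≫ (M.tensorBimod N).actRight =
      (α_ _ _ _).hom ≫ M.X ◁ N.actRight ≫ proj M N :=
  Bimod.TensorBimod.π_tensor_id_actRight M N

theorem proj_comp_whiskerRight {M M' : Bimod 𝒜.alg ℬ.alg} (f : M ⟶ M')
    (N : Bimod ℬ.alg 𝒞.alg) :
    proj M N ≫ (Bimod.whiskerRight f N).hom = f.hom ▷ N.X ≫ proj M' N :=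
  ι_colimMap _ _

theorem proj_comp_whiskerLeft (M : Bimod 𝒜.alg ℬ.alg) {N N' : Bimod ℬ.alg 𝒞.alg}
    (f : N ⟶ N') :
    proj M N ≫ (Bimod.whiskerLeft M f).hom = M.X ◁ f.hom ≫ proj M N' :=
  ι_colimMap _ _

theorem proj_proj_comp_associator_hom (M : Bimod 𝒜.alg ℬ.alg) (N : Bimod ℬ.alg 𝒞.alg)
    (L : Bimod 𝒞.alg 𝒟.alg) :
    proj M N ▷ L.X ≫ proj (M.tensorBimod N) L ≫ (Bimod.associatorBimod M N L).hom.hom =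
      (α_ _ _ _).hom ≫ M.X ◁ proj N L ≫ proj M (N.tensorBimod L) := by
  have h : proj (M.tensorBimod N) L ≫ (Bimod.associatorBimod M N L).hom.hom =
      Bimod.AssociatorBimod.homAux M N L := coequalizer.π_desc _ _
  rw [h]
  exact π_tensor_id_preserves_coequalizer_inv_desc _ _ _ _

theorem proj_proj_comp_associator_inv (M : Bimod 𝒜.alg ℬ.alg) (N : Bimod ℬ.alg 𝒞.alg)
    (L : Bimod 𝒞.alg 𝒟.alg) :
    M.X ◁ proj N L ≫ proj M (N.tensorBimod L) ≫ (Bimod.associatorBimod M N L).inv.hom =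
      (α_ _ _ _).inv ≫ proj M N ▷ L.X ≫ proj (M.tensorBimod N) L := by
  have h : proj M (N.tensorBimod L) ≫ (Bimod.associatorBimod M N L).inv.hom =
      Bimod.AssociatorBimod.invAux M N L := coequalizer.π_desc _ _
  rw [h]
  exact id_tensor_π_preserves_coequalizer_inv_desc _ _ _ _

theorem proj_comp_leftUnitor_hom (M : Bimod 𝒜.alg ℬ.alg) :
    proj (Bimod.regular 𝒜.alg) M ≫ (Bimod.leftUnitorBimod M).hom.hom = M.actLeft :=
  coequalizer.π_desc _ _

theorem proj_comp_rightUnitor_hom (M : Bimod 𝒜.alg ℬ.alg) :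
    proj M (Bimod.regular ℬ.alg) ≫ (Bimod.rightUnitorBimod M).hom.hom = M.actRight :=
  coequalizer.π_desc _ _

variable {M : Bimod 𝒜.alg ℬ.alg} {N : Bimod ℬ.alg 𝒜.alg}

theorem actLeft_comp_of_proj {e : M.X ⊗ N.X ⟶ 𝒜.alg.X} {g : (M.tensorBimod N).X ⟶ 𝒜.alg.X}
    (h : proj M N ≫ g = e)
    (left : M.actLeft ▷ N.X ≫ e = (α_ _ _ _).hom ≫ 𝒜.alg.X ◁ e ≫ 𝒜.alg.mon.mul) :
    (M.tensorBimod N).actLeft ≫ g = 𝒜.alg.X ◁ g ≫ 𝒜.alg.mon.mul := by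
  rw [← cancel_epi (𝒜.alg.X ◁ proj M N), ← Category.assoc, whiskerLeft_proj_actLeft,
    ← whiskerLeft_comp_assoc, h, Category.assoc, Category.assoc, h, left, Iso.inv_hom_id_assoc]

theorem actRight_comp_of_proj {e : M.X ⊗ N.X ⟶ 𝒜.alg.X} {g : (M.tensorBimod N).X ⟶ 𝒜.alg.X}
    (h : proj M N ≫ g = e)
    (right : M.X ◁ N.actRight ≫ e = (α_ _ _ _).inv ≫ e ▷ 𝒜.alg.X ≫ 𝒜.alg.mon.mul) :
    (M.tensorBimod N).actRight ≫ g = g ▷ 𝒜.alg.X ≫ 𝒜.alg.mon.mul := by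
  rw [← cancel_epi (proj M N ▷ 𝒜.alg.X), ← Category.assoc, proj_whiskerRight_actRight,
    ← comp_whiskerRight_assoc, h, Category.assoc, Category.assoc, h, right, Iso.hom_inv_id_assoc]

/-- The morphism on `M ⊗_B N` induced by a balanced morphism on `M ⊗ N` that is compatible with the
actions of `F(A^*)`. -/
def descProj (e : M.X ⊗ N.X ⟶ 𝒜.alg.X)
    (balanced : M.actRight ▷ N.X ≫ e = (α_ _ _ _).hom ≫ M.X ◁ N.actLeft ≫ e)
    (left : M.actLeft ▷ N.X ≫ e = (α_ _ _ _).hom ≫ 𝒜.alg.X ◁ e ≫ 𝒜.alg.mon.mul)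
    (right : M.X ◁ N.actRight ≫ e = (α_ _ _ _).inv ≫ e ▷ 𝒜.alg.X ≫ 𝒜.alg.mon.mul) :
    M.tensorBimod N ⟶ Bimod.regular 𝒜.alg where
  hom := coequalizer.desc e (balanced.trans (Category.assoc _ _ _).symm)
  left_act_hom := actLeft_comp_of_proj (coequalizer.π_desc _ _) left
  right_act_hom := actRight_comp_of_proj (coequalizer.π_desc _ _) right

theorem proj_comp_descProj (e : M.X ⊗ N.X ⟶ 𝒜.alg.X) (balanced) (left) (right) :
    proj M N ≫ (descProj (M := M) (N := N) e balanced left right).hom = e :=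
  coequalizer.π_desc _ _

theorem comp_actLeft_of_proj {w : ℬ.alg.X ⟶ N.X ⊗ M.X}
    (left : ℬ.alg.mon.mul ≫ w = ℬ.alg.X ◁ w ≫ (α_ _ _ _).inv ≫ N.actLeft ▷ M.X) :
    ℬ.alg.mon.mul ≫ w ≫ proj N M = ℬ.alg.X ◁ (w ≫ proj N M) ≫ (N.tensorBimod M).actLeft := by
  rw [whiskerLeft_comp, Category.assoc, whiskerLeft_proj_actLeft, ← Category.assoc, left]
  simp only [Category.assoc]

theorem comp_actRight_of_proj {w : ℬ.alg.X ⟶ N.X ⊗ M.X}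
    (right : ℬ.alg.mon.mul ≫ w = w ▷ ℬ.alg.X ≫ (α_ _ _ _).hom ≫ N.X ◁ M.actRight) :
    ℬ.alg.mon.mul ≫ w ≫ proj N M = (w ≫ proj N M) ▷ ℬ.alg.X ≫ (N.tensorBimod M).actRight := by
  rw [comp_whiskerRight, Category.assoc, proj_whiskerRight_actRight, ← Category.assoc, right]
  simp only [Category.assoc]

/-- The morphism to `N ⊗_A M` induced by a morphism to `N ⊗ M` that is compatible with the actions
of `G(B^*)`. -/
def liftProj (w : ℬ.alg.X ⟶ N.X ⊗ M.X)
    (left : ℬ.alg.mon.mul ≫ w = ℬ.alg.X ◁ w ≫ (α_ _ _ _).inv ≫ N.actLeft ▷ M.X)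
    (right : ℬ.alg.mon.mul ≫ w = w ▷ ℬ.alg.X ≫ (α_ _ _ _).hom ≫ N.X ◁ M.actRight) :
    Bimod.regular ℬ.alg ⟶ N.tensorBimod M where
  hom := w ≫ proj N M
  left_act_hom := comp_actLeft_of_proj left
  right_act_hom := comp_actRight_of_proj right

/-- After composition with the right unitor, the identity is tested on the epimorphism from `G(B^*)
⊗ N`. There the whiskerings, the associator and the unitors are all given by their lifts to
unreduced tensor products, and `left` remains. -/
theorem left_triangle_of_proj {counit : M.tensorBimod N ⟶ Bimod.regular 𝒜.alg}
    {unit : Bimod.regular ℬ.alg ⟶ N.tensorBimod M}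
    {e : M.X ⊗ N.X ⟶ 𝒜.alg.X} {w : ℬ.alg.X ⟶ N.X ⊗ M.X}
    (he : proj M N ≫ counit.hom = e) (hw : unit.hom = w ≫ proj N M)
    (left : w ▷ N.X ≫ (α_ _ _ _).hom ≫ N.X ◁ e ≫ N.actRight = N.actLeft) :
    Bimod.whiskerRight unit N ≫ (Bimod.associatorBimod N M N).hom ≫ Bimod.whiskerLeft N counit =
      (Bimod.leftUnitorBimod N).hom ≫ (Bimod.rightUnitorBimod N).inv := by
  rw [← cancel_mono (Bimod.rightUnitorBimod N).hom, Category.assoc, Category.assoc,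
    Category.assoc, Iso.inv_hom_id, Category.comp_id]
  refine Bimod.hom_ext _ _ ((cancel_epi (proj (Bimod.regular ℬ.alg) N)).1 ?_)
  rw [proj_comp_leftUnitor_hom]
  have h1 : (proj (Bimod.regular ℬ.alg) N : ℬ.alg.X ⊗ N.X ⟶ _) ≫
      (Bimod.whiskerRight unit N).hom ≫ (Bimod.associatorBimod N M N).hom.hom =
      w ▷ N.X ≫ (α_ _ _ _).hom ≫ N.X ◁ proj M N ≫ proj N (M.tensorBimod N) := by
    refine (Category.assoc _ _ _).symm.trans
      ((congrArg (· ≫ _) (proj_comp_whiskerRight unit N)).trans ?_)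
    rw [hw]
    refine (Category.assoc _ _ _).trans ?_
    rw [← proj_proj_comp_associator_hom]
    exact (congrArg (· ≫ _) (comp_whiskerRight _ _ _)).trans (Category.assoc _ _ _)
  obtain ⟨g, hg⟩ : ∃ g : (M.tensorBimod N).X ⟶ 𝒜.alg.X, counit.hom = g := ⟨_, rfl⟩
  have h2 : proj N (M.tensorBimod N) ≫ (Bimod.whiskerLeft N counit).hom ≫
      (Bimod.rightUnitorBimod N).hom.hom = N.X ◁ g ≫ N.actRight := by
    rw [← Category.assoc, proj_comp_whiskerLeft, Category.assoc, proj_comp_rightUnitor_hom, hg]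
    rfl
  have h3 : N.X ◁ e = N.X ◁ proj M N ≫ N.X ◁ g := by
    rw [← whiskerLeft_comp, ← hg]
    exact congrArg (N.X ◁ ·) he.symm
  refine Eq.trans ?_ left
  rw [h3, Category.assoc, ← h2]
  simp only [Bimod.comp_hom']
  refine Eq.trans ?_ ((congrArg (· ≫ (Bimod.whiskerLeft N counit).hom ≫
    (Bimod.rightUnitorBimod N).hom.hom) h1).trans ?_)
  · exact ((Category.assoc _ _ _).trans (congrArg (_ ≫ ·) (Category.assoc _ _ _))).symm
  · exact (Category.assoc _ _ _).trans (congrArg (_ ≫ ·) ((Category.assoc _ _ _).trans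
      (congrArg (_ ≫ ·) (Category.assoc _ _ _))))

theorem right_triangle_of_proj {counit : M.tensorBimod N ⟶ Bimod.regular 𝒜.alg}
    {unit : Bimod.regular ℬ.alg ⟶ N.tensorBimod M}
    {e : M.X ⊗ N.X ⟶ 𝒜.alg.X} {w : ℬ.alg.X ⟶ N.X ⊗ M.X}
    (he : proj M N ≫ counit.hom = e) (hw : unit.hom = w ≫ proj N M)
    (right : M.X ◁ w ≫ (α_ _ _ _).inv ≫ e ▷ M.X ≫ M.actLeft = M.actRight) :
    Bimod.whiskerLeft M unit ≫ (Bimod.associatorBimod M N M).inv ≫ Bimod.whiskerRight counit M =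
      (Bimod.rightUnitorBimod M).hom ≫ (Bimod.leftUnitorBimod M).inv := by
  rw [← cancel_mono (Bimod.leftUnitorBimod M).hom, Category.assoc, Category.assoc,
    Category.assoc, Iso.inv_hom_id, Category.comp_id]
  refine Bimod.hom_ext _ _ ((cancel_epi (proj M (Bimod.regular ℬ.alg))).1 ?_)
  rw [proj_comp_rightUnitor_hom]
  have h1 : (proj M (Bimod.regular ℬ.alg) : M.X ⊗ ℬ.alg.X ⟶ _) ≫
      (Bimod.whiskerLeft M unit).hom ≫ (Bimod.associatorBimod M N M).inv.hom =
      M.X ◁ w ≫ (α_ _ _ _).inv ≫ proj M N ▷ M.X ≫ proj (M.tensorBimod N) M := by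
    refine (Category.assoc _ _ _).symm.trans
      ((congrArg (· ≫ _) (proj_comp_whiskerLeft M unit)).trans ?_)
    rw [hw]
    refine (Category.assoc _ _ _).trans ?_
    rw [← proj_proj_comp_associator_inv]
    exact (congrArg (· ≫ _) (whiskerLeft_comp _ _ _)).trans (Category.assoc _ _ _)
  obtain ⟨g, hg⟩ : ∃ g : (M.tensorBimod N).X ⟶ 𝒜.alg.X, counit.hom = g := ⟨_, rfl⟩
  have h2 : proj (M.tensorBimod N) M ≫ (Bimod.whiskerRight counit M).hom ≫
      (Bimod.leftUnitorBimod M).hom.hom = g ▷ M.X ≫ M.actLeft := by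
    rw [← Category.assoc, proj_comp_whiskerRight, Category.assoc, proj_comp_leftUnitor_hom, hg]
    rfl
  have h3 : e ▷ M.X = proj M N ▷ M.X ≫ g ▷ M.X := by
    rw [← comp_whiskerRight, ← hg]
    exact congrArg (· ▷ M.X) he.symm
  refine Eq.trans ?_ right
  rw [h3, Category.assoc, ← h2]
  simp only [Bimod.comp_hom']
  refine Eq.trans ?_ ((congrArg (· ≫ (Bimod.whiskerRight counit M).hom ≫
    (Bimod.leftUnitorBimod M).hom.hom) h1).trans ?_)
  · exact ((Category.assoc _ _ _).trans (congrArg (_ ≫ ·) (Category.assoc _ _ _))).symm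
  · exact (Category.assoc _ _ _).trans (congrArg (_ ≫ ·) ((Category.assoc _ _ _).trans
      (congrArg (_ ≫ ·) (Category.assoc _ _ _))))

/-- Two morphisms which satisfy the triangle identities before the passage to the quotients
`M ⊗_B N` and `N ⊗_A M` give a rigidity pair. -/
def adjunctionOfProj (counit : M.tensorBimod N ⟶ Bimod.regular 𝒜.alg)
    (unit : Bimod.regular ℬ.alg ⟶ N.tensorBimod M)
    {e : M.X ⊗ N.X ⟶ 𝒜.alg.X} {w : ℬ.alg.X ⟶ N.X ⊗ M.X}
    (he : proj M N ≫ counit.hom = e) (hw : unit.hom = w ≫ proj N M)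
    (left : w ▷ N.X ≫ (α_ _ _ _).hom ≫ N.X ◁ e ≫ N.actRight = N.actLeft)
    (right : M.X ◁ w ≫ (α_ _ _ _).inv ≫ e ▷ M.X ≫ M.actLeft = M.actRight) :
    Bicategory.Adjunction (show ℬ ⟶ 𝒜 from N) (show 𝒜 ⟶ ℬ from M) where
  unit := unit
  counit := counit
  left_triangle :=
    Eq.trans (by simp [Bicategory.leftZigzag, bicategoricalComp]; rfl)
      (left_triangle_of_proj he hw left)
  right_triangle :=
    Eq.trans (by simp [Bicategory.rightZigzag, bicategoricalComp]; rfl)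
      (right_triangle_of_proj he hw right)

end Compositions

/-! ### Rigidity pairs -/

section RigidityPairs

attribute [local instance] Abelian.hasFiniteBiproducts

variable {T : Type u} [Category.{v} T] [Abelian T] [Linear ℂ T] [MonoidalCategory T]
  [MonoidalPreadditive T] [MonoidalLinear ℂ T] [SemisimpleTensorCategory T] [FrobeniusDuality T]

open HRep Functor.LaxMonoidal Functor.OplaxMonoidal

variable {𝒜 ℬ : HopfIn T}

theorem normFactor_comm (𝒜 ℬ : HopfIn T) : normFactor 𝒜 ℬ = normFactor ℬ 𝒜 := by
  rw [normFactor, normFactor, mul_comm]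

theorem normFactor_mul_self (𝒜 ℬ : HopfIn T) :
    normFactor 𝒜 ℬ * normFactor 𝒜 ℬ = 𝒜.ω * ℬ.ω := by
  rw [normFactor, HopfIn.ω, HopfIn.ω, ← Complex.ofReal_mul, ← Complex.ofReal_mul, mul_mul_mul_comm,
    ← Real.rpow_add 𝒜.size_pos, ← Real.rpow_add ℬ.size_pos]
  norm_num

theorem HopfIn.ω_eq_inv_sqrt (𝒜 : HopfIn T) : 𝒜.ω = ((√𝒜.size : ℝ) : ℂ)⁻¹ := by
  rw [HopfIn.ω, Real.rpow_neg 𝒜.size_pos.le, Real.sqrt_eq_rpow, Complex.ofReal_inv]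

theorem HopfIn.ω_mul_ω_mul_size (𝒜 : HopfIn T) : 𝒜.ω * 𝒜.ω * 𝒜.size = 1 := by
  have h : ((√𝒜.size : ℝ) : ℂ) ≠ 0 := Complex.ofReal_ne_zero.2 (Real.sqrt_pos.2 𝒜.size_pos).ne'
  have h' : (𝒜.size : ℂ) = ((√𝒜.size : ℝ) : ℂ) * ((√𝒜.size : ℝ) : ℂ) := by
    rw [← Complex.ofReal_mul, Real.mul_self_sqrt 𝒜.size_pos.le]
  rw [ω_eq_inv_sqrt, h']
  field_simp

/-- The balance of constants in the triangle identities: two normalized morphisms, the factor `ω_A`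
of the action of `A` and the scalar `|A|` give the factor `ω_B` of the action of `B`. -/
theorem normFactor_sq_mul (𝒜 ℬ : HopfIn T) :
    normFactor 𝒜 ℬ * normFactor 𝒜 ℬ * 𝒜.ω * 𝒜.size = ℬ.ω := by
  rw [normFactor_mul_self]
  linear_combination ℬ.ω * 𝒜.ω_mul_ω_mul_size

namespace DualModules

variable {X Z : T} {ℳ : ModuleStr 𝒜 ℬ X} {𝒩 : ModuleStr ℬ 𝒜 Z}
  {P : DualPair X Z} {P' : DualPair Z X} (h : DualModules ℳ 𝒩 P P')

/-- The copairing is the action on a fixed morphism, so its left linearity is the associativity of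
the action. Its right linearity follows in the same way from the form in `copair_eq`. -/
theorem mulUnit_comp_copair :
    ℬ.mulUnit ≫ copair 𝒩 P = ℬ.unitObj ◁ copair 𝒩 P ≫ (α_ _ _ _).inv ≫ 𝒩.actLeft ▷ X := by
  have e : ℬ.mulUnit ▷ Z ≫ 𝒩.actLeft = (α_ _ _ _).hom ≫ ℬ.unitObj ◁ 𝒩.actLeft ≫ 𝒩.actLeft :=
    𝒩.actLeft_mul
  calc _ = 𝟙 _ ⊗≫ (ℬ.mulUnit ▷ 𝟙_ T ≫ ℬ.unitObj ◁ P.q) ⊗≫ 𝒩.actLeft ▷ X := by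
        simp only [copair]; monoidal
    _ = 𝟙 _ ⊗≫ (ℬ.unitObj ⊗ ℬ.unitObj) ◁ P.q ⊗≫ (ℬ.mulUnit ▷ Z ≫ 𝒩.actLeft) ▷ X := by
        rw [← whisker_exchange]; monoidal
    _ = _ := by rw [e]; simp only [copair]; monoidal

include h in
theorem mulUnit_comp_copair' :
    ℬ.mulUnit ≫ copair 𝒩 P = copair 𝒩 P ▷ ℬ.unitObj ≫ (α_ _ _ _).hom ≫ Z ◁ ℳ.actRight := by
  have e : X ◁ ℬ.mulUnit ≫ ℳ.actRight =
    (α_ _ _ _).inv ≫ ℳ.actRight ▷ ℬ.unitObj ≫ ℳ.actRight := ℳ.actRight_mul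
  rw [h.copair_eq]
  calc _ = 𝟙 _ ⊗≫ (𝟙_ T ◁ ℬ.mulUnit ≫ P.q ▷ ℬ.unitObj) ⊗≫ Z ◁ ℳ.actRight := by monoidal
    _ = 𝟙 _ ⊗≫ P.q ▷ (ℬ.unitObj ⊗ ℬ.unitObj) ⊗≫ Z ◁ (X ◁ ℬ.mulUnit ≫ ℳ.actRight) := by
        rw [whisker_exchange]; monoidal
    _ = _ := by rw [e]; monoidal

/-- The normalized pairing `X ⊗_B Z ⟶ F(A^*)`. -/
def counit : ℳ.cell ≫ 𝒩.cell ⟶ 𝟙 𝒜 :=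
  descProj (M := ℳ.cell) (N := 𝒩.cell) (normFactor 𝒜 ℬ • ℳ.weightedPairing P.p)
    (by
      change (ℬ.ω • ℳ.actRight) ▷ Z ≫ (normFactor 𝒜 ℬ • ℳ.weightedPairing P.p) =
        (α_ X ℬ.unitObj Z).hom ≫ X ◁ (ℬ.ω • 𝒩.actLeft) ≫ (normFactor 𝒜 ℬ • ℳ.weightedPairing P.p)
      simp only [MonoidalLinear.smul_whiskerRight, MonoidalLinear.whiskerLeft_smul,
        Linear.smul_comp, Linear.comp_smul]
      rw [h.balanced_weightedPairing])
    (by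
      change (𝒜.ω • ℳ.actLeft) ▷ Z ≫ (normFactor 𝒜 ℬ • ℳ.weightedPairing P.p) =
        (α_ 𝒜.unitObj X Z).hom ≫ 𝒜.unitObj ◁ (normFactor 𝒜 ℬ • ℳ.weightedPairing P.p) ≫
          (𝒜.ω • 𝒜.mulUnit)
      simp only [MonoidalLinear.smul_whiskerRight, MonoidalLinear.whiskerLeft_smul,
        Linear.smul_comp, Linear.comp_smul]
      rw [actLeft_weightedPairing, smul_comm])
    (by
      change X ◁ (𝒜.ω • 𝒩.actRight) ≫ (normFactor 𝒜 ℬ • ℳ.weightedPairing P.p) =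
        (α_ X Z 𝒜.unitObj).inv ≫ (normFactor 𝒜 ℬ • ℳ.weightedPairing P.p) ▷ 𝒜.unitObj ≫
          (𝒜.ω • 𝒜.mulUnit)
      simp only [MonoidalLinear.smul_whiskerRight, MonoidalLinear.whiskerLeft_smul,
        Linear.smul_comp, Linear.comp_smul]
      rw [h.actRight_weightedPairing, smul_comm])

/-- The normalized copairing `G(B^*) ⟶ Z ⊗_A X`. -/
def unit : 𝟙 ℬ ⟶ 𝒩.cell ≫ ℳ.cell :=
  liftProj (M := ℳ.cell) (N := 𝒩.cell) (normFactor 𝒜 ℬ • copair 𝒩 P)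
    (by
      change (ℬ.ω • ℬ.mulUnit) ≫ (normFactor 𝒜 ℬ • copair 𝒩 P) =
        ℬ.unitObj ◁ (normFactor 𝒜 ℬ • copair 𝒩 P) ≫ (α_ ℬ.unitObj Z X).inv ≫
          (ℬ.ω • 𝒩.actLeft) ▷ X
      simp only [MonoidalLinear.smul_whiskerRight, MonoidalLinear.whiskerLeft_smul,
        Linear.smul_comp, Linear.comp_smul]
      rw [mulUnit_comp_copair, smul_comm])
    (by
      change (ℬ.ω • ℬ.mulUnit) ≫ (normFactor 𝒜 ℬ • copair 𝒩 P) =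
        (normFactor 𝒜 ℬ • copair 𝒩 P) ▷ ℬ.unitObj ≫ (α_ Z X ℬ.unitObj).hom ≫
          Z ◁ (ℬ.ω • ℳ.actRight)
      simp only [MonoidalLinear.smul_whiskerRight, MonoidalLinear.whiskerLeft_smul,
        Linear.smul_comp, Linear.comp_smul]
      rw [h.mulUnit_comp_copair', smul_comm])

theorem proj_comp_counit : proj ℳ.cell 𝒩.cell ≫ Bimod.Hom.hom h.counit =
    normFactor 𝒜 ℬ • ℳ.weightedPairing P.p :=
  proj_comp_descProj _ _ _ _

theorem unit_hom : Bimod.Hom.hom h.unit =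
    (show ℬ.unitObj ⟶ Z ⊗ X from normFactor 𝒜 ℬ • copair 𝒩 P) ≫ proj 𝒩.cell ℳ.cell :=
  rfl

/-- The normalized rigidity pair of a module and its dual. -/
def adjunction : Bicategory.Adjunction 𝒩.cell ℳ.cell :=
  adjunctionOfProj h.counit h.unit h.proj_comp_counit h.unit_hom
    (by
      change (normFactor 𝒜 ℬ • copair 𝒩 P) ▷ Z ≫ (α_ Z X Z).hom ≫
        Z ◁ (normFactor 𝒜 ℬ • ℳ.weightedPairing P.p) ≫ (𝒜.ω • 𝒩.actRight) = ℬ.ω • 𝒩.actLeft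
      simp only [MonoidalLinear.smul_whiskerRight, MonoidalLinear.whiskerLeft_smul,
        Linear.smul_comp, Linear.comp_smul]
      rw [h.triangle_left, smul_smul, smul_smul, smul_smul, ← normFactor_sq_mul 𝒜 ℬ]
      congr 1
      ring)
    (by
      change X ◁ (normFactor 𝒜 ℬ • copair 𝒩 P) ≫ (α_ X Z X).inv ≫
        (normFactor 𝒜 ℬ • ℳ.weightedPairing P.p) ▷ X ≫ (𝒜.ω • ℳ.actLeft) = ℬ.ω • ℳ.actRight
      simp only [MonoidalLinear.smul_whiskerRight, MonoidalLinear.whiskerLeft_smul,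
        Linear.smul_comp, Linear.comp_smul]
      rw [h.triangle_right, smul_smul, smul_smul, smul_smul, ← normFactor_sq_mul 𝒜 ℬ]
      congr 1
      ring)

end DualModules

/-- The normalized Frobenius duality of a module. -/
def ModuleStr.normalizedDuality {X : T} (ℳ : ModuleStr 𝒜 ℬ X) : NormalizedDuality ℳ where
  dual := ℳ.dualModule
  isTranspose := (ℳ.isTranspose_iff _).2 ℳ.dualModules_dualModule
  pairStar := ℳ.dualModules_dualModule.symm.adjunction
  pair := ℳ.dualModules_dualModule.adjunction
  pairStar_counit := by
    rw [normFactor_comm]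
    exact ℳ.dualModules_dualModule.symm.proj_comp_counit
  pair_counit := ℳ.dualModules_dualModule.proj_comp_counit

end RigidityPairs

/-! ### Dimensions -/

/-- The unit corresponds to the left unitor under the adjunction bijection, whose inverse involves
only the counit. -/
theorem adjunction_unit_eq_of_counit_eq {B : Type*} [Bicategory B] {a b : B} {f : a ⟶ b}
    {g : b ⟶ a} (P Q : Bicategory.Adjunction f g) (h : P.counit = Q.counit) : P.unit = Q.unit := by
  have key : ∀ P : Bicategory.Adjunction f g,
      P.homEquiv₂ (g := 𝟙 a) (h := f) (Bicategory.leftUnitor f).hom = P.unit := fun P => by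
    rw [Bicategory.Adjunction.homEquiv₂_apply]
    bicategory
  refine Q.homEquiv₂.symm.injective (Eq.trans ?_
    ((Equiv.symm_apply_eq (Q.homEquiv₂ (g := 𝟙 a) (h := f))).2 (key Q).symm).symm)
  refine Eq.trans ?_ ((Equiv.symm_apply_eq (P.homEquiv₂ (g := 𝟙 a) (h := f))).2 (key P).symm)
  rw [Bicategory.Adjunction.homEquiv₂_symm_apply, Bicategory.Adjunction.homEquiv₂_symm_apply, h]

section Dimensions

attribute [local instance] Abelian.hasFiniteBiproducts

variable {T : Type u} [Category.{v} T] [Abelian T] [Linear ℂ T] [MonoidalCategory T]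
  [MonoidalPreadditive T] [MonoidalLinear ℂ T] [SemisimpleTensorCategory T] [FrobeniusDuality T]

open HRep Functor.LaxMonoidal Functor.OplaxMonoidal

namespace HRep

variable {A : Type} [Ring A] [HopfAlgebra ℂ A] [FiniteDimensional ℂ A]

/-- Evaluation at an integral, as a morphism from `A^*` to the trivial module. -/
def evalIntegral (l : A) (hl : ∀ a, l * a = Coalgebra.counit (R := ℂ) a • l) :
    funs A ⟶ 𝟙_ (HRep A) :=
  ofLin (V := funs A) (W := triv A) (Module.Dual.eval ℂ A l) fun a =>
    LinearMap.ext fun f : Module.Dual ℂ A => (congrArg f (hl a)).trans (map_smul f _ _)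

theorem funsOne_comp_evalIntegral (l : A) (hl) (h : Coalgebra.counit (R := ℂ) l = 1) :
    funsOne ≫ evalIntegral l hl = 𝟙 (𝟙_ (HRep A)) := by
  refine hom_ext (LinearMap.ext fun z : ℂ => ?_)
  change z * Coalgebra.counit (R := ℂ) l = z
  rw [h, mul_one]

/-- An invariant `φ` of `A^*` satisfies `φ(b a) = ε(a) φ(b)`; at `b = 1` this gives `φ = φ(1) ε`. -/
theorem exists_eq_smul_funsOne (f : 𝟙_ (HRep A) ⟶ funs A) : ∃ s : ℂ, f = s • funsOne := by
  let φ : Module.Dual ℂ A := lin f (1 : ℂ)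
  have hφ : ∀ a, φ a = Coalgebra.counit (R := ℂ) a * φ 1 := fun a => by
    have h := congrArg (fun g : Module.Dual ℂ A => g 1) (LinearMap.congr_fun (lin_comm f a) (1 : ℂ))
    have h1 : φ (1 * a) = Coalgebra.counit (R := ℂ) a * φ 1 := by
      exact h.symm.trans <| congrArg (fun g : Module.Dual ℂ A => g 1)
        ((lin f).map_smul (Coalgebra.counit (R := ℂ) a) (1 : ℂ))
    rwa [one_mul] at h1
  refine ⟨φ 1, hom_ext (LinearMap.ext_ring (LinearMap.ext fun a => (hφ a).trans ?_))⟩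
  change _ = φ 1 * ((1 : ℂ) * Coalgebra.counit (R := ℂ) a)
  ring

end HRep

namespace ModuleStr

variable {𝒜 ℬ : HopfIn T} {X : T} (ℳ : ModuleStr 𝒜 ℬ X)

theorem left_inv_unit :
    (ℳ.left (𝟙_ (HRep 𝒜.A))).inv (1 : ℂ) = (λ_ X).inv ≫ ε 𝒜.F ▷ X :=
  (ℳ.left (𝟙_ (HRep 𝒜.A))).ext_hom fun f => by
    obtain ⟨z, hz⟩ : ∃ z : ℂ, f (1 : ℂ) = z := ⟨_, rfl⟩
    have hf : f = z • unitDual 𝒜.A := by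
      rw [← hz]
      exact LinearMap.ext_ring (mul_one _).symm
    have h : ε 𝒜.F ▷ X ≫ (ℳ.left (𝟙_ (HRep 𝒜.A))).hom (unitDual 𝒜.A) = (λ_ X).hom := ℳ.left_unit
    refine (MultipleIso.inv_hom _ _ _).trans ((congrArg (· • 𝟙 X) hz).trans ?_)
    rw [hf, map_smul, Linear.comp_smul, Category.assoc, h, Iso.inv_hom_id]

/-- The weighted pairing of a copairing. -/
theorem comp_weightedPairing {Z : T} {q : 𝟙_ T ⟶ X ⊗ Z} {p : X ⊗ Z ⟶ 𝟙_ T} {d : ℂ}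
    (h : q ≫ p = d • 𝟙 (𝟙_ T)) :
    q ≫ ℳ.weightedPairing p = d • (ε 𝒜.F ≫ 𝒜.F.map funsOne) := by
  -- By fullness the composite comes from an invariant of `A^*`, so it is `s` times the unit.
  -- Evaluation at the normalized integral `l` determines `s`, because `ε(l) = χ(l) = 1`.
  obtain ⟨l, -, hl, h1⟩ := exists_integral (A := 𝒜.A) 𝒜.antipode_antipode
  obtain ⟨s, hs⟩ := exists_eq_smul_funsOne (𝒜.F.preimage (η 𝒜.F ≫ q ≫ ℳ.weightedPairing p))
  have e : q ≫ ℳ.weightedPairing p = s • (ε 𝒜.F ≫ 𝒜.F.map funsOne) := by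
    rw [← Linear.comp_smul, ← Functor.map_smul, ← hs, Functor.map_preimage,
      Functor.Monoidal.ε_η_assoc]
  -- Evaluation at `l` collapses the inserted character to `χ(l) = 1`, so only `p` is left.
  have e1 : ℳ.weightedPairing p ≫ 𝒜.F.map (evalIntegral l hl) = p ≫ ε 𝒜.F := by
    have hi : (ℳ.left (funs 𝒜.A)).inv (regChar 𝒜) ≫ 𝒜.F.map (evalIntegral l hl) ▷ X =
        (λ_ X).inv ≫ ε 𝒜.F ▷ X := by
      rw [ℳ.left_inv_natural, ← ℳ.left_inv_unit]
      exact congrArg _ (regTrace_integral hl h1)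
    rw [weightedPairing]
    set i := (ℳ.left (funs 𝒜.A)).inv (regChar 𝒜)
    calc _ = i ▷ Z ⊗≫ (𝒜.unitObj ◁ p ≫ 𝒜.F.map (evalIntegral l hl) ▷ 𝟙_ T) ⊗≫ 𝟙 _ := by monoidal
      _ = (i ≫ 𝒜.F.map (evalIntegral l hl) ▷ X) ▷ Z ⊗≫ 𝒜.F.obj (𝟙_ _) ◁ p ⊗≫ 𝟙 _ := by
        rw [whisker_exchange]; monoidal
      _ = 𝟙 _ ⊗≫ (ε 𝒜.F ▷ (X ⊗ Z) ≫ 𝒜.F.obj (𝟙_ _) ◁ p) ⊗≫ 𝟙 _ := by rw [hi]; monoidal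
      _ = _ := by rw [← whisker_exchange]; monoidal
  have e2 : s • 𝟙 (𝟙_ T) = d • 𝟙 (𝟙_ T) := by
    have := congrArg (· ≫ 𝒜.F.map (evalIntegral l hl) ≫ η 𝒜.F) e
    simp only [Category.assoc, Linear.smul_comp] at this
    rw [reassoc_of% e1, reassoc_of% h, ← Functor.map_comp_assoc, funsOne_comp_evalIntegral l hl h1,
      CategoryTheory.Functor.map_id, Category.id_comp, Functor.Monoidal.ε_η] at this
    rw [← this, Linear.smul_comp, Category.id_comp]
  rw [e, (SemisimpleTensorCategory.end_unit (d • 𝟙 (𝟙_ T))).unique e2.symm rfl]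

end ModuleStr

namespace HopfIn

theorem unit_mulUnit (𝒜 : HopfIn T) :
    𝒜.unitObj ◁ (ε 𝒜.F ≫ 𝒜.F.map funsOne) ≫ 𝒜.mulUnit = (ρ_ 𝒜.unitObj).hom :=
  letI := 𝒜.F.monObjObj (funs 𝒜.A)
  MonObj.mul_one 𝒜.unitObj

end HopfIn

namespace DualModules

variable {𝒜 ℬ : HopfIn T} {X Z : T} {ℳ : ModuleStr 𝒜 ℬ X} {𝒩 : ModuleStr ℬ 𝒜 Z}
  {P : DualPair X Z} {P' : DualPair Z X} (h : DualModules ℳ 𝒩 P P')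

/-- The copairing is the action of `F(A^*)` on `P'.q`. Linearity of the weighted pairing moves the
action outside, where it becomes multiplication by `d` times the unit of `F(A^*)`. -/
theorem copair_weightedPairing {d : ℂ} (hd : P'.q ≫ P.p = d • 𝟙 (𝟙_ T)) :
    copair ℳ P' ≫ ℳ.weightedPairing P.p = d • 𝟙 𝒜.unitObj := by
  rw [copair, Category.assoc, Category.assoc, Category.assoc, actLeft_weightedPairing,
    Iso.inv_hom_id_assoc, ← whiskerLeft_comp_assoc, ℳ.comp_weightedPairing hd,
    MonoidalLinear.whiskerLeft_smul, Linear.smul_comp, Linear.comp_smul, HopfIn.unit_mulUnit,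
    Iso.inv_hom_id]

theorem unit_comp_counit {d : ℂ} (hd : P'.q ≫ P.p = d • 𝟙 (𝟙_ T)) :
    Bimod.Hom.hom (h.symm.unit ≫ h.counit) = (𝒜.ω * ℬ.ω * d) • 𝟙 𝒜.unitObj := by
  refine (Category.assoc (normFactor ℬ 𝒜 • copair ℳ P') (proj ℳ.cell 𝒩.cell)
    (Bimod.Hom.hom h.counit)).trans ((congrArg (_ ≫ ·) h.proj_comp_counit).trans ?_)
  change (normFactor ℬ 𝒜 • copair ℳ P') ≫ (normFactor 𝒜 ℬ • ℳ.weightedPairing P.p) = _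
  rw [Linear.smul_comp, Linear.comp_smul, copair_weightedPairing hd, smul_smul, smul_smul,
    normFactor_comm ℬ 𝒜, normFactor_mul_self]

end DualModules

/-- The transposition condition provides `DualModules` for the dual in `D`. The projections are
epimorphisms, so the counits of `D` are the constructed ones, and so are its units. Neutrality makes
both scalars `dim X`. -/
theorem NormalizedDuality.hasDim {𝒜 ℬ : HopfIn T} {X : T} {ℳ : ModuleStr 𝒜 ℬ X}
    (D : NormalizedDuality ℳ) :
    D.HasDim (dim X / ((√𝒜.size : ℝ) * (√ℬ.size : ℝ) : ℂ)) := by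
  have h := (ℳ.isTranspose_iff D.dual).1 D.isTranspose
  have e1 : D.pair.counit = h.counit :=
    Bimod.hom_ext _ _ ((cancel_epi (proj ℳ.cell D.dual.cell)).1
      (D.pair_counit.trans h.proj_comp_counit.symm))
  have e2 : D.pairStar.counit = h.symm.counit :=
    Bimod.hom_ext _ _ ((cancel_epi (proj D.dual.cell ℳ.cell)).1
      (D.pairStar_counit.trans (by rw [normFactor_comm]; exact h.symm.proj_comp_counit.symm)))
  have e3 : D.pair.unit = h.unit := adjunction_unit_eq_of_counit_eq D.pair h.adjunction e1
  have e4 : D.pairStar.unit = h.symm.unit :=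
    adjunction_unit_eq_of_counit_eq D.pairStar h.symm.adjunction e2
  have hd : dim X / ((√𝒜.size : ℝ) * (√ℬ.size : ℝ) : ℂ) = 𝒜.ω * ℬ.ω * dim X := by
    rw [HopfIn.ω_eq_inv_sqrt, HopfIn.ω_eq_inv_sqrt, ← mul_inv, div_eq_inv_mul]
  have h1 : coevStar X ≫ ev X = dim X • 𝟙 (𝟙_ T) := dim_spec X
  have h2 : coev X ≫ evStar X = dim X • 𝟙 (𝟙_ T) := by
    have := FrobeniusDuality.neutral (𝟙 X)
    rw [id_whiskerRight, whiskerLeft_id, Category.id_comp, Category.id_comp] at this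
    exact this.symm.trans h1
  refine ⟨?_, ?_⟩
  · rw [e1, e4, hd]
    exact h.unit_comp_counit h1
  · rw [e2, e3, hd, mul_comm 𝒜.ω]
    exact h.symm.unit_comp_counit h2

end Dimensions

end HopfBicat

end

theorem mainTheorem3 {T : Type u} [Category.{v} T] [Abelian T] [Linear ℂ T] [MonoidalCategory T]
    [MonoidalPreadditive T] [MonoidalLinear ℂ T] [HopfBicat.SemisimpleTensorCategory T]
    [HopfBicat.FrobeniusDuality T] (𝒜 ℬ : HopfBicat.HopfIn T) (X : T)
    (ℳ : HopfBicat.ModuleStr 𝒜 ℬ X) :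
    Nonempty (HopfBicat.NormalizedDuality ℳ) ∧
      ∀ D : HopfBicat.NormalizedDuality ℳ,
        D.HasDim (HopfBicat.dim X / ((√𝒜.size : ℝ) * (√ℬ.size : ℝ) : ℂ)) := by
  exact ⟨⟨ℳ.normalizedDuality⟩, fun D => D.hasDim⟩
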